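/- Let $\mathbb{T}=\mathbb{R}/2\pi\mathbb{Z}$. For $c>0$ let $u_c(\xi)=\sqrt{2c}\,\operatorname{sech}(\sqrt{c}\,\xi)$ be the line soliton, $L_c=-\partial_\xi^2+c-3u_c^2$, and consider the stationary equation $$-\partial_{\xi}^2u-\partial_{y}^2u+cu-u^3=0\quad\text{in }\mathbb{R}\times\mathbb{T}.\tag{TW}$$ Let $H^2_{\rm even}=\{u\in H^2(\mathbb{R}\times\mathbb{T};\mathbb{R}):u(-\xi,y)=u(\xi,y)=u(\xi,-y)\}$, $c_*=\tfrac13$ and $\psi_*(\xi)=2c_*\operatorname{sech}^2(\sqrt{c_*}\,\xi)$. Let $w_0,w_2\in H^2(\mathbb{R})$, with $w_0$ even, be the solutions of $$L_{c_*}w_0=\tfrac32u_{c_*}\psi_*^2,\qquad (L_{c_*}+4)w_2=\tfrac32u_{c_*}\psi_*^2,$$ and put $$\alpha=8c_*^{3/2},\qquad \beta=\tfrac32\langle\psi_*^2u_{c_*},2w_0+w_2\rangle_{L^2(\mathbb{R})}+\tfrac38\|\psi_*\|_{L^4(\mathbb{R})}^4 .$$ Then these solutions $w_0,w_2$ exist,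 $\alpha>0$ and $\beta<0$, and there are $c_+>c_*$ and $A>0$ such that for every $c\in(c_*,c_+)$ the following holds. The line soliton $u_c$ is a solution of (TW) in $H^2_{\rm even}$; the equation $\alpha(c-c_*)b+\beta b^3=0$ has a nonzero real root $b$; and for every such root $b$, equation (TW) has a solution $u_b\in H^2_{\rm even}$, different from $0$ and from $u_c$, of the form $$u_b(\xi,y)=u_{c_*}(\xi)+b\cos(y)\psi_*(\xi)+\tilde u_b(\xi,y),\qquad \tilde u_b\in H^2_{\rm even},\quad \|\tilde u_b\|_{H^2}\le A\,b^2,$$ where $A$ does not depend on $b$ and $c$. -/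

import Mathlib

open MeasureTheory Filter
open scoped ENNReal

noncomputable section

/-! ### Functions on the line with two weak derivatives -/

/-- `g` is the weak derivative of `w` on the real line. -/
def IsWeakDerivLine (w g : ℝ → ℝ) : Prop :=
  ∀ φ : ℝ → ℝ, ContDiff ℝ ((⊤ : ℕ∞) : WithTop ℕ∞) φ → HasCompactSupport φ →
    ∫ x, w x * deriv φ x = -∫ x, g x * φ x

/-- Weak derivatives of `w` up to order two, all in `L²(ℝ)`; such data exist if and only if
`w` belongs to `H²(ℝ)`, and they are then unique almost everywhere. -/
structure H2DataLine (w : ℝ → ℝ) where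
  d : ℝ → ℝ
  dd : ℝ → ℝ
  memLp : MemLp w 2
  memLp_d : MemLp d 2
  memLp_dd : MemLp dd 2
  weak_d : IsWeakDerivLine w d
  weak_dd : IsWeakDerivLine d dd

/-! ### The cylinder `ℝ × 𝕋` with `𝕋 = ℝ / 2πℤ` -/

instance factTwoPiPos : Fact (0 < 2 * Real.pi) := ⟨Real.two_pi_pos⟩

/-- The torus `𝕋 = ℝ / 2πℤ`; its volume is Lebesgue measure, of total mass `2π`. -/
abbrev Torus : Type := AddCircle (2 * Real.pi)

/-- The cylinder `ℝ × 𝕋`, with variables `(ξ, y)`. -/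
abbrev Cylinder : Type := ℝ × Torus

/-- The classical partial derivative in `ξ`. -/
def partialXi (φ : Cylinder → ℝ) (p : Cylinder) : ℝ :=
  deriv (fun s : ℝ => φ (s, p.2)) p.1

/-- The classical partial derivative in `y`. -/
def partialY (φ : Cylinder → ℝ) (p : Cylinder) : ℝ :=
  deriv (fun t : ℝ => φ (p.1, p.2 + (t : Torus))) 0

/-- Smooth compactly supported functions on the cylinder. -/
structure IsTestFunction (φ : Cylinder → ℝ) : Prop where
  smooth : ContDiff ℝ ((⊤ : ℕ∞) : WithTop ℕ∞) (fun q : ℝ × ℝ => φ (q.1, (q.2 : Torus)))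
  compactSupport : HasCompactSupport φ

/-- `g` is the weak partial derivative of `u` in `ξ`. -/
def IsWeakPartialXi (u g : Cylinder → ℝ) : Prop :=
  ∀ φ : Cylinder → ℝ, IsTestFunction φ → ∫ p, u p * partialXi φ p = -∫ p, g p * φ p

/-- `g` is the weak partial derivative of `u` in `y`. -/
def IsWeakPartialY (u g : Cylinder → ℝ) : Prop :=
  ∀ φ : Cylinder → ℝ, IsTestFunction φ → ∫ p, u p * partialY φ p = -∫ p, g p * φ p

/-- Weak partial derivatives of `u` up to order two, all in `L²(ℝ × 𝕋)`; such data exist if and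
only if `u` belongs to `H²(ℝ × 𝕋)`, and they are then unique almost everywhere. -/
structure H2Data (u : Cylinder → ℝ) where
  dx : Cylinder → ℝ
  dy : Cylinder → ℝ
  dxx : Cylinder → ℝ
  dxy : Cylinder → ℝ
  dyy : Cylinder → ℝ
  memLp : MemLp u 2
  memLp_dx : MemLp dx 2
  memLp_dy : MemLp dy 2
  memLp_dxx : MemLp dxx 2
  memLp_dxy : MemLp dxy 2
  memLp_dyy : MemLp dyy 2
  weak_dx : IsWeakPartialXi u dx
  weak_dy : IsWeakPartialY u dy
  weak_dxx : IsWeakPartialXi dx dxx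
  weak_dxy : IsWeakPartialY dx dxy
  weak_dyy : IsWeakPartialY dy dyy

/-- The `H²` norm computed from the weak derivatives: the square root of the sum of the squared
`L²` norms of all derivatives of order at most two. -/
def H2Data.norm {u : Cylinder → ℝ} (J : H2Data u) : ℝ≥0∞ :=
  (eLpNorm u 2 volume ^ 2 + eLpNorm J.dx 2 volume ^ 2 + eLpNorm J.dy 2 volume ^ 2
    + eLpNorm J.dxx 2 volume ^ 2 + eLpNorm J.dxy 2 volume ^ 2
    + eLpNorm J.dyy 2 volume ^ 2) ^ (1 / 2 : ℝ)

/-- The `H²(ℝ × 𝕋)` norm. All `H2Data` of `u` have the same norm, so the infimum is its common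
value; it is `∞` when `u` is not in `H²`. -/
def h2Norm (u : Cylinder → ℝ) : ℝ≥0∞ := ⨅ J : H2Data u, J.norm

/-- `u ∈ H²_even`: `u ∈ H²(ℝ × 𝕋)` and `u(-ξ, y) = u(ξ, y) = u(ξ, -y)`. -/
def MemH2Even (u : Cylinder → ℝ) : Prop :=
  Nonempty (H2Data u) ∧
    (∀ᵐ p : Cylinder, u (-p.1, p.2) = u p) ∧ (∀ᵐ p : Cylinder, u (p.1, -p.2) = u p)

/-- `u ∈ H²(ℝ × 𝕋)` solves `-u_ξξ - u_yy + c u - u³ = 0`. -/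
def SolvesTW (c : ℝ) (u : Cylinder → ℝ) : Prop :=
  ∃ J : H2Data u, ∀ᵐ p : Cylinder, -J.dxx p - J.dyy p + c * u p - u p ^ 3 = 0

/-! ### The line soliton and the coefficients of the normal form -/

/-- The line soliton `u_c(ξ) = √(2c) sech(√c ξ)`. -/
def lineSoliton (c ξ : ℝ) : ℝ := Real.sqrt (2 * c) / Real.cosh (Real.sqrt c * ξ)

/-- The critical speed. -/
def cStar : ℝ := 1 / 3

/-- `ψ_*(ξ) = 2 c_* sech²(√c_* ξ)`. -/
def psiStar (ξ : ℝ) : ℝ := 2 * cStar / Real.cosh (Real.sqrt cStar * ξ) ^ 2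

/-- The function `cos` on `𝕋`. -/
def cosTorus : Torus → ℝ := Real.cos_periodic.lift

/-- `w ∈ H²(ℝ)` solves `(L_{c_*} + κ) w = (3/2) u_{c_*} ψ_*²`, where
`L_c = -∂² + c - 3 u_c²`. -/
def SolvesCorrector (κ : ℝ) (w : ℝ → ℝ) : Prop :=
  ∃ J : H2DataLine w, ∀ᵐ ξ : ℝ,
    (-J.dd ξ + cStar * w ξ - 3 * lineSoliton cStar ξ ^ 2 * w ξ) + κ * w ξ
      = 3 / 2 * lineSoliton cStar ξ * psiStar ξ ^ 2

/-- `α = 8 c_*^{3/2}`. -/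
def alphaCoeff : ℝ := 8 * cStar ^ (3 / 2 : ℝ)

/-- `β = (3/2) ⟨ψ_*² u_{c_*}, 2 w₀ + w₂⟩ + (3/8) ‖ψ_*‖⁴_{L⁴}`. -/
def betaCoeff (w₀ w₂ : ℝ → ℝ) : ℝ :=
  3 / 2 * (∫ ξ, psiStar ξ ^ 2 * lineSoliton cStar ξ * (2 * w₀ ξ + w₂ ξ))
    + 3 / 8 * ∫ ξ, psiStar ξ ^ 4

end

/-!
The branch is constructed by a Lyapunov–Schmidt reduction at the critical soliton, carried out in
an algebra of cosine series with exponentially decaying coefficients rather than in `H²`.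

*Rescaling.* With `c = κ²` and `s = κ ξ`, a solution is written
`u = κ (Q + V)(s, y)`, `Q = √2 sech`. If `δ² = 3 - 1/c`, the `k`-th cosine coefficient of `V` solves
`-V_k'' + (1 + 3k² - 6 sech²) V_k = (δ² (-∂_y²) V + 3 Q V² + V³)_k`,
so that the operators on the left do not depend on `c`. They are Pöschl–Teller operators, whose
homogeneous solutions are elementary (`greenPairOne`, `greenPairTwo`, `greenPairLarge`); the
explicit Green functions invert them on even functions bounded by a multiple of `e^{-|s|/2}`, with
a gain of two derivatives in `y` (`exists_resolvent`). The only obstruction is the bound state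
`sech²` at frequency `k = 1`, the rescaled `ψ_*`.

*Reduction.* The sequences of coefficients form a Banach algebra `Modes` of Wiener type. Putting
`V = δ (r e + δ S H)`, with `e = sech² cos y`, `S` the resolvents and `H` orthogonal to the bound
state, and dividing out the powers of `δ`, the equation becomes a smooth system for
`(r, K)`, `H = 3 r² Q e² + δ K`, which at `δ = 0` reduces to the scalar equation `r + p r³ = 0` with
`p` a positive multiple of `β`. When `β < 0` the root `r₀ > 0` is simple, and the implicit function
theorem continues it to small `δ` (`Bifurcation.exists_branch`, `exists_modes_branch`). A root `b`
of the normal form corresponds to `δ = 2b / (3 κ r₀)`; the sign of `δ` is that of `b`.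

*Sign of `β`.* In rescaled variables `β` is a positive multiple of
`72 ∫ sech⁵ (2 z₀ + z₂) + 192/35`, where `z₀`, `z₂` are the rescaled `w₀`, `w₂`.
The term with `z₀` is computed from the explicit solution `sech³/6 - sech/3` of the equation for
`z₀`, and the one with `z₂` is at most `(1/7) ∫ sech¹⁰`, since `-∂² + 13 - 6 sech² ≥ 7`
(`reducedCubic_neg`).

*Back to the cylinder.* Series whose coefficients decay exponentially and are summable together with
those of their derivatives are classical, hence weak, solutions, and their `H²` norm is bounded by
the sum of the coefficients (`CoeffBound₂.h2Norm_le`). This yields membership in `H²_even` and the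
estimate `O(δ²) = O(b²)` for the remainder (`exists_bifurcating_solutions`).
-/

open scoped BoundedContinuousFunction

noncomputable section

/-! ### The hyperbolic secant -/

/-- The hyperbolic secant. -/
def sech (s : ℝ) : ℝ := (Real.cosh s)⁻¹

lemma sech_pos (s : ℝ) : 0 < sech s := inv_pos.2 (Real.cosh_pos s)

lemma sech_mul_cosh (s : ℝ) : sech s * Real.cosh s = 1 :=
  inv_mul_cancel₀ (Real.cosh_pos s).ne'

lemma sech_neg (s : ℝ) : sech (-s) = sech s := by simp [sech]

lemma sech_abs (s : ℝ) : sech |s| = sech s := by simp [sech]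

lemma sech_zero : sech 0 = 1 := by simp [sech]

lemma sech_le_one (s : ℝ) : sech s ≤ 1 := inv_le_one_of_one_le₀ (Real.one_le_cosh s)

lemma sech_sq_add_tanh_sq (s : ℝ) : sech s ^ 2 + Real.tanh s ^ 2 = 1 := by
  have h := (Real.cosh_pos s).ne'
  rw [sech, Real.tanh_eq_sinh_div_cosh]
  field_simp
  linarith [Real.cosh_sq s]

lemma tanh_sq_eq (s : ℝ) : Real.tanh s ^ 2 = 1 - sech s ^ 2 := by
  linarith [sech_sq_add_tanh_sq s]

lemma sech_mul_sinh (s : ℝ) : sech s * Real.sinh s = Real.tanh s := by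
  rw [sech, Real.tanh_eq_sinh_div_cosh]; ring

lemma tanh_mul_cosh (s : ℝ) : Real.tanh s * Real.cosh s = Real.sinh s := by
  have h := (Real.cosh_pos s).ne'
  rw [Real.tanh_eq_sinh_div_cosh]; field_simp

lemma hasDerivAt_sech (s : ℝ) : HasDerivAt sech (-(sech s * Real.tanh s)) s := by
  have h := (Real.cosh_pos s).ne'
  convert! (Real.hasDerivAt_cosh s).inv h using 1
  rw [sech, Real.tanh_eq_sinh_div_cosh]
  field_simp

lemma hasDerivAt_tanh (s : ℝ) : HasDerivAt Real.tanh (sech s ^ 2) s := by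
  have h := (Real.cosh_pos s).ne'
  have h1 : Real.tanh = fun s => Real.sinh s / Real.cosh s :=
    funext Real.tanh_eq_sinh_div_cosh
  rw [h1]
  convert! (Real.hasDerivAt_sinh s).div (Real.hasDerivAt_cosh s) h using 1
  rw [sech]
  field_simp
  linarith [Real.cosh_sq s]

lemma continuous_sech : Continuous sech :=
  continuous_iff_continuousAt.2 fun s => (hasDerivAt_sech s).continuousAt

lemma cosh_le_exp {s : ℝ} (hs : 0 ≤ s) : Real.cosh s ≤ Real.exp s := by
  rw [Real.cosh_eq]
  have : Real.exp (-s) ≤ Real.exp s := Real.exp_le_exp.2 (by linarith)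
  linarith

lemma sech_le (s : ℝ) : sech s ≤ 2 * Real.exp (-|s|) := by
  rw [← sech_abs, sech, Real.exp_neg, ← div_eq_mul_inv, ← one_div,
    div_le_div_iff₀ (Real.cosh_pos _) (Real.exp_pos _), Real.cosh_eq]
  linarith [Real.exp_pos (-|s|)]

lemma abs_tanh_le_one (s : ℝ) : |Real.tanh s| ≤ 1 := (Real.abs_tanh_lt_one s).le

lemma tanh_nonneg {s : ℝ} (hs : 0 ≤ s) : 0 ≤ Real.tanh s := by
  rw [Real.tanh_eq_sinh_div_cosh]
  exact div_nonneg (Real.sinh_nonneg_iff.2 hs) (Real.cosh_pos s).le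

/-! ### Green operators on the half-line -/

/-- Two solutions `φ`, `χ` of `y'' = (m² - 6 sech²) y` with Wronskian one, `φ` decaying and `χ`
growing on the half-line `s ≥ 0` at the rates `e^{∓ms}`, together with their derivatives. -/
structure GreenPair (m a b : ℝ) where
  φ : ℝ → ℝ
  dφ : ℝ → ℝ
  χ : ℝ → ℝ
  dχ : ℝ → ℝ
  hasDerivAt_φ : ∀ s, HasDerivAt φ (dφ s) s
  hasDerivAt_dφ : ∀ s, HasDerivAt dφ ((m ^ 2 - 6 * sech s ^ 2) * φ s) s
  hasDerivAt_χ : ∀ s, HasDerivAt χ (dχ s) s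
  hasDerivAt_dχ : ∀ s, HasDerivAt dχ ((m ^ 2 - 6 * sech s ^ 2) * χ s) s
  wronskian : ∀ s, φ s * dχ s - dφ s * χ s = 1
  abs_φ_le : ∀ s, 0 ≤ s → |φ s| ≤ a * Real.exp (-(m * s))
  abs_dφ_le : ∀ s, 0 ≤ s → |dφ s| ≤ m * a * Real.exp (-(m * s))
  abs_χ_le : ∀ s, 0 ≤ s → |χ s| ≤ b * Real.exp (m * s)
  abs_dχ_le : ∀ s, 0 ≤ s → |dχ s| ≤ m * b * Real.exp (m * s)

namespace GreenPair

variable {m a b : ℝ}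

lemma continuous_φ (P : GreenPair m a b) : Continuous P.φ :=
  continuous_iff_continuousAt.2 fun s => (P.hasDerivAt_φ s).continuousAt

lemma continuous_χ (P : GreenPair m a b) : Continuous P.χ :=
  continuous_iff_continuousAt.2 fun s => (P.hasDerivAt_χ s).continuousAt

/-- The Green integral `φ ∫₀ˢ χ F + χ ∫ₛ^∞ φ F`, with the two factors in front of the integrals
replaced by arbitrary functions so that it also describes the derivative. -/
def green (P : GreenPair m a b) (p q F : ℝ → ℝ) (s : ℝ) : ℝ :=
  p s * (∫ t in (0:ℝ)..s, P.χ t * F t)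
    + q s * ((∫ t in Set.Ioi (0:ℝ), P.φ t * F t) - ∫ t in (0:ℝ)..s, P.φ t * F t)

lemma hasDerivAt_green (P : GreenPair m a b) {F : ℝ → ℝ} (hF : Continuous F)
    {p p' q q' : ℝ → ℝ} (hp : ∀ s, HasDerivAt p (p' s) s) (hq : ∀ s, HasDerivAt q (q' s) s)
    (s : ℝ) : HasDerivAt (P.green p q F)
      (P.green p' q' F s + (p s * P.χ s - q s * P.φ s) * F s) s := by
  have h1 : HasDerivAt (fun s => ∫ t in (0:ℝ)..s, P.χ t * F t) (P.χ s * F s) s :=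
    (P.continuous_χ.mul hF).integral_hasStrictDerivAt 0 s |>.hasDerivAt
  have h2 : HasDerivAt (fun s => ∫ t in (0:ℝ)..s, P.φ t * F t) (P.φ s * F s) s :=
    (P.continuous_φ.mul hF).integral_hasStrictDerivAt 0 s |>.hasDerivAt
  convert! ((hp s).mul h1).add ((hq s).mul (h2.const_sub
    (∫ t in Set.Ioi (0:ℝ), P.φ t * F t))) using 1
  simp only [green]; ring

lemma hasDerivAt_green_sol (P : GreenPair m a b) {F : ℝ → ℝ} (hF : Continuous F) (s : ℝ) :
    HasDerivAt (P.green P.φ P.χ F) (P.green P.dφ P.dχ F s) s := by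
  convert! P.hasDerivAt_green hF P.hasDerivAt_φ P.hasDerivAt_χ s using 1
  ring

lemma hasDerivAt_green_deriv (P : GreenPair m a b) {F : ℝ → ℝ} (hF : Continuous F) (s : ℝ) :
    HasDerivAt (P.green P.dφ P.dχ F)
      ((m ^ 2 - 6 * sech s ^ 2) * P.green P.φ P.χ F s - F s) s := by
  convert! P.hasDerivAt_green hF P.hasDerivAt_dφ P.hasDerivAt_dχ s using 1
  have := P.wronskian s
  simp only [green]
  linear_combination (F s) * this

/-- The slope at the origin, the obstruction to a twice differentiable even reflection. -/
lemma green_deriv_zero (P : GreenPair m a b) (F : ℝ → ℝ) :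
    P.green P.dφ P.dχ F 0 = P.dχ 0 * ∫ t in Set.Ioi (0:ℝ), P.φ t * F t := by
  simp [green]

lemma a_nonneg (P : GreenPair m a b) : 0 ≤ a := by
  have := (abs_nonneg _).trans (P.abs_φ_le 0 le_rfl); simpa using this

lemma b_nonneg (P : GreenPair m a b) : 0 ≤ b := by
  have := (abs_nonneg _).trans (P.abs_χ_le 0 le_rfl); simpa using this

lemma abs_φ_mul_le (P : GreenPair m a b) {F : ℝ → ℝ} {M : ℝ}
    (hM : ∀ t, 0 ≤ t → |F t| ≤ M * Real.exp (-(t / 2))) {t : ℝ} (ht : 0 ≤ t) :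
    |P.φ t * F t| ≤ a * M * Real.exp (-(m + 1 / 2) * t) := by
  rw [abs_mul]
  calc _ ≤ (a * Real.exp (-(m * t))) * (M * Real.exp (-(t / 2))) :=
        mul_le_mul (P.abs_φ_le t ht) (hM t ht) (abs_nonneg _)
          (mul_nonneg P.a_nonneg (Real.exp_pos _).le)
    _ = a * M * (Real.exp (-(m * t)) * Real.exp (-(t / 2))) := by ring
    _ = _ := by rw [← Real.exp_add]; ring_nf

lemma abs_χ_mul_le (P : GreenPair m a b) {F : ℝ → ℝ} {M : ℝ}
    (hM : ∀ t, 0 ≤ t → |F t| ≤ M * Real.exp (-(t / 2))) {t : ℝ} (ht : 0 ≤ t) :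
    |P.χ t * F t| ≤ b * M * Real.exp ((m - 1 / 2) * t) := by
  rw [abs_mul]
  calc _ ≤ (b * Real.exp (m * t)) * (M * Real.exp (-(t / 2))) :=
        mul_le_mul (P.abs_χ_le t ht) (hM t ht) (abs_nonneg _)
          (mul_nonneg P.b_nonneg (Real.exp_pos _).le)
    _ = b * M * (Real.exp (m * t) * Real.exp (-(t / 2))) := by ring
    _ = _ := by rw [← Real.exp_add]; ring_nf

lemma integrableOn_φ_mul (P : GreenPair m a b) (hm : 1 ≤ m) {F : ℝ → ℝ} (hF : Continuous F)
    {M : ℝ} (hM : ∀ t, 0 ≤ t → |F t| ≤ M * Real.exp (-(t / 2))) :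
    IntegrableOn (fun t => P.φ t * F t) (Set.Ioi 0) := by
  have h : IntegrableOn (fun t => a * M * Real.exp (-(m + 1 / 2) * t)) (Set.Ioi 0) :=
    (integrableOn_exp_mul_Ioi (by linarith) 0).const_mul _
  refine h.mono' (P.continuous_φ.mul hF).aestronglyMeasurable ?_
  filter_upwards [ae_restrict_mem measurableSet_Ioi] with t ht
  exact P.abs_φ_mul_le hM (le_of_lt ht)

/-- The bound `|φ ∫₀ˢ χ F| + |χ ∫ₛ^∞ φ F| ≲ e^{-s/2}`; the constant `3ab/m` is what makes the
Green operators of high frequency gain two derivatives. -/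
lemma abs_green_le (P : GreenPair m a b) (hm : 1 ≤ m) {F : ℝ → ℝ} (hF : Continuous F)
    {M : ℝ} (hM : ∀ t, 0 ≤ t → |F t| ≤ M * Real.exp (-(t / 2))) {p q : ℝ → ℝ} {κ s : ℝ}
    (hκ : 0 ≤ κ) (hs : 0 ≤ s) (hp : |p s| ≤ κ * a * Real.exp (-(m * s)))
    (hq : |q s| ≤ κ * b * Real.exp (m * s)) :
    |P.green p q F s| ≤ κ * (3 * (a * b) / m) * M * Real.exp (-(s / 2)) := by
  have ha := P.a_nonneg
  have hb := P.b_nonneg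
  have hm0 : (0:ℝ) < m - 1 / 2 := by linarith
  have hm1 : (0:ℝ) < m + 1 / 2 := by linarith
  have hM0 : 0 ≤ M := by simpa using (abs_nonneg _).trans (hM 0 le_rfl)
  have h1 : |∫ t in (0:ℝ)..s, P.χ t * F t| ≤ b * M * (2 / m * Real.exp ((m - 1 / 2) * s)) := by
    calc _ ≤ |∫ t in (0:ℝ)..s, b * M * Real.exp ((m - 1 / 2) * t)| := by
          rw [← Real.norm_eq_abs]
          refine intervalIntegral.norm_integral_le_abs_of_norm_le ?_ ?_
          · refine ae_restrict_of_forall_mem measurableSet_uIoc fun t ht => ?_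
            rw [Set.uIoc_of_le hs] at ht
            exact P.abs_χ_mul_le hM ht.1.le
          · exact (by fun_prop : Continuous fun t : ℝ =>
              b * M * Real.exp ((m - 1 / 2) * t)).intervalIntegrable _ _
      _ = b * M * ((Real.exp ((m - 1 / 2) * s) - 1) / (m - 1 / 2)) := by
          rw [intervalIntegral.integral_const_mul,
            intervalIntegral.integral_comp_mul_left (fun x => Real.exp x) hm0.ne', integral_exp,
            smul_eq_mul, inv_mul_eq_div, abs_of_nonneg]
          · simp
          · have : 1 ≤ Real.exp ((m - 1 / 2) * s) := Real.one_le_exp (by positivity)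
            simp only [mul_zero, Real.exp_zero]
            exact mul_nonneg (by positivity) (div_nonneg (by linarith) hm0.le)
      _ ≤ _ := by
          refine mul_le_mul_of_nonneg_left ?_ (by positivity)
          rw [div_mul_eq_mul_div, div_le_div_iff₀ hm0 (by linarith)]
          nlinarith [Real.exp_pos ((m - 1 / 2) * s)]
  have hi := P.integrableOn_φ_mul hm hF hM
  have h2 : |(∫ t in Set.Ioi (0:ℝ), P.φ t * F t) - ∫ t in (0:ℝ)..s, P.φ t * F t|
      ≤ a * M * (1 / m * Real.exp (-(m + 1 / 2) * s)) := by
    rw [← intervalIntegral.integral_Ioi_sub_Ioi hi hs, sub_sub_cancel]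
    have hi' : IntegrableOn (fun t => a * M * Real.exp (-(m + 1 / 2) * t)) (Set.Ioi s) :=
      (integrableOn_exp_mul_Ioi (by linarith) s).const_mul _
    calc _ ≤ ∫ t in Set.Ioi s, a * M * Real.exp (-(m + 1 / 2) * t) := by
          rw [← Real.norm_eq_abs]
          refine norm_integral_le_of_norm_le hi' ?_
          filter_upwards [ae_restrict_mem measurableSet_Ioi] with t ht
          exact P.abs_φ_mul_le hM (hs.trans (le_of_lt ht))
      _ = a * M * (1 / (m + 1 / 2) * Real.exp (-(m + 1 / 2) * s)) := by
          rw [integral_const_mul, integral_exp_mul_Ioi (by linarith)]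
          congr 1
          rw [neg_div, div_neg, neg_neg]; ring
      _ ≤ _ := by
          gcongr
          linarith
  have e1 : Real.exp (-(m * s)) * Real.exp ((m - 1 / 2) * s) = Real.exp (-(s / 2)) := by
    rw [← Real.exp_add]; ring_nf
  have e2 : Real.exp (m * s) * Real.exp (-(m + 1 / 2) * s) = Real.exp (-(s / 2)) := by
    rw [← Real.exp_add]; ring_nf
  calc |P.green p q F s| ≤ |p s| * |∫ t in (0:ℝ)..s, P.χ t * F t|
        + |q s| * |(∫ t in Set.Ioi (0:ℝ), P.φ t * F t) - ∫ t in (0:ℝ)..s, P.φ t * F t| := by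
        rw [green, ← abs_mul, ← abs_mul]; exact abs_add_le _ _
    _ ≤ (κ * a * Real.exp (-(m * s))) * (b * M * (2 / m * Real.exp ((m - 1 / 2) * s)))
        + (κ * b * Real.exp (m * s)) * (a * M * (1 / m * Real.exp (-(m + 1 / 2) * s))) := by
        gcongr
    _ = κ * (a * b) * M * (2 / m) * (Real.exp (-(m * s)) * Real.exp ((m - 1 / 2) * s))
        + κ * (a * b) * M * (1 / m) * (Real.exp (m * s) * Real.exp (-(m + 1 / 2) * s)) := by ring
    _ = _ := by rw [e1, e2]; ring

end GreenPair

/-! ### Even reflection -/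

/-- The derivative of the even reflection `s ↦ w |s|`, where `w'` is the derivative of `w`. -/
def oddReflect (w' : ℝ → ℝ) (s : ℝ) : ℝ := if 0 ≤ s then w' s else -w' (-s)

lemma abs_oddReflect (w' : ℝ → ℝ) (s : ℝ) : |oddReflect w' s| = |w' (|s|)| := by
  unfold oddReflect
  split_ifs with h
  · rw [abs_of_nonneg h]
  · rw [abs_neg, abs_of_neg (not_le.1 h)]

/-- Gluing along the two half-lines: a function that agrees on each of them with a function of
derivative `d` has derivative `d`. -/
lemma hasDerivAt_of_halflines {f : ℝ → ℝ} {g h : ℝ → ℝ} {s d : ℝ}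
    (hg : 0 ≤ s → HasDerivAt g d s) (hh : s ≤ 0 → HasDerivAt h d s)
    (hfg : ∀ t, 0 ≤ t → f t = g t) (hfh : ∀ t, t ≤ 0 → f t = h t) : HasDerivAt f d s := by
  rcases lt_trichotomy s 0 with hs | rfl | hs
  · refine (hh hs.le).congr_of_eventuallyEq ?_
    filter_upwards [Iio_mem_nhds hs] with t ht using hfh t (le_of_lt ht)
  · have h1 : HasDerivWithinAt f d (Set.Ici 0) 0 :=
      (hg le_rfl).hasDerivWithinAt.congr (fun t ht => hfg t ht) (hfg 0 le_rfl)
    have h2 : HasDerivWithinAt f d (Set.Iic 0) 0 :=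
      (hh le_rfl).hasDerivWithinAt.congr (fun t ht => hfh t ht) (hfh 0 le_rfl)
    have := h2.union h1
    rwa [Set.Iic_union_Ici, hasDerivWithinAt_univ] at this
  · refine (hg hs.le).congr_of_eventuallyEq ?_
    filter_upwards [Ioi_mem_nhds hs] with t ht using hfg t (le_of_lt ht)

/-- The even reflection is differentiable because the one-sided derivative vanishes at the
origin. -/
lemma hasDerivAt_comp_abs {w w' : ℝ → ℝ} (hw : ∀ s, HasDerivAt w (w' s) s) (h0 : w' 0 = 0)
    (s : ℝ) : HasDerivAt (fun s => w |s|) (oddReflect w' s) s := by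
  refine hasDerivAt_of_halflines (g := w) (h := fun s => w (-s)) (fun hs => ?_) (fun hs => ?_)
    (fun t ht => by rw [abs_of_nonneg ht]) (fun t ht => by rw [abs_of_nonpos ht])
  · simpa [oddReflect, hs] using hw s
  · have h1 := (hw (-s)).scomp s (hasDerivAt_neg s)
    rcases hs.lt_or_eq with h | rfl
    · simpa [oddReflect, not_le.2 h, Function.comp_def] using h1
    · simpa [oddReflect, h0, Function.comp_def] using h1

lemma hasDerivAt_oddReflect {w' w'' : ℝ → ℝ} (hw : ∀ s, HasDerivAt w' (w'' s) s)
    (h0 : w' 0 = 0) (s : ℝ) : HasDerivAt (oddReflect w') (w'' |s|) s := by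
  refine hasDerivAt_of_halflines (g := w') (h := fun s => -w' (-s)) (fun hs => ?_) (fun hs => ?_)
    (fun t ht => by simp [oddReflect, ht]) (fun t ht => ?_)
  · simpa [abs_of_nonneg hs] using hw s
  · have h1 := ((hw (-s)).scomp s (hasDerivAt_neg s)).neg
    convert! h1 using 1
    simp [abs_of_nonpos hs]
  · rcases ht.lt_or_eq with h | rfl
    · simp [oddReflect, not_le.2 h]
    · simp [oddReflect, h0]

/-! ### Explicit solutions of the homogeneous equations -/

/-- The pair at frequency zero, `m = 1`: the odd decaying solution `sech tanh` and an even
solution growing like `cosh`. -/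
def greenPairOne : GreenPair 1 1 10 where
  φ s := 1 / 2 * (sech s * Real.tanh s)
  dφ s := 1 / 2 * (sech s ^ 3 - sech s * Real.tanh s ^ 2)
  χ s := Real.cosh s + 3 * (s * (sech s * Real.tanh s)) - 3 * sech s
  dχ s := Real.sinh s + 3 * (s * (sech s ^ 3 - sech s * Real.tanh s ^ 2))
    + 6 * (sech s * Real.tanh s)
  hasDerivAt_φ s := by
    convert! ((hasDerivAt_sech s).mul (hasDerivAt_tanh s)).const_mul (1 / 2) using 1
    ring
  hasDerivAt_dφ s := by
    convert! (((hasDerivAt_sech s).pow 3).sub ((hasDerivAt_sech s).mul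
      ((hasDerivAt_tanh s).pow 2))).const_mul (1 / 2) using 1
    have := tanh_sq_eq s
    simp only [Pi.pow_apply]; push_cast
    linear_combination (-1 / 2 * (sech s) * (Real.tanh s)) * this
  hasDerivAt_χ s := by
    convert! ((Real.hasDerivAt_cosh s).add (((hasDerivAt_id s).mul ((hasDerivAt_sech s).mul
      (hasDerivAt_tanh s))).const_mul 3)).sub ((hasDerivAt_sech s).const_mul 3) using 1
    simp only [id]; simp; ring
  hasDerivAt_dχ s := by
    convert! ((Real.hasDerivAt_sinh s).add (((hasDerivAt_id s).mul (((hasDerivAt_sech s).pow 3).sub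
      ((hasDerivAt_sech s).mul ((hasDerivAt_tanh s).pow 2)))).const_mul 3)).add
      (((hasDerivAt_sech s).mul (hasDerivAt_tanh s)).const_mul 6) using 1
    have h := tanh_sq_eq s
    have h2 := sech_mul_cosh s
    simp only [id, Pi.pow_apply]; simp
    linear_combination (-3 * sech s * s * Real.tanh s + 9 * sech s) * h + (-6 * sech s) * h2
  wronskian s := by
    have h := tanh_sq_eq s
    have h2 := sech_mul_cosh s
    have h3 := tanh_mul_cosh s
    rw [← h3]
    linear_combination (1 + 3 / 2 * sech s ^ 2) * h
      + (Real.tanh s ^ 2 - 1 / 2 * sech s ^ 2) * h2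
  abs_φ_le s hs := by
    have h1 := sech_le s
    rw [abs_of_nonneg hs] at h1
    have h2 := abs_tanh_le_one s
    rw [abs_mul, abs_mul, abs_of_pos (sech_pos s), one_mul, one_mul,
      abs_of_pos (by norm_num : (0:ℝ) < 1 / 2)]
    nlinarith [sech_pos s, abs_nonneg (Real.tanh s)]
  abs_dφ_le s hs := by
    have h1 := sech_le s
    rw [abs_of_nonneg hs] at h1
    have h2 := tanh_sq_eq s
    have h3 : sech s ^ 3 - sech s * Real.tanh s ^ 2 = sech s * (2 * sech s ^ 2 - 1) := by
      rw [h2]; ring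
    have h4 : |2 * sech s ^ 2 - 1| ≤ 1 := by
      have := sech_pos s; have := sech_le_one s
      rw [abs_le]; constructor <;> nlinarith
    rw [h3, abs_mul, abs_mul, abs_of_pos (sech_pos s), one_mul, one_mul,
      abs_of_pos (by norm_num : (0:ℝ) < 1 / 2), one_mul]
    nlinarith [sech_pos s, abs_nonneg (2 * sech s ^ 2 - 1)]
  abs_χ_le s hs := by
    have h1 := cosh_le_exp hs
    have h2 := Real.add_one_le_exp s
    have h3 := tanh_nonneg hs
    have h4 := (abs_le.1 (abs_tanh_le_one s)).2
    have h5 := sech_pos s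
    have h6 := sech_le_one s
    have h7 := Real.cosh_pos s
    have h8 : s * (sech s * Real.tanh s) ≤ s * 1 :=
      mul_le_mul_of_nonneg_left (by nlinarith) hs
    have h9 : 0 ≤ s * (sech s * Real.tanh s) := by positivity
    rw [one_mul, abs_le]; constructor <;> linarith
  abs_dχ_le s hs := by
    have h1 := cosh_le_exp hs
    have h2 := Real.add_one_le_exp s
    have h3 := tanh_nonneg hs
    have h4 := (abs_le.1 (abs_tanh_le_one s)).2
    have h5 := sech_pos s
    have h6 := sech_le_one s
    have h7 := Real.sinh_lt_cosh (x := s)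
    have h7' := Real.sinh_nonneg_iff.2 hs
    have h10 : sech s * Real.tanh s ≤ 1 := by nlinarith
    have h11 : 0 ≤ sech s * Real.tanh s := by positivity
    have h12 : sech s ^ 3 - sech s * Real.tanh s ^ 2 = sech s * (2 * sech s ^ 2 - 1) := by
      rw [tanh_sq_eq]; ring
    have h13 : |sech s ^ 3 - sech s * Real.tanh s ^ 2| ≤ 1 := by
      rw [h12, abs_le]; constructor <;> nlinarith [mul_pos h5 h5]
    have h14 := abs_le.1 h13
    have h8 : s * (sech s ^ 3 - sech s * Real.tanh s ^ 2) ≤ s * 1 :=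
      mul_le_mul_of_nonneg_left h14.2 hs
    have h9 : s * (-1) ≤ s * (sech s ^ 3 - sech s * Real.tanh s ^ 2) :=
      mul_le_mul_of_nonneg_left h14.1 hs
    rw [one_mul, one_mul, abs_le]; constructor <;> linarith

lemma abs_integral_cosh_pow_le {s : ℝ} (hs : 0 ≤ s) :
    |∫ t in (0:ℝ)..s, Real.cosh t ^ 4| ≤ Real.exp (4 * s) / 4 := by
  rw [abs_of_nonneg (intervalIntegral.integral_nonneg hs fun t _ => by positivity)]
  calc _ ≤ ∫ t in (0:ℝ)..s, Real.exp (4 * t) := by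
        refine intervalIntegral.integral_mono_on hs
          ((Real.continuous_cosh.pow 4).intervalIntegrable _ _) ?_ fun t ht => ?_
        · exact (by fun_prop : Continuous fun t : ℝ => Real.exp (4 * t)).intervalIntegrable _ _
        · calc Real.cosh t ^ 4 ≤ Real.exp t ^ 4 := by
                have := Real.cosh_pos t
                have := cosh_le_exp ht.1
                gcongr
            _ = _ := by rw [← Real.exp_nat_mul]; push_cast; rfl
    _ = (Real.exp (4 * s) - 1) / 4 := by
        rw [intervalIntegral.integral_comp_mul_left (fun x => Real.exp x) (by norm_num),
          integral_exp, smul_eq_mul, inv_mul_eq_div]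
        simp
    _ ≤ _ := by linarith

/-- The pair at frequency one, `m = 2`: the even bound state `sech²` and the odd growing
solution that reduction of order yields from it. -/
def greenPairTwo : GreenPair 2 4 2 where
  φ s := sech s ^ 2
  dφ s := -2 * (sech s ^ 2 * Real.tanh s)
  χ s := sech s ^ 2 * ∫ t in (0:ℝ)..s, Real.cosh t ^ 4
  dχ s := -2 * (sech s ^ 2 * Real.tanh s) * (∫ t in (0:ℝ)..s, Real.cosh t ^ 4) + Real.cosh s ^ 2
  hasDerivAt_φ s := by
    convert! (hasDerivAt_sech s).pow 2 using 1
    push_cast; ring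
  hasDerivAt_dφ s := by
    convert! (((hasDerivAt_sech s).pow 2).mul (hasDerivAt_tanh s)).const_mul (-2) using 1
    have := tanh_sq_eq s
    simp only [Pi.pow_apply]; push_cast
    linear_combination (-4 * sech s ^ 2) * this
  hasDerivAt_χ s := by
    have hI : HasDerivAt (fun s => ∫ t in (0:ℝ)..s, Real.cosh t ^ 4) (Real.cosh s ^ 4) s :=
      ((Real.continuous_cosh.pow 4).integral_hasStrictDerivAt 0 s).hasDerivAt
    convert! ((hasDerivAt_sech s).pow 2).mul hI using 1
    have h2 := sech_mul_cosh s
    simp only [Pi.pow_apply]; push_cast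
    linear_combination (-Real.cosh s ^ 2 * (sech s * Real.cosh s + 1)) * h2
  hasDerivAt_dχ s := by
    have hI : HasDerivAt (fun s => ∫ t in (0:ℝ)..s, Real.cosh t ^ 4) (Real.cosh s ^ 4) s :=
      ((Real.continuous_cosh.pow 4).integral_hasStrictDerivAt 0 s).hasDerivAt
    convert! (((((hasDerivAt_sech s).pow 2).mul (hasDerivAt_tanh s)).const_mul (-2)).mul hI).add
      ((Real.hasDerivAt_cosh s).pow 2) using 1
    have h := tanh_sq_eq s
    have h2 := sech_mul_cosh s
    have h3 := tanh_mul_cosh s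
    simp only [Pi.pow_apply, Pi.mul_apply]; push_cast
    rw [← h3]
    linear_combination (-4 * sech s ^ 2 * (∫ t in (0:ℝ)..s, Real.cosh t ^ 4)) * h
      + (2 * Real.tanh s * Real.cosh s ^ 2 * (sech s * Real.cosh s + 1)) * h2
  wronskian s := by
    have h2 := sech_mul_cosh s
    linear_combination (sech s * Real.cosh s + 1) * h2
  abs_φ_le s hs := by
    have h1 := sech_le s
    rw [abs_of_nonneg hs] at h1
    have h5 := sech_pos s
    have e : Real.exp (-(2 * s)) = Real.exp (-s) ^ 2 := by rw [← Real.exp_nat_mul]; ring_nf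
    rw [abs_of_nonneg (by positivity), e]
    calc sech s ^ 2 ≤ (2 * Real.exp (-s)) ^ 2 := by gcongr
      _ = _ := by ring
  abs_dφ_le s hs := by
    have h1 := sech_le s
    rw [abs_of_nonneg hs] at h1
    have h5 := sech_pos s
    have e : Real.exp (-(2 * s)) = Real.exp (-s) ^ 2 := by rw [← Real.exp_nat_mul]; ring_nf
    rw [abs_mul, abs_mul, abs_of_nonneg (by positivity : 0 ≤ sech s ^ 2), e]
    calc |(-2:ℝ)| * (sech s ^ 2 * |Real.tanh s|) ≤ 2 * ((2 * Real.exp (-s)) ^ 2 * 1) := by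
          rw [abs_neg, abs_two]
          gcongr
          exact abs_tanh_le_one s
      _ = _ := by ring
  abs_χ_le s hs := by
    have hI := abs_integral_cosh_pow_le hs
    have h1 := sech_le s
    rw [abs_of_nonneg hs] at h1
    have h5 := sech_pos s
    rw [abs_mul, abs_of_nonneg (by positivity : 0 ≤ sech s ^ 2)]
    calc _ ≤ (2 * Real.exp (-s)) ^ 2 * (Real.exp (4 * s) / 4) := by gcongr
      _ = Real.exp (-s) ^ 2 * Real.exp (4 * s) := by ring
      _ = Real.exp (2 * s) := by rw [← Real.exp_nat_mul, ← Real.exp_add]; push_cast; ring_nf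
      _ ≤ _ := by linarith [Real.exp_pos (2 * s)]
  abs_dχ_le s hs := by
    have hI := abs_integral_cosh_pow_le hs
    have h1 := sech_le s
    rw [abs_of_nonneg hs] at h1
    have h5 := sech_pos s
    have h6 : Real.cosh s ^ 2 ≤ Real.exp (2 * s) := by
      have := cosh_le_exp hs
      calc Real.cosh s ^ 2 ≤ Real.exp s ^ 2 := by
            have := Real.cosh_pos s; gcongr
        _ = _ := by rw [← Real.exp_nat_mul]; push_cast; rfl
    calc _ ≤ |(-2 * (sech s ^ 2 * Real.tanh s)) * ∫ t in (0:ℝ)..s, Real.cosh t ^ 4|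
          + |Real.cosh s ^ 2| := abs_add_le _ _
      _ = 2 * (sech s ^ 2 * |Real.tanh s|) * |∫ t in (0:ℝ)..s, Real.cosh t ^ 4|
          + Real.cosh s ^ 2 := by
          rw [abs_mul, abs_mul, abs_mul, abs_of_nonneg (by positivity : 0 ≤ sech s ^ 2), abs_neg,
            abs_two, abs_of_nonneg (by positivity : 0 ≤ Real.cosh s ^ 2)]
      _ ≤ 2 * ((2 * Real.exp (-s)) ^ 2 * 1) * (Real.exp (4 * s) / 4) + Real.exp (2 * s) := by
          gcongr
          exact abs_tanh_le_one s
      _ = 2 * (Real.exp (-s) ^ 2 * Real.exp (4 * s)) + Real.exp (2 * s) := by ring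
      _ = 2 * Real.exp (2 * s) + Real.exp (2 * s) := by
          rw [← Real.exp_nat_mul, ← Real.exp_add]; push_cast; ring_nf
      _ ≤ _ := by linarith [Real.exp_pos (2 * s)]

/-- The polynomial `P(t) = 3t² + 3mt + m² - 1`, for which `e^{-ms} P(tanh s)` is the Jost solution
of the Pöschl–Teller equation `y'' = (m² - 6 sech²) y`. -/
def jostPoly (m t : ℝ) : ℝ := 3 * t ^ 2 + 3 * m * t + m ^ 2 - 1

/-- The solution `e^{-ms} P(tanh s)` with `P` the polynomial `jostPoly m`; replacing `m` by `-m`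
gives the solution growing at `+∞`. -/
def jost (m s : ℝ) : ℝ := Real.exp (-(m * s)) * jostPoly m (Real.tanh s)

/-- The derivative of the Jost solution. -/
def jostDeriv (m s : ℝ) : ℝ :=
  Real.exp (-(m * s)) * (-m * jostPoly m (Real.tanh s) + (6 * Real.tanh s + 3 * m) * sech s ^ 2)

lemma hasDerivAt_exp_neg_mul (m s : ℝ) :
    HasDerivAt (fun s => Real.exp (-(m * s))) (-m * Real.exp (-(m * s))) s := by
  have h : HasDerivAt (fun s => -(m * s)) (-m) s := by
    convert! ((hasDerivAt_id s).const_mul m).neg using 1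
    ring
  simpa [mul_comm] using h.exp

lemma hasDerivAt_jostPoly_tanh (m s : ℝ) :
    HasDerivAt (fun s => jostPoly m (Real.tanh s))
      ((6 * Real.tanh s + 3 * m) * sech s ^ 2) s := by
  have h := hasDerivAt_tanh s
  convert! ((((h.pow 2).const_mul 3).add (h.const_mul (3 * m))).add_const (m ^ 2)).sub_const 1
    using 1
  push_cast; ring

lemma hasDerivAt_jost (m s : ℝ) : HasDerivAt (jost m) (jostDeriv m s) s := by
  convert! (hasDerivAt_exp_neg_mul m s).mul (hasDerivAt_jostPoly_tanh m s) using 1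
  simp only [jostDeriv]; ring

lemma hasDerivAt_jostDeriv (m s : ℝ) :
    HasDerivAt (jostDeriv m) ((m ^ 2 - 6 * sech s ^ 2) * jost m s) s := by
  have h := hasDerivAt_tanh s
  convert! (hasDerivAt_exp_neg_mul m s).mul (((hasDerivAt_jostPoly_tanh m s).const_mul (-m)).add
    (((h.const_mul 6).add_const (3 * m)).mul ((hasDerivAt_sech s).pow 2))) using 1
  have h2 := tanh_sq_eq s
  simp only [jost, jostPoly, Pi.pow_apply, Pi.add_apply, Pi.mul_apply]; push_cast
  linear_combination (-6 * Real.exp (-(m * s)) * sech s ^ 2) * h2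

/-- The Wronskian vanishes only at the thresholds `m = 0, 1, 2`; hence the separate pairs for
`m = 1` and `m = 2`. -/
lemma jost_wronskian (m s : ℝ) :
    jost m s * jostDeriv (-m) s - jostDeriv m s * jost (-m) s
      = 2 * m * (m ^ 2 - 1) * (m ^ 2 - 4) := by
  have e : Real.exp (-(m * s)) * Real.exp (-(-m * s)) = 1 := by
    rw [← Real.exp_add]; simp
  have h2 := sech_sq_add_tanh_sq s
  have h3 : sech s ^ 2 = 1 - Real.tanh s ^ 2 := by linarith
  simp only [jost, jostDeriv, jostPoly, h3]
  linear_combination (2 * m * (m ^ 2 - 1) * (m ^ 2 - 4)) * e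

lemma abs_jostPoly_le {m t : ℝ} (hm : 3 ≤ |m|) (ht : |t| ≤ 1) :
    |jostPoly m t| ≤ 20 / 9 * |m| ^ 2 := by
  have h1 : t ^ 2 ≤ 1 := by rw [← sq_abs]; nlinarith [abs_nonneg t]
  have h2 : |m * t| ≤ |m| := by rw [abs_mul]; nlinarith [abs_nonneg t, abs_nonneg m]
  have h3 := abs_le.1 h2
  have h4 : m ^ 2 = |m| ^ 2 := (sq_abs m).symm
  rw [jostPoly, abs_le]
  constructor <;> nlinarith [sq_nonneg t]

lemma abs_jost_le {m s : ℝ} (hm : 3 ≤ |m|) :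
    |jost m s| ≤ 3 * |m| ^ 2 * Real.exp (-(m * s)) := by
  have h := abs_jostPoly_le hm (abs_tanh_le_one s)
  rw [jost, abs_mul, Real.abs_exp, mul_comm]
  gcongr
  nlinarith

lemma abs_jostDeriv_le {m s : ℝ} (hm : 3 ≤ |m|) :
    |jostDeriv m s| ≤ |m| * (3 * |m| ^ 2) * Real.exp (-(m * s)) := by
  have h := abs_jostPoly_le hm (abs_tanh_le_one s)
  have h1 := abs_tanh_le_one s
  have h2 : |sech s ^ 2| ≤ 1 := by
    have := sech_pos s; have := sech_le_one s
    rw [abs_of_nonneg (by positivity)]; nlinarith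
  have h3 : |6 * Real.tanh s + 3 * m| ≤ 6 + 3 * |m| := by
    refine (abs_add_le _ _).trans ?_
    rw [abs_mul, abs_mul, abs_of_pos (by norm_num : (0:ℝ) < 6),
      abs_of_pos (by norm_num : (0:ℝ) < 3)]
    linarith
  have h4 : |-m * jostPoly m (Real.tanh s) + (6 * Real.tanh s + 3 * m) * sech s ^ 2|
      ≤ |m| * (3 * |m| ^ 2) := by
    calc _ ≤ |m| * (20 / 9 * |m| ^ 2) + (6 + 3 * |m|) * 1 := by
          refine (abs_add_le _ _).trans ?_
          rw [abs_mul, abs_mul, abs_neg]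
          gcongr
      _ ≤ _ := by nlinarith [mul_nonneg (abs_nonneg m) (sub_nonneg.2 hm), sq_nonneg (|m| - 3)]
  rw [jostDeriv, abs_mul, Real.abs_exp, mul_comm]
  gcongr

/-- The pair for `m ≥ 3`: the decaying Jost solution and the even combination of both Jost
solutions. -/
def greenPairLarge (m : ℝ) (hm : 3 ≤ m) :
    GreenPair m (3 * m ^ 2 / (2 * m * (m ^ 2 - 1) * (m ^ 2 - 4))) (6 * m ^ 2) where
  φ s := jost m s / (2 * m * (m ^ 2 - 1) * (m ^ 2 - 4))
  dφ s := jostDeriv m s / (2 * m * (m ^ 2 - 1) * (m ^ 2 - 4))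
  χ s := jost m s + jost (-m) s
  dχ s := jostDeriv m s + jostDeriv (-m) s
  hasDerivAt_φ s := (hasDerivAt_jost m s).div_const _
  hasDerivAt_dφ s := by
    convert! (hasDerivAt_jostDeriv m s).div_const (2 * m * (m ^ 2 - 1) * (m ^ 2 - 4)) using 1
    ring
  hasDerivAt_χ s := (hasDerivAt_jost m s).add (hasDerivAt_jost (-m) s)
  hasDerivAt_dχ s := by
    convert! (hasDerivAt_jostDeriv m s).add (hasDerivAt_jostDeriv (-m) s) using 1
    ring
  wronskian s := by
    have hW : 2 * m * (m ^ 2 - 1) * (m ^ 2 - 4) ≠ 0 := by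
      have h1 : 0 < m ^ 2 - 1 := by nlinarith
      have h2 : 0 < m ^ 2 - 4 := by nlinarith
      positivity
    rw [div_mul_eq_mul_div, div_mul_eq_mul_div, ← sub_div, div_eq_one_iff_eq hW,
      ← jost_wronskian m s]
    ring
  abs_φ_le s _ := by
    have h1 : 0 < m ^ 2 - 1 := by nlinarith
    have h2 : 0 < m ^ 2 - 4 := by nlinarith
    have h := abs_jost_le (m := m) (s := s) (by rwa [abs_of_nonneg (by linarith)])
    rw [abs_of_nonneg (by linarith : 0 ≤ m)] at h
    rw [abs_div, abs_of_pos (by positivity : 0 < 2 * m * (m ^ 2 - 1) * (m ^ 2 - 4)),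
      div_mul_eq_mul_div]
    gcongr
  abs_dφ_le s _ := by
    have h1 : 0 < m ^ 2 - 1 := by nlinarith
    have h2 : 0 < m ^ 2 - 4 := by nlinarith
    have h := abs_jostDeriv_le (m := m) (s := s) (by rwa [abs_of_nonneg (by linarith)])
    rw [abs_of_nonneg (by linarith : 0 ≤ m)] at h
    rw [abs_div, abs_of_pos (by positivity : 0 < 2 * m * (m ^ 2 - 1) * (m ^ 2 - 4)),
      mul_div_assoc', div_mul_eq_mul_div]
    gcongr
  abs_χ_le s hs := by
    have h := abs_jost_le (m := m) (s := s) (by rwa [abs_of_nonneg (by linarith)])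
    have h' := abs_jost_le (m := -m) (s := s) (by rwa [abs_neg, abs_of_nonneg (by linarith)])
    rw [abs_neg, abs_of_nonneg (by linarith : 0 ≤ m)] at h'
    rw [abs_of_nonneg (by linarith : 0 ≤ m)] at h
    have e : Real.exp (-(m * s)) ≤ Real.exp (m * s) := Real.exp_le_exp.2 (by nlinarith)
    rw [show -(-m * s) = m * s by ring] at h'
    have := abs_add_le (jost m s) (jost (-m) s)
    nlinarith [sq_nonneg m]
  abs_dχ_le s hs := by
    have h := abs_jostDeriv_le (m := m) (s := s) (by rwa [abs_of_nonneg (by linarith)])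
    have h' := abs_jostDeriv_le (m := -m) (s := s)
      (by rwa [abs_neg, abs_of_nonneg (by linarith)])
    rw [abs_neg, abs_of_nonneg (by linarith : 0 ≤ m)] at h'
    rw [abs_of_nonneg (by linarith : 0 ≤ m)] at h
    have e : Real.exp (-(m * s)) ≤ Real.exp (m * s) := Real.exp_le_exp.2 (by nlinarith)
    rw [show -(-m * s) = m * s by ring] at h'
    have := abs_add_le (jostDeriv m s) (jostDeriv (-m) s)
    have hp : 0 ≤ m * (3 * m ^ 2) := by positivity
    nlinarith [mul_le_mul_of_nonneg_left e hp]

/-! ### The resolvents on exponentially decaying functions -/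

/-- The exponential weight `e^{-|s|/2}`. -/
def weight (s : ℝ) : ℝ := Real.exp (-(|s| / 2))

lemma weight_pos (s : ℝ) : 0 < weight s := Real.exp_pos _

lemma weight_neg (s : ℝ) : weight (-s) = weight s := by simp [weight]

lemma weight_abs (s : ℝ) : weight |s| = weight s := by simp [weight]

lemma weight_le_one (s : ℝ) : weight s ≤ 1 :=
  Real.exp_le_one_iff.2 (by have := abs_nonneg s; linarith)

lemma weight_of_nonneg {s : ℝ} (hs : 0 ≤ s) : weight s = Real.exp (-(s / 2)) := by
  rw [weight, abs_of_nonneg hs]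

lemma continuous_weight : Continuous weight := by unfold weight; fun_prop

/-- The function `e^{-|s|/2} f(s)` encoded by the bounded continuous function `f`. In this way
bounded continuous functions represent the continuous functions decaying like `e^{-|s|/2}`. -/
def decay (f : ℝ →ᵇ ℝ) (s : ℝ) : ℝ := weight s * f s

lemma continuous_decay (f : ℝ →ᵇ ℝ) : Continuous (decay f) :=
  continuous_weight.mul f.continuous

lemma abs_decay_le (f : ℝ →ᵇ ℝ) (s : ℝ) : |decay f s| ≤ ‖f‖ * weight s := by
  rw [decay, abs_mul, abs_of_pos (weight_pos s), mul_comm]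
  exact mul_le_mul_of_nonneg_right (f.norm_coe_le_norm s) (weight_pos s).le

lemma abs_decay_le_exp (f : ℝ →ᵇ ℝ) (t : ℝ) (ht : 0 ≤ t) :
    |decay f t| ≤ ‖f‖ * Real.exp (-(t / 2)) := by
  rw [← weight_of_nonneg ht]; exact abs_decay_le f t

lemma decay_add (f g : ℝ →ᵇ ℝ) (s : ℝ) : decay (f + g) s = decay f s + decay g s := by
  simp [decay, mul_add]

lemma decay_smul (r : ℝ) (f : ℝ →ᵇ ℝ) (s : ℝ) : decay (r • f) s = r * decay f s := by
  simp [decay]; ring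

namespace GreenPair

variable {m a b : ℝ}

lemma green_add (P : GreenPair m a b) (hm : 1 ≤ m) (p q : ℝ → ℝ) (f g : ℝ →ᵇ ℝ) (s : ℝ) :
    P.green p q (decay (f + g)) s = P.green p q (decay f) s + P.green p q (decay g) s := by
  have i1 : ∀ h : ℝ →ᵇ ℝ, IntervalIntegrable (fun t => P.χ t * decay h t) volume 0 s :=
    fun h => (P.continuous_χ.mul (continuous_decay h)).intervalIntegrable _ _
  have i2 : ∀ h : ℝ →ᵇ ℝ, IntervalIntegrable (fun t => P.φ t * decay h t) volume 0 s :=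
    fun h => (P.continuous_φ.mul (continuous_decay h)).intervalIntegrable _ _
  have i3 : ∀ h : ℝ →ᵇ ℝ, IntegrableOn (fun t => P.φ t * decay h t) (Set.Ioi 0) :=
    fun h => P.integrableOn_φ_mul hm (continuous_decay h) (abs_decay_le_exp h)
  simp only [green, decay_add, mul_add]
  rw [intervalIntegral.integral_add (i1 f) (i1 g), intervalIntegral.integral_add (i2 f) (i2 g),
    integral_add (i3 f) (i3 g)]
  ring

lemma green_smul (P : GreenPair m a b) (p q : ℝ → ℝ) (r : ℝ) (f : ℝ →ᵇ ℝ) (s : ℝ) :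
    P.green p q (decay (r • f)) s = r * P.green p q (decay f) s := by
  simp only [green, decay_smul, mul_left_comm _ r, intervalIntegral.integral_const_mul,
    integral_const_mul]
  ring

lemma abs_green_sol_le (P : GreenPair m a b) (hm : 1 ≤ m) (f : ℝ →ᵇ ℝ) (s : ℝ) :
    |P.green P.φ P.χ (decay f) (|s|)| ≤ 3 * (a * b) / m * ‖f‖ * weight s := by
  have h := P.abs_green_le hm (continuous_decay f) (abs_decay_le_exp f) zero_le_one (abs_nonneg s)
    (by simpa using P.abs_φ_le _ (abs_nonneg s)) (by simpa using P.abs_χ_le _ (abs_nonneg s))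
  simpa [weight] using h

lemma abs_green_deriv_le (P : GreenPair m a b) (hm : 1 ≤ m) (f : ℝ →ᵇ ℝ) (s : ℝ) :
    |P.green P.dφ P.dχ (decay f) (|s|)| ≤ 3 * (a * b) * ‖f‖ * weight s := by
  have h := P.abs_green_le hm (continuous_decay f) (abs_decay_le_exp f)
    (by linarith : 0 ≤ m) (abs_nonneg s) (P.abs_dφ_le _ (abs_nonneg s))
    (P.abs_dχ_le _ (abs_nonneg s))
  have hm' : m ≠ 0 := by linarith
  have e : m * (3 * (a * b) / m) = 3 * (a * b) := by field_simp
  rwa [e] at h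

lemma abs_inv_weight_green_le (P : GreenPair m a b) (hm : 1 ≤ m) (f : ℝ →ᵇ ℝ) (s : ℝ) :
    ‖(weight s)⁻¹ * P.green P.φ P.χ (decay f) |s|‖ ≤ 3 * (a * b) / m * ‖f‖ := by
  have := P.abs_green_sol_le hm f s
  rw [Real.norm_eq_abs, abs_mul, abs_of_pos (inv_pos.2 (weight_pos s)),
    inv_mul_le_iff₀ (weight_pos s)]
  linarith

lemma continuous_inv_weight_green (P : GreenPair m a b) (f : ℝ →ᵇ ℝ) :
    Continuous fun s => (weight s)⁻¹ * P.green P.φ P.χ (decay f) |s| :=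
  (continuous_weight.inv₀ fun s => (weight_pos s).ne').mul
    ((continuous_iff_continuousAt.2 fun s =>
      (P.hasDerivAt_green_sol (continuous_decay f) s).continuousAt).comp continuous_abs)

/-- The Green operator, with the solution evaluated at `|s|`. -/
def resolvent (P : GreenPair m a b) (hm : 1 ≤ m) : (ℝ →ᵇ ℝ) →L[ℝ] (ℝ →ᵇ ℝ) :=
  LinearMap.mkContinuous
    { toFun := fun f => BoundedContinuousFunction.ofNormedAddCommGroup _
        (P.continuous_inv_weight_green f) _ (P.abs_inv_weight_green_le hm f)
      map_add' := fun f g => by ext s; simp [green_add P hm, mul_add]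
      map_smul' := fun r f => by ext s; simp [green_smul]; ring }
    (3 * (a * b) / m) (fun f => BoundedContinuousFunction.norm_ofNormedAddCommGroup_le
      (P.continuous_inv_weight_green f)
      (mul_nonneg (div_nonneg (by have := P.a_nonneg; have := P.b_nonneg; positivity)
        (by linarith)) (norm_nonneg _)) (P.abs_inv_weight_green_le hm f))

lemma decay_resolvent (P : GreenPair m a b) (hm : 1 ≤ m) (f : ℝ →ᵇ ℝ) (s : ℝ) :
    decay (P.resolvent hm f) s = P.green P.φ P.χ (decay f) |s| := by
  have := (weight_pos s).ne'
  simp [decay, resolvent]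
  field_simp

end GreenPair

/-- `z`, with derivative `dz`, solves `-z'' + (1 + 3k² - 6 sech²) z = F` on the half-line and is
extended evenly. -/
structure IsModeSolution (k : ℕ) (F z dz : ℝ → ℝ) : Prop where
  hasDerivAt : ∀ s, HasDerivAt z (dz s) s
  hasDerivAt_deriv : ∀ s,
    HasDerivAt dz ((1 + 3 * (k : ℝ) ^ 2 - 6 * sech s ^ 2) * z s - F |s|) s

lemma GreenPair.isModeSolution {m a b : ℝ} (P : GreenPair m a b) (hm : 1 ≤ m) {k : ℕ}
    (hk : m ^ 2 = 1 + 3 * (k : ℝ) ^ 2) (f : ℝ →ᵇ ℝ)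
    (h0 : P.dχ 0 * ∫ t in Set.Ioi (0:ℝ), P.φ t * decay f t = 0) :
    IsModeSolution k (decay f) (decay (P.resolvent hm f))
      (oddReflect (P.green P.dφ P.dχ (decay f))) := by
  have hF := continuous_decay f
  have h0' := (P.green_deriv_zero (decay f)).trans h0
  have e : decay (P.resolvent hm f) = fun s => P.green P.φ P.χ (decay f) |s| :=
    funext fun s => P.decay_resolvent hm f s
  refine ⟨fun s => ?_, fun s => ?_⟩
  · rw [e]; exact hasDerivAt_comp_abs (P.hasDerivAt_green_sol hF) h0' s
  · rw [e, ← hk]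
    simpa [sech_abs] using hasDerivAt_oddReflect (P.hasDerivAt_green_deriv hF) h0' s

/-- A single frequency: a resolvent with the gain of two derivatives in `y`. At frequency one the
equation is solved only for right-hand sides orthogonal to the bound state `sech²`. -/
lemma exists_resolvent (k : ℕ) : ∃ T : (ℝ →ᵇ ℝ) →L[ℝ] (ℝ →ᵇ ℝ),
    (∀ f s, (1 + (k : ℝ) ^ 2) * |decay (T f) s| ≤ 240 * ‖f‖ * weight s) ∧
    (∀ f s, decay (T f) (-s) = decay (T f) s) ∧
    ∀ f, (k = 1 → ∫ t in Set.Ioi (0:ℝ), sech t ^ 2 * decay f t = 0) →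
      ∃ dz, IsModeSolution k (decay f) (decay (T f)) dz ∧
        ∀ s, (1 + (k : ℝ)) * |dz s| ≤ 240 * ‖f‖ * weight s := by
  have key : ∀ {m a b : ℝ} (P : GreenPair m a b) (hm : 1 ≤ m),
      m ^ 2 = 1 + 3 * (k : ℝ) ^ 2 → (1 + (k : ℝ) ^ 2) * (3 * (a * b) / m) ≤ 240 →
      (1 + (k : ℝ)) * (3 * (a * b)) ≤ 240 →
      (∀ f, (k = 1 → ∫ t in Set.Ioi (0:ℝ), sech t ^ 2 * decay f t = 0) →
        P.dχ 0 * ∫ t in Set.Ioi (0:ℝ), P.φ t * decay f t = 0) →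
      ∃ T : (ℝ →ᵇ ℝ) →L[ℝ] (ℝ →ᵇ ℝ),
      (∀ f s, (1 + (k : ℝ) ^ 2) * |decay (T f) s| ≤ 240 * ‖f‖ * weight s) ∧
      (∀ f s, decay (T f) (-s) = decay (T f) s) ∧
      ∀ f, (k = 1 → ∫ t in Set.Ioi (0:ℝ), sech t ^ 2 * decay f t = 0) →
        ∃ dz, IsModeSolution k (decay f) (decay (T f)) dz ∧
          ∀ s, (1 + (k : ℝ)) * |dz s| ≤ 240 * ‖f‖ * weight s := by
    intro m a b P hm hk h1 h2 h3
    refine ⟨P.resolvent hm, fun f s => ?_, fun f s => ?_, fun f hf =>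
      ⟨_, P.isModeSolution hm hk f (h3 f hf), fun s => ?_⟩⟩
    · rw [P.decay_resolvent]
      calc _ ≤ (1 + (k : ℝ) ^ 2) * (3 * (a * b) / m * ‖f‖ * weight s) := by
            gcongr; exact P.abs_green_sol_le hm f s
        _ = (1 + (k : ℝ) ^ 2) * (3 * (a * b) / m) * (‖f‖ * weight s) := by ring
        _ ≤ 240 * (‖f‖ * weight s) := by
            have := weight_pos s
            gcongr
        _ = _ := by ring
    · rw [P.decay_resolvent, P.decay_resolvent, abs_neg]
    · rw [abs_oddReflect]
      calc _ ≤ (1 + (k : ℝ)) * (3 * (a * b) * ‖f‖ * weight s) := by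
            gcongr; exact P.abs_green_deriv_le hm f s
        _ = (1 + (k : ℝ)) * (3 * (a * b)) * (‖f‖ * weight s) := by ring
        _ ≤ 240 * (‖f‖ * weight s) := by
            have := weight_pos s
            gcongr
        _ = _ := by ring
  rcases Nat.lt_or_ge k 2 with hk | hk
  · interval_cases k
    -- For `k ≠ 1` the growing solution `χ` is even, so its slope at the origin vanishes.
    · refine key greenPairOne le_rfl (by norm_num) (by norm_num) (by norm_num) fun f _ => ?_
      simp [greenPairOne]
    -- For `k = 1` it is odd, and the orthogonality condition takes over.
    · refine key greenPairTwo (by norm_num) (by norm_num) (by norm_num) (by norm_num)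
        fun f hf => ?_
      have : ∀ t, greenPairTwo.φ t = sech t ^ 2 := fun t => rfl
      simp [this, hf rfl]
  · have hk' : (2:ℝ) ≤ k := by exact_mod_cast hk
    have hm2 : Real.sqrt (1 + 3 * (k : ℝ) ^ 2) ^ 2 = 1 + 3 * (k : ℝ) ^ 2 :=
      Real.sq_sqrt (by positivity)
    have hm : 3 ≤ Real.sqrt (1 + 3 * (k : ℝ) ^ 2) := Real.le_sqrt_of_sq_le (by nlinarith)
    generalize Real.sqrt (1 + 3 * (k : ℝ) ^ 2) = m at hm hm2
    -- The Wronskian in the denominator is of order `m⁵`, which makes the product of the two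
    -- constants of the pair of order `1/m`.
    have hA : 0 < m ^ 2 - 1 := by nlinarith
    have hB : 0 < m ^ 2 - 4 := by nlinarith
    have hAB : m ^ 4 ≤ 81 / 40 * ((m ^ 2 - 1) * (m ^ 2 - 4)) := by
      have : 9 ≤ m ^ 2 := by nlinarith
      nlinarith
    have hab : 3 * (3 * m ^ 2 / (2 * m * (m ^ 2 - 1) * (m ^ 2 - 4)) * (6 * m ^ 2)) ≤ 60 / m := by
      rw [div_mul_eq_mul_div, mul_div_assoc', div_le_div_iff₀ (by positivity) (by linarith)]
      nlinarith [mul_le_mul_of_nonneg_left hAB (by linarith : 0 ≤ m)]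
    have hkm : 1 + (k : ℝ) ≤ 4 * m := by nlinarith
    refine key (greenPairLarge m hm) (by linarith) hm2 ?_ ?_ fun f _ => ?_
    · calc _ ≤ (1 + (k : ℝ) ^ 2) * (60 / m / m) := by gcongr
        _ ≤ m ^ 2 * (60 / m / m) := by gcongr; nlinarith
        _ = 60 := by field_simp
        _ ≤ _ := by norm_num
    · calc _ ≤ (4 * m) * (60 / m) := by gcongr
        _ = 240 := by field_simp; norm_num
    · have : (greenPairLarge m hm).dχ 0 = 0 := by
        simp [greenPairLarge, jostDeriv, jostPoly, sech_zero]
        ring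
      rw [this, zero_mul]

/-- The resolvent of `-∂² + 1 + 3k² - 6 sech²` on even functions. -/
def modeResolvent (k : ℕ) : (ℝ →ᵇ ℝ) →L[ℝ] (ℝ →ᵇ ℝ) := (exists_resolvent k).choose

lemma abs_modeResolvent_le (k : ℕ) (f : ℝ →ᵇ ℝ) (s : ℝ) :
    (1 + (k : ℝ) ^ 2) * |decay (modeResolvent k f) s| ≤ 240 * ‖f‖ * weight s :=
  (exists_resolvent k).choose_spec.1 f s

lemma modeResolvent_even (k : ℕ) (f : ℝ →ᵇ ℝ) (s : ℝ) :
    decay (modeResolvent k f) (-s) = decay (modeResolvent k f) s :=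
  (exists_resolvent k).choose_spec.2.1 f s

lemma exists_isModeSolution (k : ℕ) (f : ℝ →ᵇ ℝ)
    (hf : k = 1 → ∫ t in Set.Ioi (0:ℝ), sech t ^ 2 * decay f t = 0) :
    ∃ dz, IsModeSolution k (decay f) (decay (modeResolvent k f)) dz ∧
      ∀ s, (1 + (k : ℝ)) * |dz s| ≤ 240 * ‖f‖ * weight s :=
  (exists_resolvent k).choose_spec.2.2 f hf

lemma norm_modeResolvent_le (k : ℕ) (f : ℝ →ᵇ ℝ) :
    (1 + (k : ℝ) ^ 2) * ‖modeResolvent k f‖ ≤ 240 * ‖f‖ := by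
  rw [mul_comm, ← le_div_iff₀ (by positivity), BoundedContinuousFunction.norm_le (by positivity)]
  intro s
  have h := abs_modeResolvent_le k f s
  rw [decay, abs_mul, abs_of_pos (weight_pos s)] at h
  rw [le_div_iff₀ (by positivity), Real.norm_eq_abs]
  refine le_of_mul_le_mul_right ?_ (weight_pos s)
  linarith

/-! ### Trigonometric functions on the torus -/

lemma cosTorus_coe (t : ℝ) : cosTorus (t : Torus) = Real.cos t := rfl

/-- The function `sin` on `𝕋`. -/
def sinTorus : Torus → ℝ := Real.sin_periodic.lift

lemma sinTorus_coe (t : ℝ) : sinTorus (t : Torus) = Real.sin t := rfl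

lemma nsmul_coe_torus (k : ℕ) (t : ℝ) : k • (t : Torus) = ((k * t : ℝ) : Torus) := by
  rw [← AddCircle.coe_nsmul, nsmul_eq_mul]

lemma cosTorus_nsmul_coe (k : ℕ) (t : ℝ) : cosTorus (k • (t : Torus)) = Real.cos (k * t) := by
  rw [nsmul_coe_torus, cosTorus_coe]

lemma sinTorus_nsmul_coe (k : ℕ) (t : ℝ) : sinTorus (k • (t : Torus)) = Real.sin (k * t) := by
  rw [nsmul_coe_torus, sinTorus_coe]

lemma abs_cosTorus_le (y : Torus) : |cosTorus y| ≤ 1 := by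
  induction y using QuotientAddGroup.induction_on with
  | H t => exact Real.abs_cos_le_one t

lemma abs_sinTorus_le (y : Torus) : |sinTorus y| ≤ 1 := by
  induction y using QuotientAddGroup.induction_on with
  | H t => exact Real.abs_sin_le_one t

lemma cosTorus_neg (y : Torus) : cosTorus (-y) = cosTorus y := by
  induction y using QuotientAddGroup.induction_on with
  | H t => exact Real.cos_neg t

lemma continuous_cosTorus : Continuous cosTorus :=
  Real.continuous_cos.quotient_lift _

lemma continuous_sinTorus : Continuous sinTorus :=
  Real.continuous_sin.quotient_lift _

/-- The absolute difference of two frequencies. -/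
def freqDiff (k l : ℕ) : ℕ := max k l - min k l

lemma cosTorus_mul_cosTorus (k l : ℕ) (y : Torus) :
    cosTorus (k • y) * cosTorus (l • y)
      = 1 / 2 * (cosTorus ((k + l) • y) + cosTorus (freqDiff k l • y)) := by
  induction y using QuotientAddGroup.induction_on with
  | H t =>
    change cosTorus (k • (t : Torus)) * cosTorus (l • (t : Torus))
      = 1 / 2 * (cosTorus ((k + l) • (t : Torus)) + cosTorus (freqDiff k l • (t : Torus)))
    simp only [cosTorus_nsmul_coe]
    have h : Real.cos (freqDiff k l * t) = Real.cos (k * t - l * t) := by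
      rcases le_total k l with h | h
      · rw [freqDiff, max_eq_right h, min_eq_left h, Nat.cast_sub h, ← Real.cos_neg]; ring_nf
      · rw [freqDiff, max_eq_left h, min_eq_right h, Nat.cast_sub h]; ring_nf
    rw [h, Nat.cast_add, add_mul, Real.cos_add, Real.cos_sub]
    ring

/-! ### The Wiener algebra in the periodic variable -/

/-- Absolutely summable sequences of coefficients: `F` stands for the function
`∑ₖ e^{-|s|/2} F_k(s) cos(ky)` on the cylinder. -/
abbrev Modes : Type := lp (fun _ : ℕ => ℝ →ᵇ ℝ) 1

namespace Modes

lemma hasSum_norm (F : Modes) : HasSum (fun k => ‖F k‖) ‖F‖ := by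
  simpa using lp.hasSum_norm (p := 1) (by simp) F

lemma summable_norm (F : Modes) : Summable fun k => ‖F k‖ := F.hasSum_norm.summable

lemma norm_apply_le (F : Modes) (k : ℕ) : ‖F k‖ ≤ ‖F‖ :=
  lp.norm_apply_le_norm one_ne_zero F k

/-- The sequence whose only nonzero coefficient is `f`, at frequency `k`. -/
def single (k : ℕ) (f : ℝ →ᵇ ℝ) : Modes := lp.single 1 k f

lemma norm_single (k : ℕ) (f : ℝ →ᵇ ℝ) : ‖single k f‖ = ‖f‖ :=
  lp.norm_single (E := fun _ : ℕ => ℝ →ᵇ ℝ) (p := 1) zero_lt_one k f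

lemma single_self (k : ℕ) (f : ℝ →ᵇ ℝ) : single k f k = f :=
  lp.single_apply_self (E := fun _ : ℕ => ℝ →ᵇ ℝ) 1 k f

lemma single_ne {k j : ℕ} (f : ℝ →ᵇ ℝ) (h : j ≠ k) : single k f j = 0 :=
  lp.single_apply_ne (E := fun _ : ℕ => ℝ →ᵇ ℝ) 1 k f h

lemma single_add (k : ℕ) (f g : ℝ →ᵇ ℝ) : single k (f + g) = single k f + single k g :=
  lp.single_add (E := fun _ : ℕ => ℝ →ᵇ ℝ) 1 k f g

lemma single_smul (k : ℕ) (r : ℝ) (f : ℝ →ᵇ ℝ) : single k (r • f) = r • single k f :=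
  lp.single_smul (E := fun _ : ℕ => ℝ →ᵇ ℝ) 1 k r f

/-- A uniformly bounded family of operators acting frequency by frequency, as a map. -/
def diagFun (A : ℕ → (ℝ →ᵇ ℝ) →L[ℝ] (ℝ →ᵇ ℝ)) (C : ℝ) (hA : ∀ k f, ‖A k f‖ ≤ C * ‖f‖)
    (F : Modes) : Modes :=
  ⟨fun k => A k (F k), memℓp_gen <| by
    have h : Summable fun k => ‖A k (F k)‖ :=
      Summable.of_nonneg_of_le (fun _ => norm_nonneg _) (fun k => hA k (F k))
        (F.summable_norm.mul_left C)
    simpa only [ENNReal.toReal_one, Real.rpow_one] using h⟩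

/-- A uniformly bounded family of operators acting frequency by frequency. -/
def diag (A : ℕ → (ℝ →ᵇ ℝ) →L[ℝ] (ℝ →ᵇ ℝ)) (C : ℝ) (hA : ∀ k f, ‖A k f‖ ≤ C * ‖f‖) :
    Modes →L[ℝ] Modes :=
  LinearMap.mkContinuous
    { toFun := diagFun A C hA
      map_add' := fun F G => Subtype.ext <| funext fun k => (A k).map_add (F k) (G k)
      map_smul' := fun r F => Subtype.ext <| funext fun k => (A k).map_smul r (F k) }
    C (fun F => hasSum_le (fun k => hA k (F k)) (hasSum_norm (diagFun A C hA F))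
      (F.hasSum_norm.mul_left C))

lemma diag_apply (A : ℕ → (ℝ →ᵇ ℝ) →L[ℝ] (ℝ →ᵇ ℝ)) (C : ℝ) (hA : ∀ k f, ‖A k f‖ ≤ C * ‖f‖)
    (F : Modes) (k : ℕ) : diag A C hA F k = A k (F k) := rfl

lemma diag_single (A : ℕ → (ℝ →ᵇ ℝ) →L[ℝ] (ℝ →ᵇ ℝ)) (C : ℝ) (hA : ∀ k f, ‖A k f‖ ≤ C * ‖f‖)
    (k : ℕ) (f : ℝ →ᵇ ℝ) : diag A C hA (single k f) = single k (A k f) := by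
  refine Subtype.ext (funext fun j => ?_)
  rw [diag_apply]
  by_cases h : j = k
  · subst h; rw [single_self, single_self]
  · rw [single_ne _ h, single_ne _ h, map_zero]

/-- The weight as a bounded continuous function. -/
def weightBCF : ℝ →ᵇ ℝ :=
  BoundedContinuousFunction.ofNormedAddCommGroup weight continuous_weight 1 fun s => by
    rw [Real.norm_eq_abs, abs_of_pos (weight_pos s)]; exact weight_le_one s

/-- The product of coefficients representing the pointwise product of decaying functions. -/
def decayMul (f g : ℝ →ᵇ ℝ) : ℝ →ᵇ ℝ := weightBCF * (f * g)

lemma decay_decayMul (f g : ℝ →ᵇ ℝ) (s : ℝ) :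
    decay (decayMul f g) s = decay f s * decay g s := by
  simp [decay, decayMul, weightBCF]; ring

lemma norm_decayMul_le (f g : ℝ →ᵇ ℝ) : ‖decayMul f g‖ ≤ ‖f‖ * ‖g‖ := by
  have h : ‖weightBCF‖ ≤ 1 :=
    BoundedContinuousFunction.norm_ofNormedAddCommGroup_le _ zero_le_one _
  calc _ ≤ ‖weightBCF‖ * ‖f * g‖ := norm_mul_le _ _
    _ ≤ 1 * (‖f‖ * ‖g‖) := mul_le_mul h (norm_mul_le _ _) (norm_nonneg _) zero_le_one
    _ = _ := one_mul _

/-- The product of `f cos(ky)` and `g cos(ly)`. -/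
def mulTerm (k l : ℕ) (f g : ℝ →ᵇ ℝ) : Modes :=
  (1 / 2 : ℝ) • (single (k + l) (decayMul f g) + single (freqDiff k l) (decayMul f g))

lemma norm_mulTerm_le (k l : ℕ) (f g : ℝ →ᵇ ℝ) : ‖mulTerm k l f g‖ ≤ ‖f‖ * ‖g‖ := by
  have h := norm_decayMul_le f g
  rw [mulTerm, norm_smul]
  have := norm_add_le (single (k + l) (decayMul f g)) (single (freqDiff k l) (decayMul f g))
  rw [norm_single, norm_single] at this
  norm_num
  linarith

lemma summable_norm_mul (F G : Modes) : Summable fun p : ℕ × ℕ => ‖F p.1‖ * ‖G p.2‖ :=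
  F.summable_norm.mul_of_nonneg G.summable_norm (fun _ => norm_nonneg _) fun _ => norm_nonneg _

lemma summable_mulTerm (F G : Modes) :
    Summable fun p : ℕ × ℕ => mulTerm p.1 p.2 (F p.1) (G p.2) :=
  .of_norm_bounded (summable_norm_mul F G) fun _ => norm_mulTerm_le _ _ _ _

lemma decayMul_add_left (f f' g : ℝ →ᵇ ℝ) :
    decayMul (f + f') g = decayMul f g + decayMul f' g := by simp only [decayMul]; ring

lemma decayMul_add_right (f g g' : ℝ →ᵇ ℝ) :
    decayMul f (g + g') = decayMul f g + decayMul f g' := by simp only [decayMul]; ring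

lemma decayMul_smul_left (r : ℝ) (f g : ℝ →ᵇ ℝ) : decayMul (r • f) g = r • decayMul f g := by
  ext s; simp [decayMul]; ring

lemma decayMul_smul_right (r : ℝ) (f g : ℝ →ᵇ ℝ) : decayMul f (r • g) = r • decayMul f g := by
  ext s; simp [decayMul]; ring

/-- Multiplication in the Wiener algebra: the Cauchy product of cosine series. -/
def mul : Modes →L[ℝ] Modes →L[ℝ] Modes :=
  LinearMap.mkContinuous₂
    (LinearMap.mk₂ ℝ (fun F G => ∑' p : ℕ × ℕ, mulTerm p.1 p.2 (F p.1) (G p.2))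
      (fun F F' G => by
        rw [← (summable_mulTerm F G).tsum_add (summable_mulTerm F' G)]
        refine tsum_congr fun p => ?_
        simp only [mulTerm, lp.coeFn_add, Pi.add_apply, decayMul_add_left, single_add, smul_add]
        abel)
      (fun r F G => by
        rw [← (summable_mulTerm F G).tsum_const_smul r]
        refine tsum_congr fun p => ?_
        simp only [mulTerm, lp.coeFn_smul, Pi.smul_apply, decayMul_smul_left, single_smul,
          smul_add, smul_comm r])
      (fun F G G' => by
        rw [← (summable_mulTerm F G).tsum_add (summable_mulTerm F G')]
        refine tsum_congr fun p => ?_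
        simp only [mulTerm, lp.coeFn_add, Pi.add_apply, decayMul_add_right, single_add, smul_add]
        abel)
      (fun r F G => by
        rw [← (summable_mulTerm F G).tsum_const_smul r]
        refine tsum_congr fun p => ?_
        simp only [mulTerm, lp.coeFn_smul, Pi.smul_apply, decayMul_smul_right, single_smul,
          smul_add, smul_comm r]))
    1 (fun F G => by
      rw [one_mul, LinearMap.mk₂_apply, ← F.hasSum_norm.tsum_eq, ← G.hasSum_norm.tsum_eq,
        F.summable_norm.tsum_mul_tsum G.summable_norm (summable_norm_mul F G)]
      exact tsum_of_norm_bounded (summable_norm_mul F G).hasSum fun _ => norm_mulTerm_le _ _ _ _)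

lemma mul_apply (F G : Modes) :
    mul F G = ∑' p : ℕ × ℕ, mulTerm p.1 p.2 (F p.1) (G p.2) := rfl

lemma mulTerm_zero_left (k l : ℕ) (g : ℝ →ᵇ ℝ) : mulTerm k l 0 g = 0 := by
  rw [← norm_le_zero_iff]; simpa using norm_mulTerm_le k l 0 g

lemma mulTerm_zero_right (k l : ℕ) (f : ℝ →ᵇ ℝ) : mulTerm k l f 0 = 0 := by
  rw [← norm_le_zero_iff]; simpa using norm_mulTerm_le k l f 0

lemma mul_single_single (k l : ℕ) (f g : ℝ →ᵇ ℝ) :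
    mul (single k f) (single l g) = mulTerm k l f g := by
  rw [mul_apply, tsum_eq_single (k, l)]
  · simp only [single_self]
  · rintro ⟨i, j⟩ h
    by_cases hi : i = k
    · have hj : j ≠ l := fun hj => h (by rw [hi, hj])
      simp only [single_ne g hj, mulTerm_zero_right]
    · simp only [single_ne f hi, mulTerm_zero_left]

lemma abs_eval_term_le (F : Modes) (s : ℝ) (y : Torus) (k : ℕ) :
    ‖decay (F k) s * cosTorus (k • y)‖ ≤ weight s * ‖F k‖ := by
  rw [Real.norm_eq_abs, abs_mul]
  calc _ ≤ (‖F k‖ * weight s) * 1 :=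
        mul_le_mul (abs_decay_le _ _) (abs_cosTorus_le _) (abs_nonneg _)
          (mul_nonneg (norm_nonneg _) (weight_pos s).le)
    _ = _ := by ring

lemma summable_eval (F : Modes) (s : ℝ) (y : Torus) :
    Summable fun k => decay (F k) s * cosTorus (k • y) :=
  .of_norm_bounded (F.summable_norm.mul_left _) (F.abs_eval_term_le s y)

/-- Evaluation at a point of the cylinder. -/
def eval (s : ℝ) (y : Torus) : Modes →L[ℝ] ℝ :=
  LinearMap.mkContinuous
    { toFun := fun F => ∑' k, decay (F k) s * cosTorus (k • y)
      map_add' := fun F G => by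
        rw [← (F.summable_eval s y).tsum_add (G.summable_eval s y)]
        refine tsum_congr fun k => ?_
        rw [lp.coeFn_add, Pi.add_apply, decay_add, add_mul]
      map_smul' := fun r F => by
        rw [RingHom.id_apply, smul_eq_mul, ← tsum_mul_left]
        refine tsum_congr fun k => ?_
        rw [lp.coeFn_smul, Pi.smul_apply, decay_smul, mul_assoc] }
    (weight s) (fun F => by
      exact tsum_of_norm_bounded (F.hasSum_norm.mul_left _) (F.abs_eval_term_le s y))

lemma eval_apply (s : ℝ) (y : Torus) (F : Modes) :
    eval s y F = ∑' k, decay (F k) s * cosTorus (k • y) := rfl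

lemma hasSum_eval (s : ℝ) (y : Torus) (F : Modes) :
    HasSum (fun k => decay (F k) s * cosTorus (k • y)) (eval s y F) :=
  (F.summable_eval s y).hasSum

lemma abs_eval_le (s : ℝ) (y : Torus) (F : Modes) : |eval s y F| ≤ weight s * ‖F‖ :=
  tsum_of_norm_bounded (F.hasSum_norm.mul_left _) (F.abs_eval_term_le s y)

lemma eval_single (s : ℝ) (y : Torus) (k : ℕ) (f : ℝ →ᵇ ℝ) :
    eval s y (single k f) = decay f s * cosTorus (k • y) := by
  rw [eval_apply, tsum_eq_single k, single_self]
  intro j hj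
  rw [single_ne f hj]; simp [decay]

lemma eval_mul (s : ℝ) (y : Torus) (F G : Modes) :
    eval s y (mul F G) = eval s y F * eval s y G := by
  rw [mul_apply, (eval s y).map_tsum (summable_mulTerm F G), eval_apply s y F, eval_apply s y G,
    tsum_mul_tsum_of_summable_norm (F.summable_eval s y).norm (G.summable_eval s y).norm]
  refine tsum_congr fun p => ?_
  rw [mulTerm, map_smul, map_add, eval_single, eval_single, smul_eq_mul, decay_decayMul,
    mul_mul_mul_comm, cosTorus_mul_cosTorus]
  ring

end Modes

/-! ### Lyapunov–Schmidt reduction in an abstract algebra -/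

namespace Bifurcation

variable {X : Type*} [NormedAddCommGroup X] [NormedSpace ℝ X]

/-- The leading quadratic source `3 Q e²`. -/
def source (B : X →L[ℝ] X →L[ℝ] X) (Q e : X) : X := (3 : ℝ) • B Q (B e e)

/-- The cubic coefficient `6 Q e S(3Qe²) + e³` of the reduced equation. -/
def cubic (B : X →L[ℝ] X →L[ℝ] X) (S : X →L[ℝ] X) (Q e : X) : X :=
  (6 : ℝ) • B Q (B e (S (source B Q e))) + B e (B e e)

/-- The right-hand side after blow-up. Writing `V = δ (r e + δ S H)` and `H = r² source + δ K`,
the equation `δ² H = δ² D V + 3 Q V² + V³` becomes `K = rescaled δ r K`, which is regular at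
`δ = 0`. -/
def rescaled (B : X →L[ℝ] X →L[ℝ] X) (S D : X →L[ℝ] X) (Q e : X) (δ r : ℝ) (K : X) : X :=
  (6 * r) • B Q (B e (S (r ^ 2 • source B Q e + δ • K)))
    + (3 * δ) • B Q (B (S (r ^ 2 • source B Q e + δ • K)) (S (r ^ 2 • source B Q e + δ • K)))
    + (r • e + δ • D (r ^ 2 • source B Q e + δ • K))
    + B (r • e + δ • S (r ^ 2 • source B Q e + δ • K))
        (B (r • e + δ • S (r ^ 2 • source B Q e + δ • K))
          (r • e + δ • S (r ^ 2 • source B Q e + δ • K)))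

lemma rescaled_zero (B : X →L[ℝ] X →L[ℝ] X) (S D : X →L[ℝ] X) (Q e : X) (r : ℝ) (K : X) :
    rescaled B S D Q e 0 r K = r ^ 3 • cubic B S Q e + r • e := by
  simp only [rescaled, cubic, zero_smul, add_zero, mul_zero, map_smul, _root_.smul_apply]
  module

/-- The system whose zeros are the solutions of `K = rescaled δ r K`, `ℓ K = 0`. -/
def system (B : X →L[ℝ] X →L[ℝ] X) (S D : X →L[ℝ] X) (Q e : X) (ℓ : X →L[ℝ] ℝ)
    (v : ℝ × (ℝ × X)) : ℝ × X :=
  (ℓ (rescaled B S D Q e v.1 v.2.1 v.2.2), v.2.2 - rescaled B S D Q e v.1 v.2.1 v.2.2)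

lemma contDiff_system (B : X →L[ℝ] X →L[ℝ] X) (S D : X →L[ℝ] X) (Q e : X) (ℓ : X →L[ℝ] ℝ) :
    ContDiff ℝ 1 (system B S D Q e ℓ) := by
  unfold system rescaled
  fun_prop

/-- The derivative of the system in the unknowns `(r, K)` at `δ = 0` is triangular. -/
def triangular (σ : ℝ) (hσ : σ ≠ 0) (s : X) : (ℝ × X) ≃L[ℝ] (ℝ × X) :=
  ContinuousLinearEquiv.equivOfInverse
    ((σ • ContinuousLinearMap.fst ℝ ℝ X).prod
      (ContinuousLinearMap.snd ℝ ℝ X - (ContinuousLinearMap.fst ℝ ℝ X).smulRight s))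
    ((σ⁻¹ • ContinuousLinearMap.fst ℝ ℝ X).prod
      (ContinuousLinearMap.snd ℝ ℝ X + (σ⁻¹ • ContinuousLinearMap.fst ℝ ℝ X).smulRight s))
    (fun x => by ext <;> simp [hσ])
    (fun x => by ext <;> simp [hσ])

/-- A simple nonzero root `r₀` of the reduced cubic `r + ℓ(cubic) r³` continues to a branch of
solutions of the blown-up equation. -/
theorem exists_branch [CompleteSpace X] (B : X →L[ℝ] X →L[ℝ] X) (S D : X →L[ℝ] X) (Q e : X)
    (ℓ : X →L[ℝ] ℝ) (r₀ : ℝ) (he : ℓ e = 1) (hr : r₀ ^ 2 * ℓ (cubic B S Q e) = -1) :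
    ∃ δ₀ > 0, ∃ C > 0, ∀ δ : ℝ, |δ| < δ₀ → ∃ r K, |r - r₀| ≤ C * |δ| ∧ ‖K‖ ≤ C ∧
      K = rescaled B S D Q e δ r K ∧ ℓ K = 0 := by
  set p := cubic B S Q e with hp
  set u : ℝ × (ℝ × X) := (0, (r₀, r₀ ^ 3 • p + r₀ • e)) with hu
  set Φ := system B S D Q e ℓ with hΦ
  have cdf : ContDiffAt ℝ 1 Φ u := (contDiff_system B S D Q e ℓ).contDiffAt
  have hℓ0 : ℓ (r₀ ^ 3 • p + r₀ • e) = 0 := by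
    simp only [map_add, map_smul, he, smul_eq_mul]
    linear_combination r₀ * hr
  have hΦu : Φ u = 0 := by
    simp only [hΦ, hu, system, rescaled_zero, ← hp, hℓ0, sub_self, Prod.mk_zero_zero]
  -- The root `r₀` of `r + ℓ(p) r³` is simple: the derivative there is `1 - 3 = -2`.
  have hσ : ℓ ((3 * r₀ ^ 2) • p + e) = -2 := by
    simp only [map_add, map_smul, he, smul_eq_mul]
    linear_combination 3 * hr
  have hinv : (fderiv ℝ Φ u ∘L .inr ℝ ℝ (ℝ × X)).IsInvertible := by
    refine ⟨triangular (-2) (by norm_num) ((3 * r₀ ^ 2) • p + e), ?_⟩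
    have h1 : HasFDerivAt (fun x : ℝ × X => Φ (0, x)) (fderiv ℝ Φ u ∘L .inr ℝ ℝ (ℝ × X)) u.2 :=
      HasFDerivAt.comp (g := Φ) u.2
        (cdf.differentiableAt one_ne_zero).hasFDerivAt (hasFDerivAt_prodMk_right 0 u.2)
    have h2 : HasFDerivAt (fun x : ℝ × X => x.1 ^ 3 • p + x.1 • e)
        ((ContinuousLinearMap.fst ℝ ℝ X).smulRight ((3 * r₀ ^ 2) • p + e)) u.2 := by
      have h3 : HasDerivAt (fun r : ℝ => r ^ 3 • p + r • e) ((3 * r₀ ^ 2) • p + e) r₀ := by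
        convert! ((hasDerivAt_pow 3 r₀).smul_const p).add ((hasDerivAt_id r₀).smul_const e)
          using 1
        simp
      exact h3.hasFDerivAt.comp u.2 (hasFDerivAt_fst (𝕜 := ℝ) (p := u.2))
    have h4 : HasFDerivAt (fun x : ℝ × X => Φ (0, x))
        (triangular (-2) (by norm_num) ((3 * r₀ ^ 2) • p + e) : (ℝ × X) →L[ℝ] (ℝ × X)) u.2 := by
      have e1 : (fun x : ℝ × X => Φ (0, x))
          = fun x => (ℓ (x.1 ^ 3 • p + x.1 • e), x.2 - (x.1 ^ 3 • p + x.1 • e)) := by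
        funext x
        simp only [hΦ, system, rescaled_zero, ← hp]
      rw [e1]
      convert! (ℓ.hasFDerivAt.comp u.2 h2).prodMk (hasFDerivAt_snd.sub h2) using 1
      ext <;> simp [triangular, hσ]
    exact (h4.unique h1)
  set ψ := cdf.implicitFunction one_ne_zero hinv with hψ
  have h0 : ψ 0 = u.2 := cdf.implicitFunction_apply_self one_ne_zero hinv
  have hev : ∀ᶠ δ in nhds (0:ℝ), Φ (δ, ψ δ) = 0 := by
    have := cdf.eventually_apply_implicitFunction one_ne_zero hinv
    rwa [hΦu] at this
  have hO := (cdf.hasStrictFDerivAt_implicitFunction one_ne_zero hinv).hasFDerivAt.isBigO_sub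
  obtain ⟨C, hC, hO⟩ := hO.exists_pos
  rw [Asymptotics.isBigOWith_iff] at hO
  obtain ⟨δ₀, hδ₀, hball⟩ := Metric.eventually_nhds_iff.1 (hev.and hO)
  refine ⟨min δ₀ 1, lt_min hδ₀ one_pos, C + ‖u.2‖, by positivity, fun δ hδ => ?_⟩
  have hδ1 : |δ| < 1 := hδ.trans_le (min_le_right _ _)
  obtain ⟨h1, h2⟩ := hball (y := δ)
    (by rw [Real.dist_eq, sub_zero]; exact hδ.trans_le (min_le_left _ _))
  have h3 : ‖ψ δ - u.2‖ ≤ C * |δ| := by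
    have : u.1 = 0 := rfl
    rw [this, sub_zero, ← hψ, h0] at h2
    exact h2
  have h5 := congrArg Prod.snd h1
  have h6 := congrArg Prod.fst h1
  simp only [hΦ, system, Prod.snd_zero, Prod.fst_zero, sub_eq_zero] at h5 h6
  refine ⟨(ψ δ).1, (ψ δ).2, ?_, ?_, h5, by rw [h5]; exact h6⟩
  · calc |(ψ δ).1 - r₀| = ‖(ψ δ - u.2).1‖ := rfl
      _ ≤ ‖ψ δ - u.2‖ := norm_fst_le _
      _ ≤ C * |δ| := h3
      _ ≤ _ := by gcongr; linarith [norm_nonneg u.2]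
  · calc ‖(ψ δ).2‖ ≤ ‖ψ δ‖ := norm_snd_le _
      _ = ‖(ψ δ - u.2) + u.2‖ := by rw [sub_add_cancel]
      _ ≤ ‖ψ δ - u.2‖ + ‖u.2‖ := norm_add_le _ _
      _ ≤ C * 1 + ‖u.2‖ := by
          gcongr; exact h3.trans (by gcongr)
      _ = _ := by ring

end Bifurcation

/-! ### Integrals of powers of the hyperbolic secant -/

lemma integrable_weight : Integrable weight := by
  have h1 : IntegrableOn weight (Set.Ioi 0) := by
    refine (integrableOn_exp_mul_Ioi (by norm_num : -(1 / 2 : ℝ) < 0) 0).congr_fun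
      (fun t ht => ?_) measurableSet_Ioi
    rw [weight_of_nonneg (le_of_lt ht)]; ring_nf
  have h2 : IntegrableOn weight (Set.Iic 0) := by
    refine (integrableOn_exp_mul_Iic (by norm_num : (0:ℝ) < 1 / 2) 0).congr_fun
      (fun t ht => ?_) measurableSet_Iic
    rw [← weight_neg, weight_of_nonneg (by simpa using ht)]; ring_nf
  rw [← integrableOn_univ, ← Set.Iic_union_Ioi (a := (0:ℝ))]
  exact h2.union h1

lemma integrable_of_abs_le_weight {f : ℝ → ℝ} (hf : Continuous f) {C : ℝ}
    (h : ∀ s, |f s| ≤ C * weight s) : Integrable f :=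
  (integrable_weight.const_mul C).mono' hf.aestronglyMeasurable (Eventually.of_forall h)

lemma sech_le_weight (s : ℝ) : sech s ≤ 2 * weight s := by
  refine (sech_le s).trans ?_
  have : Real.exp (-|s|) ≤ weight s := Real.exp_le_exp.2 (by have := abs_nonneg s; linarith)
  linarith

lemma sech_pow_le_weight (n : ℕ) (s : ℝ) : sech s ^ (n + 1) ≤ 2 * weight s := by
  have h := sech_le_weight s
  have h1 : sech s ^ n ≤ 1 := pow_le_one₀ (sech_pos s).le (sech_le_one s)
  rw [pow_succ]
  nlinarith [sech_pos s]

lemma integrable_sech_pow (n : ℕ) : Integrable fun s => sech s ^ (n + 1) :=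
  integrable_of_abs_le_weight (continuous_sech.pow _) fun s => by
    rw [abs_of_pos (pow_pos (sech_pos s) _)]; exact sech_pow_le_weight n s

lemma tendsto_tanh_atTop : Tendsto Real.tanh atTop (nhds 1) := by
  have h : Tendsto (fun s : ℝ => 1 - Real.exp (-s) * sech s) atTop (nhds (1 - 0)) := by
    refine tendsto_const_nhds.sub ?_
    refine squeeze_zero' (Eventually.of_forall fun s => ?_) (Eventually.of_forall fun s => ?_)
      Real.tendsto_exp_neg_atTop_nhds_zero
    · have := sech_pos s; positivity
    · exact mul_le_of_le_one_right (Real.exp_pos _).le (sech_le_one s)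
  rw [sub_zero] at h
  refine h.congr fun s => ?_
  have h2 := sech_mul_cosh s
  rw [← sech_mul_sinh]
  have : Real.exp (-s) = Real.cosh s - Real.sinh s := (Real.cosh_sub_sinh s).symm
  rw [this]
  linear_combination -h2

lemma tendsto_tanh_atBot : Tendsto Real.tanh atBot (nhds (-1)) := by
  have h := (tendsto_tanh_atTop.comp tendsto_neg_atBot_atTop).neg
  refine h.congr fun s => ?_
  simp [Real.tanh_neg]

lemma integral_sech_pow_four : ∫ s, sech s ^ 4 = 4 / 3 := by
  have h := integral_of_hasDerivAt_of_tendsto (f' := fun s => sech s ^ 4)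
    (fun s => by
      convert! (hasDerivAt_tanh s).sub (((hasDerivAt_tanh s).pow 3).div_const 3) using 1
      have := tanh_sq_eq s
      push_cast; linear_combination (sech s ^ 2) * this)
    (integrable_sech_pow 3) (tendsto_tanh_atBot.sub ((tendsto_tanh_atBot.pow 3).div_const 3))
    (tendsto_tanh_atTop.sub ((tendsto_tanh_atTop.pow 3).div_const 3))
  rw [h]; norm_num

lemma integral_sech_pow_six : ∫ s, sech s ^ 6 = 16 / 15 := by
  have h := integral_of_hasDerivAt_of_tendsto (f' := fun s => sech s ^ 6)
    (fun s => by
      convert! ((hasDerivAt_tanh s).sub (((hasDerivAt_tanh s).pow 3).const_mul (2 / 3))).add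
        (((hasDerivAt_tanh s).pow 5).div_const 5) using 1
      have := sech_sq_add_tanh_sq s
      have h2 : sech s ^ 2 = 1 - Real.tanh s ^ 2 := by linarith
      have h6 : sech s ^ 6 = (sech s ^ 2) ^ 2 * sech s ^ 2 := by ring
      rw [h6, h2]; push_cast; ring)
    (integrable_sech_pow 5) ((tendsto_tanh_atBot.sub ((tendsto_tanh_atBot.pow 3).const_mul
      (2 / 3))).add ((tendsto_tanh_atBot.pow 5).div_const 5))
    ((tendsto_tanh_atTop.sub ((tendsto_tanh_atTop.pow 3).const_mul
      (2 / 3))).add ((tendsto_tanh_atTop.pow 5).div_const 5))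
  rw [h]; norm_num

lemma integral_sech_pow_eight : ∫ s, sech s ^ 8 = 32 / 35 := by
  have h := integral_of_hasDerivAt_of_tendsto (f' := fun s => sech s ^ 8)
    (fun s => by
      convert! (((hasDerivAt_tanh s).sub ((hasDerivAt_tanh s).pow 3)).add
        (((hasDerivAt_tanh s).pow 5).const_mul (3 / 5))).sub
        (((hasDerivAt_tanh s).pow 7).div_const 7) using 1
      have := sech_sq_add_tanh_sq s
      have h2 : sech s ^ 2 = 1 - Real.tanh s ^ 2 := by linarith
      have h8 : sech s ^ 8 = (sech s ^ 2) ^ 3 * sech s ^ 2 := by ring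
      rw [h8, h2]; push_cast; ring)
    (integrable_sech_pow 7) (((tendsto_tanh_atBot.sub (tendsto_tanh_atBot.pow 3)).add
      ((tendsto_tanh_atBot.pow 5).const_mul (3 / 5))).sub
      ((tendsto_tanh_atBot.pow 7).div_const 7))
    (((tendsto_tanh_atTop.sub (tendsto_tanh_atTop.pow 3)).add
      ((tendsto_tanh_atTop.pow 5).const_mul (3 / 5))).sub
      ((tendsto_tanh_atTop.pow 7).div_const 7))
  rw [h]; norm_num

lemma integral_eq_two_mul_Ioi {f : ℝ → ℝ} (hf : ∀ s, f (-s) = f s) :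
    ∫ s, f s = 2 * ∫ s in Set.Ioi (0:ℝ), f s := by
  rw [← integral_comp_abs]
  refine integral_congr_ae (Eventually.of_forall fun s => ?_)
  rcases abs_choice s with h | h <;> simp only [h, hf]

/-! ### The sign of the cubic coefficient -/

/-- The coefficient representing the function `sech^(n+1)`. -/
def sechPow (n : ℕ) : ℝ →ᵇ ℝ :=
  BoundedContinuousFunction.ofNormedAddCommGroup (fun s => (weight s)⁻¹ * sech s ^ (n + 1))
    ((continuous_weight.inv₀ fun s => (weight_pos s).ne').mul (continuous_sech.pow _)) 2
    fun s => by
      rw [Real.norm_eq_abs, abs_of_pos (mul_pos (inv_pos.2 (weight_pos s))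
        (pow_pos (sech_pos s) _)), inv_mul_le_iff₀ (weight_pos s)]
      linarith [sech_pow_le_weight n s]

lemma decay_sechPow (n : ℕ) (s : ℝ) : decay (sechPow n) s = sech s ^ (n + 1) := by
  have := (weight_pos s).ne'
  simp [decay, sechPow]
  field_simp

lemma decay_injective : Function.Injective decay := fun f g h => by
  ext s
  exact mul_left_cancel₀ (weight_pos s).ne' (congrFun h s)

/-- The solution of `-z'' + (1 + 3k² - 6 sech²) z = sech⁵`, the corrector at frequency `k`
in rescaled variables. -/
def corrector (k : ℕ) : ℝ → ℝ := decay (modeResolvent k (sechPow 4))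

lemma corrector_even (k : ℕ) (s : ℝ) : corrector k (-s) = corrector k s :=
  modeResolvent_even k _ s

lemma continuous_corrector (k : ℕ) : Continuous (corrector k) := continuous_decay _

lemma exists_abs_corrector_le (k : ℕ) : ∃ C, ∀ s, |corrector k s| ≤ C * weight s :=
  ⟨_, abs_decay_le _⟩

lemma exists_corrector_deriv {k : ℕ} (hk : k ≠ 1) :
    ∃ dz : ℝ → ℝ, (∀ s, HasDerivAt (corrector k) (dz s) s) ∧
      (∀ s, HasDerivAt dz
        ((1 + 3 * (k : ℝ) ^ 2 - 6 * sech s ^ 2) * corrector k s - sech s ^ 5) s) ∧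
      ∃ C, ∀ s, |dz s| ≤ C * weight s := by
  obtain ⟨dz, h1, h2⟩ := exists_isModeSolution k (sechPow 4) fun h => absurd h hk
  refine ⟨dz, h1.hasDerivAt, fun s => ?_, 240 * ‖sechPow 4‖, fun s => ?_⟩
  · simpa [decay_sechPow, sech_abs, corrector] using h1.hasDerivAt_deriv s
  · refine le_trans ?_ (h2 s)
    exact le_mul_of_one_le_left (abs_nonneg _) (by linarith [Nat.cast_nonneg (α := ℝ) k])

lemma continuous_of_hasDerivAt {f f' : ℝ → ℝ} (h : ∀ s, HasDerivAt f (f' s) s) :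
    Continuous f := continuous_iff_continuousAt.2 fun s => (h s).continuousAt

lemma abs_mul_le_weight {f g : ℝ → ℝ} {C D : ℝ} (hf : ∀ s, |f s| ≤ C * weight s)
    (hg : ∀ s, |g s| ≤ D) (s : ℝ) : |f s * g s| ≤ (C * D) * weight s := by
  rw [abs_mul]
  calc _ ≤ (C * weight s) * D :=
        mul_le_mul (hf s) (hg s) (abs_nonneg _) ((abs_nonneg _).trans (hf s))
    _ = _ := by ring

lemma abs_le_of_le_weight {f : ℝ → ℝ} {C : ℝ} (hf : ∀ s, |f s| ≤ C * weight s) (s : ℝ) :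
    |f s| ≤ C := by
  have hC : 0 ≤ C := by simpa [weight] using (abs_nonneg _).trans (hf 0)
  exact (hf s).trans (mul_le_of_le_one_right hC (weight_le_one s))

lemma integrable_sech_pow_mul_corrector (n k : ℕ) :
    Integrable fun s => sech s ^ (n + 1) * corrector k s := by
  obtain ⟨C, hC⟩ := exists_abs_corrector_le k
  refine integrable_of_abs_le_weight ((continuous_sech.pow _).mul (continuous_corrector k))
    (abs_mul_le_weight (C := 2) (D := C) (fun s => ?_) (abs_le_of_le_weight hC))
  rw [abs_of_pos (pow_pos (sech_pos s) _)]; exact sech_pow_le_weight n s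

/-- The pairing of `sech⁵` with the corrector at frequency zero, by Green's identity with the
explicit solution `sech³/6 - sech/3` of the corrector equation. -/
lemma integral_sech_mul_corrector_zero : ∫ s, sech s ^ 5 * corrector 0 s = -64 / 315 := by
  obtain ⟨dz, h1, h2, C, hC⟩ := exists_corrector_deriv (k := 0) (by norm_num)
  obtain ⟨C', hC'⟩ := exists_abs_corrector_le 0
  set v : ℝ → ℝ := fun s => sech s ^ 3 / 6 - sech s / 3 with hv
  set v' : ℝ → ℝ := fun s => -(sech s ^ 3 * Real.tanh s) / 2 + sech s * Real.tanh s / 3 with hv'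
  have hv1 : ∀ s, HasDerivAt v (v' s) s := fun s => by
    convert! (((hasDerivAt_sech s).pow 3).div_const 6).sub ((hasDerivAt_sech s).div_const 3)
      using 1
    simp only [hv']; push_cast; ring
  have hv2 : ∀ s, HasDerivAt v' ((1 - 6 * sech s ^ 2) * v s - sech s ^ 5) s := fun s => by
    convert! ((((hasDerivAt_sech s).pow 3).mul (hasDerivAt_tanh s)).neg.div_const 2).add
      (((hasDerivAt_sech s).mul (hasDerivAt_tanh s)).div_const 3) using 1
    have := tanh_sq_eq s
    simp only [hv, Pi.pow_apply]; push_cast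
    linear_combination (-3 / 2 * sech s ^ 3 + sech s / 3) * this
  have bv : ∀ s, |v s| ≤ 1 := fun s => by
    have h3 := sech_pos s; have h4 := sech_le_one s
    have h5 : sech s ^ 3 ≤ 1 := pow_le_one₀ h3.le h4
    have h6 : 0 < sech s ^ 3 := by positivity
    simp only [hv]
    rw [abs_le]; constructor <;> linarith
  have bv' : ∀ s, |v' s| ≤ 1 := fun s => by
    have h3 := sech_pos s; have h4 := sech_le_one s
    have h5 : sech s ^ 3 ≤ 1 := pow_le_one₀ h3.le h4
    have h6 : 0 < sech s ^ 3 := by positivity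
    have h7 := abs_tanh_le_one s
    have h8 : |sech s ^ 3 * Real.tanh s| ≤ 1 := by
      rw [abs_mul, abs_of_pos h6]; nlinarith [abs_nonneg (Real.tanh s)]
    have h9 : |sech s * Real.tanh s| ≤ 1 := by
      rw [abs_mul, abs_of_pos h3]; nlinarith [abs_nonneg (Real.tanh s)]
    rw [abs_le] at h8 h9
    simp only [hv']
    rw [abs_le]; constructor <;> linarith
  have cv := continuous_of_hasDerivAt hv1
  have cv' := continuous_of_hasDerivAt hv2
  have cdz := continuous_of_hasDerivAt h2
  have i1 := integrable_sech_pow_mul_corrector 4 0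
  have i2 : Integrable fun s => sech s ^ 5 * v s := by
    refine integrable_of_abs_le_weight ((continuous_sech.pow _).mul cv)
      (abs_mul_le_weight (C := 2) (fun s => ?_) bv)
    rw [abs_of_pos (pow_pos (sech_pos s) _)]; exact sech_pow_le_weight 4 s
  have key := integral_eq_zero_of_hasDerivAt_of_integrable
    (f := fun s => dz s * v s - corrector 0 s * v' s)
    (f' := fun s => sech s ^ 5 * corrector 0 s - sech s ^ 5 * v s)
    (fun s => by
      convert! ((h2 s).mul (hv1 s)).sub ((h1 s).mul (hv2 s)) using 1
      push_cast; ring)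
    (i1.sub i2)
    ((integrable_of_abs_le_weight (cdz.mul cv) (abs_mul_le_weight hC bv)).sub
      (integrable_of_abs_le_weight ((continuous_corrector 0).mul cv')
        (abs_mul_le_weight hC' bv')))
  rw [integral_sub i1 i2, sub_eq_zero] at key
  rw [key]
  have e : (fun s => sech s ^ 5 * v s) = fun s => 1 / 6 * sech s ^ 8 - 1 / 3 * sech s ^ 6 := by
    funext s; simp only [hv]; ring
  rw [e, integral_sub ((integrable_sech_pow 7).const_mul _) ((integrable_sech_pow 5).const_mul _),
    integral_const_mul, integral_const_mul, integral_sech_pow_eight, integral_sech_pow_six]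
  norm_num

/-- The energy estimate at frequency two: the operator `-∂² + 13 - 6 sech²` is at least `7`. -/
lemma integral_sech_mul_corrector_two_le : ∫ s, sech s ^ 5 * corrector 2 s ≤ 32 / 245 := by
  obtain ⟨dz, h1, h2, C, hC⟩ := exists_corrector_deriv (k := 2) (by norm_num)
  obtain ⟨C', hC'⟩ := exists_abs_corrector_le 2
  have cz := continuous_corrector 2
  have cdz := continuous_of_hasDerivAt h2
  have hCb := abs_le_of_le_weight hC
  have hCb' := abs_le_of_le_weight hC'
  have bS : ∀ s, |1 + 3 * ((2:ℕ) : ℝ) ^ 2 - 6 * sech s ^ 2| ≤ 13 := fun s => by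
    have h3 := sech_pos s; have h4 := sech_le_one s
    rw [abs_le]; push_cast; constructor <;> nlinarith
  have i1 := integrable_sech_pow_mul_corrector 4 2
  have i2 : Integrable fun s => dz s * dz s :=
    integrable_of_abs_le_weight (cdz.mul cdz) (abs_mul_le_weight hC hCb)
  have i3 : Integrable fun s => corrector 2 s * corrector 2 s :=
    integrable_of_abs_le_weight (cz.mul cz) (abs_mul_le_weight hC' hCb')
  have cS : Continuous fun s => 1 + 3 * ((2:ℕ) : ℝ) ^ 2 - 6 * sech s ^ 2 := by
    have := continuous_sech; fun_prop
  have i4 : Integrable fun s => (corrector 2 s * corrector 2 s)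
      * (1 + 3 * ((2:ℕ) : ℝ) ^ 2 - 6 * sech s ^ 2) :=
    integrable_of_abs_le_weight ((cz.mul cz).mul cS)
      (abs_mul_le_weight (abs_mul_le_weight hC' hCb') bS)
  have i5 := (integrable_sech_pow 7)
  have key := integral_eq_zero_of_hasDerivAt_of_integrable
    (f := fun s => dz s * corrector 2 s)
    (f' := fun s => (corrector 2 s * corrector 2 s)
      * (1 + 3 * ((2:ℕ) : ℝ) ^ 2 - 6 * sech s ^ 2) - sech s ^ 5 * corrector 2 s + dz s * dz s)
    (fun s => by
      convert! (h2 s).mul (h1 s) using 1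
      ring)
    ((i4.sub i1).add i2)
    (integrable_of_abs_le_weight (cdz.mul cz) (abs_mul_le_weight hC hCb'))
  -- By Young's inequality `2 sech⁵ z ≤ 7 z² + sech¹⁰/7`, and `sech¹⁰ ≤ sech⁸`.
  have hle : ∫ s, (sech s ^ 5 * corrector 2 s - 1 / 7 * sech s ^ 8) ≤ 0 := by
    rw [← key]
    refine integral_mono (i1.sub (i5.const_mul _)) ((i4.sub i1).add i2) fun s => ?_
    have h3 := sech_pos s
    have h4 : sech s ^ 2 ≤ 1 := pow_le_one₀ h3.le (sech_le_one s)
    have h5 : 0 ≤ sech s ^ 8 * (1 - sech s ^ 2) := mul_nonneg (by positivity) (by linarith)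
    have h6 := mul_nonneg (mul_self_nonneg (corrector 2 s)) (sub_nonneg.2 h4)
    have h7 := sq_nonneg (7 * corrector 2 s - sech s ^ 5)
    push_cast
    nlinarith [mul_self_nonneg (dz s)]
  rw [integral_sub i1 (i5.const_mul _), integral_const_mul, integral_sech_pow_eight] at hle
  linarith

/-- The cubic coefficient of the reduced equation in rescaled variables, up to a positive
factor; `192/35` is `6 ∫ sech⁸`. -/
def reducedCubic : ℝ := 72 * (∫ s, sech s ^ 5 * (2 * corrector 0 s + corrector 2 s)) + 192 / 35

lemma integral_sech_mul_correctors :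
    ∫ s, sech s ^ 5 * (2 * corrector 0 s + corrector 2 s)
      = 2 * (∫ s, sech s ^ 5 * corrector 0 s) + ∫ s, sech s ^ 5 * corrector 2 s := by
  have i1 := integrable_sech_pow_mul_corrector 4 0
  have i2 := integrable_sech_pow_mul_corrector 4 2
  rw [← integral_const_mul, ← integral_add (i1.const_mul _) i2]
  refine integral_congr_ae (Eventually.of_forall fun s => ?_)
  simp only []; ring

lemma reducedCubic_neg : reducedCubic < 0 := by
  have h1 := integral_sech_mul_corrector_zero
  have h2 := integral_sech_mul_corrector_two_le
  rw [reducedCubic, integral_sech_mul_correctors, h1]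
  linarith

/-! ### The reduced equation of the soliton -/

lemma norm_le_of_one_add_mul_le {x y c : ℝ} (hc : 0 ≤ c) (hx : 0 ≤ x) (h : (1 + c) * x ≤ y) :
    x ≤ y := by nlinarith [mul_nonneg hc hx]

/-- The resolvents acting frequency by frequency. -/
def resolventModes : Modes →L[ℝ] Modes :=
  Modes.diag modeResolvent 240 fun k f =>
    norm_le_of_one_add_mul_le (sq_nonneg (k : ℝ)) (norm_nonneg _) (norm_modeResolvent_le k f)

/-- The resolvents followed by `-∂_y²`. -/
def resolventModesYY : Modes →L[ℝ] Modes :=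
  Modes.diag (fun k => (k : ℝ) ^ 2 • modeResolvent k) 240 fun k f => by
    rw [_root_.smul_apply, norm_smul, Real.norm_eq_abs, abs_of_nonneg (sq_nonneg (k : ℝ))]
    have := norm_modeResolvent_le k f
    nlinarith [norm_nonneg (modeResolvent k f)]

/-- The soliton `√2 sech` as an element of the algebra. -/
def solitonMode : Modes := Modes.single 0 (Real.sqrt 2 • sechPow 0)

/-- The kernel element `sech² cos y`. -/
def kernelMode : Modes := Modes.single 1 (sechPow 1)

lemma integrableOn_sech_sq_mul_decay (f : ℝ →ᵇ ℝ) :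
    IntegrableOn (fun t => sech t ^ 2 * decay f t) (Set.Ioi 0) := by
  refine (integrable_of_abs_le_weight ((continuous_sech.pow 2).mul (continuous_decay f))
    (abs_mul_le_weight (C := 2) (fun s => ?_) (abs_le_of_le_weight (abs_decay_le f)))).integrableOn
  rw [Pi.pow_apply, abs_of_pos (pow_pos (sech_pos s) _)]; exact sech_pow_le_weight 1 s

/-- The projection onto the kernel, normalized to be one on `sech² cos y`. -/
def kernelCoeff : Modes →L[ℝ] ℝ :=
  LinearMap.mkContinuous
    { toFun := fun F => 3 / 2 * ∫ t in Set.Ioi (0:ℝ), sech t ^ 2 * decay (F 1) t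
      map_add' := fun F G => by
        have h : ∀ t, sech t ^ 2 * decay ((F + G) 1) t
            = sech t ^ 2 * decay (F 1) t + sech t ^ 2 * decay (G 1) t := fun t => by
          rw [lp.coeFn_add, Pi.add_apply, decay_add, mul_add]
        simp only [h]
        rw [integral_add (integrableOn_sech_sq_mul_decay _) (integrableOn_sech_sq_mul_decay _),
          mul_add]
      map_smul' := fun r F => by
        have h : ∀ t, sech t ^ 2 * decay ((r • F) 1) t
            = r * (sech t ^ 2 * decay (F 1) t) := fun t => by
          rw [lp.coeFn_smul, Pi.smul_apply, decay_smul]; ring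
        simp only [h]
        rw [integral_const_mul, RingHom.id_apply, smul_eq_mul]; ring }
    (3 / 2 * ∫ t in Set.Ioi (0:ℝ), 1 * weight t) (fun F => by
      change |3 / 2 * ∫ t in Set.Ioi (0:ℝ), sech t ^ 2 * decay (F 1) t| ≤ _
      rw [abs_mul, abs_of_pos (by norm_num : (0:ℝ) < 3 / 2), mul_assoc]
      refine mul_le_mul_of_nonneg_left ?_ (by norm_num)
      rw [← integral_mul_const, ← Real.norm_eq_abs]
      refine norm_integral_le_of_norm_le
        ((integrable_weight.const_mul 1).mul_const _).integrableOn
        (Eventually.of_forall fun t => ?_)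
      have h1 := abs_decay_le (F 1) t
      have h2 : sech t ^ 2 ≤ 1 := pow_le_one₀ (sech_pos t).le (sech_le_one t)
      have h3 := F.norm_apply_le 1
      rw [Real.norm_eq_abs, abs_mul, abs_of_pos (pow_pos (sech_pos t) 2)]
      calc _ ≤ 1 * (‖F‖ * weight t) := by
            refine mul_le_mul h2 (h1.trans ?_) (abs_nonneg _) zero_le_one
            exact mul_le_mul_of_nonneg_right h3 (weight_pos t).le
        _ = _ := by ring)

lemma kernelCoeff_apply (F : Modes) :
    kernelCoeff F = 3 / 2 * ∫ t in Set.Ioi (0:ℝ), sech t ^ 2 * decay (F 1) t := rfl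

lemma kernelCoeff_single_one (f : ℝ →ᵇ ℝ) :
    kernelCoeff (Modes.single 1 f) = 3 / 2 * ∫ t in Set.Ioi (0:ℝ), sech t ^ 2 * decay f t := by
  rw [kernelCoeff_apply, Modes.single_self]

lemma kernelCoeff_single_ne {k : ℕ} (hk : k ≠ 1) (f : ℝ →ᵇ ℝ) :
    kernelCoeff (Modes.single k f) = 0 := by
  rw [kernelCoeff_apply, Modes.single_ne f hk.symm]; simp [decay]

lemma kernelCoeff_kernelMode : kernelCoeff kernelMode = 1 := by
  have h := integral_eq_two_mul_Ioi (f := fun s => sech s ^ 4) fun s => by rw [sech_neg]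
  rw [integral_sech_pow_four] at h
  have e : ∀ t, sech t ^ 2 * decay (sechPow 1) t = sech t ^ 4 := fun t => by
    rw [decay_sechPow]; ring
  rw [kernelMode, kernelCoeff_single_one]
  simp only [e]
  linarith

lemma source_eq : Bifurcation.source Modes.mul solitonMode kernelMode
    = Modes.single 0 ((3 / 2 * Real.sqrt 2) • sechPow 4)
      + Modes.single 2 ((3 / 2 * Real.sqrt 2) • sechPow 4) := by
  have e : Modes.decayMul (Real.sqrt 2 • sechPow 0) (Modes.decayMul (sechPow 1) (sechPow 1))
      = Real.sqrt 2 • sechPow 4 := by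
    refine decay_injective (funext fun s => ?_)
    simp only [Modes.decay_decayMul, decay_smul, decay_sechPow]; ring
  have f1 : freqDiff 1 1 = 0 := rfl
  have f2 : freqDiff 0 2 = 2 := rfl
  have f3 : freqDiff 0 0 = 0 := rfl
  simp only [Bifurcation.source, solitonMode, kernelMode, Modes.mul_single_single, Modes.mulTerm,
    map_smul, map_add, f1, f2, f3, e, Nat.reduceAdd]
  simp only [Modes.single_smul]
  module

lemma kernelCoeff_mul_single_zero (f : ℝ →ᵇ ℝ) :
    kernelCoeff (Modes.mul solitonMode (Modes.mul kernelMode (Modes.single 0 f)))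
      = 3 / 2 * (Real.sqrt 2 * ∫ t in Set.Ioi (0:ℝ), sech t ^ 5 * decay f t) := by
  have f1 : freqDiff 1 0 = 1 := rfl
  have f2 : freqDiff 0 1 = 1 := rfl
  have e : ∀ t, sech t ^ 2 * decay (Modes.decayMul (Real.sqrt 2 • sechPow 0)
      (Modes.decayMul (sechPow 1) f)) t = Real.sqrt 2 * (sech t ^ 5 * decay f t) := fun t => by
    simp only [Modes.decay_decayMul, decay_smul, decay_sechPow]; ring
  simp only [solitonMode, kernelMode, Modes.mul_single_single, Modes.mulTerm,
    map_smul, map_add, f1, f2, Nat.reduceAdd, kernelCoeff_single_one, e, integral_const_mul,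
    smul_eq_mul]
  ring

lemma kernelCoeff_mul_single_two (f : ℝ →ᵇ ℝ) :
    kernelCoeff (Modes.mul solitonMode (Modes.mul kernelMode (Modes.single 2 f)))
      = 3 / 4 * (Real.sqrt 2 * ∫ t in Set.Ioi (0:ℝ), sech t ^ 5 * decay f t) := by
  have f1 : freqDiff 1 2 = 1 := rfl
  have f2 : freqDiff 0 1 = 1 := rfl
  have f3 : freqDiff 0 3 = 3 := rfl
  have e : ∀ t, sech t ^ 2 * decay (Modes.decayMul (Real.sqrt 2 • sechPow 0)
      (Modes.decayMul (sechPow 1) f)) t = Real.sqrt 2 * (sech t ^ 5 * decay f t) := fun t => by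
    simp only [Modes.decay_decayMul, decay_smul, decay_sechPow]; ring
  simp only [solitonMode, kernelMode, Modes.mul_single_single, Modes.mulTerm,
    map_smul, map_add, f1, f2, f3, Nat.reduceAdd, kernelCoeff_single_one,
    kernelCoeff_single_ne (by norm_num : 3 ≠ 1), e, integral_const_mul,
    smul_eq_mul]
  ring

lemma kernelCoeff_cube :
    kernelCoeff (Modes.mul kernelMode (Modes.mul kernelMode kernelMode)) = 18 / 35 := by
  have f1 : freqDiff 1 2 = 1 := rfl
  have f2 : freqDiff 1 0 = 1 := rfl
  have f3 : freqDiff 1 1 = 0 := rfl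
  have e : ∀ t, sech t ^ 2 * decay (Modes.decayMul (sechPow 1)
      (Modes.decayMul (sechPow 1) (sechPow 1))) t = sech t ^ 8 := fun t => by
    simp only [Modes.decay_decayMul, decay_sechPow]; ring
  have h := integral_eq_two_mul_Ioi (f := fun s => sech s ^ 8) fun s => by rw [sech_neg]
  rw [integral_sech_pow_eight] at h
  simp only [kernelMode, Modes.mul_single_single, Modes.mulTerm,
    map_smul, map_add, f1, f2, f3, Nat.reduceAdd, kernelCoeff_single_one,
    kernelCoeff_single_ne (by norm_num : 3 ≠ 1), e, smul_eq_mul]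
  linarith

lemma kernelCoeff_cubic :
    kernelCoeff (Bifurcation.cubic Modes.mul resolventModes solitonMode kernelMode)
      = 3 / 32 * reducedCubic := by
  have e : ∀ k, decay (modeResolvent k (sechPow 4)) = corrector k := fun k => rfl
  have hs : ∀ k, ∫ s, sech s ^ 5 * corrector k s
      = 2 * ∫ s in Set.Ioi (0:ℝ), sech s ^ 5 * corrector k s := fun k =>
    integral_eq_two_mul_Ioi fun s => by rw [sech_neg, corrector_even]
  have h2 : Real.sqrt 2 * Real.sqrt 2 = 2 := Real.mul_self_sqrt (by norm_num)
  rw [Bifurcation.cubic, map_add, kernelCoeff_cube, source_eq, map_add, resolventModes,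
    Modes.diag_single, Modes.diag_single]
  simp only [map_smul, map_add, Modes.single_smul, kernelCoeff_mul_single_zero,
    kernelCoeff_mul_single_two, smul_eq_mul, e]
  rw [reducedCubic, integral_sech_mul_correctors, hs, hs]
  linear_combination (27 / 2 * (∫ s in Set.Ioi (0:ℝ), sech s ^ 5 * corrector 0 s)
    + 27 / 4 * (∫ s in Set.Ioi (0:ℝ), sech s ^ 5 * corrector 2 s)) * h2

/-! ### Classical derivatives on the cylinder are weak derivatives -/

/-- The covering of the cylinder by the plane. -/
def cylMk (q : ℝ × ℝ) : Cylinder := (q.1, (q.2 : Torus))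

lemma isOpenQuotientMap_cylMk : IsOpenQuotientMap cylMk :=
  IsOpenQuotientMap.prodMap IsOpenQuotientMap.id QuotientAddGroup.isOpenQuotientMap_mk

lemma continuous_cyl_iff {f : Cylinder → ℝ} : Continuous f ↔ Continuous fun q => f (cylMk q) :=
  isOpenQuotientMap_cylMk.isQuotientMap.continuous_iff

namespace IsTestFunction

variable {φ : Cylinder → ℝ}

lemma smooth' (hφ : IsTestFunction φ) :
    ContDiff ℝ ((⊤ : ℕ∞) : WithTop ℕ∞) fun q : ℝ × ℝ => φ (cylMk q) := hφ.smooth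

lemma continuous (hφ : IsTestFunction φ) : Continuous φ :=
  continuous_cyl_iff.2 hφ.smooth'.continuous

lemma hasFDerivAt (hφ : IsTestFunction φ) (q : ℝ × ℝ) :
    HasFDerivAt (fun q => φ (cylMk q)) (fderiv ℝ (fun q => φ (cylMk q)) q) q :=
  (hφ.smooth'.differentiable (by simp) q).hasFDerivAt

lemma hasDerivAt_fst (hφ : IsTestFunction φ) (s t : ℝ) :
    HasDerivAt (fun s : ℝ => φ (s, (t : Torus)))
      (fderiv ℝ (fun q => φ (cylMk q)) (s, t) (1, 0)) s :=
  (hφ.hasFDerivAt (s, t)).comp_hasDerivAt (f := fun s : ℝ => (s, t)) s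
    ((hasDerivAt_id s).prodMk (hasDerivAt_const s t))

lemma hasDerivAt_snd (hφ : IsTestFunction φ) (s t : ℝ) :
    HasDerivAt (fun t : ℝ => φ (s, (t : Torus)))
      (fderiv ℝ (fun q => φ (cylMk q)) (s, t) (0, 1)) t :=
  (hφ.hasFDerivAt (s, t)).comp_hasDerivAt t ((hasDerivAt_const t s).prodMk (hasDerivAt_id t))

lemma partialXi_cylMk (hφ : IsTestFunction φ) (q : ℝ × ℝ) :
    partialXi φ (cylMk q) = fderiv ℝ (fun q => φ (cylMk q)) q (1, 0) :=
  (hφ.hasDerivAt_fst q.1 q.2).deriv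

lemma partialY_cylMk (hφ : IsTestFunction φ) (q : ℝ × ℝ) :
    partialY φ (cylMk q) = fderiv ℝ (fun q => φ (cylMk q)) q (0, 1) := by
  have h := hφ.hasDerivAt_snd q.1 q.2
  rw [← add_zero q.2] at h
  have h2 := h.comp_const_add q.2 0
  rw [add_zero] at h2
  exact h2.deriv

lemma continuous_fderiv_apply (hφ : IsTestFunction φ) (w : ℝ × ℝ) :
    Continuous fun q => fderiv ℝ (fun q => φ (cylMk q)) q w :=
  (hφ.smooth'.continuous_fderiv (by simp)).clm_apply continuous_const

lemma continuous_partialXi (hφ : IsTestFunction φ) : Continuous (partialXi φ) := by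
  rw [continuous_cyl_iff]
  simpa only [hφ.partialXi_cylMk] using hφ.continuous_fderiv_apply (1, 0)

lemma continuous_partialY (hφ : IsTestFunction φ) : Continuous (partialY φ) := by
  rw [continuous_cyl_iff]
  simpa only [hφ.partialY_cylMk] using hφ.continuous_fderiv_apply (0, 1)

lemma hasCompactSupport_partialXi (hφ : IsTestFunction φ) :
    HasCompactSupport (partialXi φ) := by
  refine HasCompactSupport.intro hφ.compactSupport fun p hp => ?_
  have h := notMem_tsupport_iff_eventuallyEq.1 hp
  have h2 : (fun s : ℝ => φ (s, p.2)) =ᶠ[nhds p.1] fun _ => 0 :=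
    (Continuous.tendsto (by fun_prop : Continuous fun s : ℝ => (s, p.2)) p.1).eventually h
  rw [partialXi, h2.deriv_eq, deriv_const]

lemma hasCompactSupport_partialY (hφ : IsTestFunction φ) :
    HasCompactSupport (partialY φ) := by
  refine HasCompactSupport.intro hφ.compactSupport fun p hp => ?_
  have h := notMem_tsupport_iff_eventuallyEq.1 hp
  have hc : Continuous fun t : ℝ => (p.1, p.2 + (t : Torus)) :=
    continuous_const.prodMk (continuous_const.add (AddCircle.continuous_mk' _))
  have h1 : Tendsto (fun t : ℝ => (p.1, p.2 + (t : Torus))) (nhds 0) (nhds p) := by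
    have := hc.tendsto 0
    simpa using this
  have h2 : (fun t : ℝ => φ (p.1, p.2 + (t : Torus))) =ᶠ[nhds 0] fun _ => 0 := h1.eventually h
  rw [partialY, h2.deriv_eq, deriv_const]

lemma hasCompactSupport_section (hφ : IsTestFunction φ) (y : Torus) :
    HasCompactSupport fun s : ℝ => φ (s, y) := by
  refine HasCompactSupport.intro (hφ.compactSupport.isCompact.image continuous_fst)
    fun s hs => ?_
  by_contra h
  exact hs ⟨(s, y), subset_tsupport _ h, rfl⟩

lemma hasCompactSupport_partialXi_section (hφ : IsTestFunction φ) (y : Torus) :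
    HasCompactSupport fun s : ℝ => partialXi φ (s, y) := by
  refine HasCompactSupport.intro (hφ.hasCompactSupport_partialXi.isCompact.image continuous_fst)
    fun s hs => ?_
  by_contra h
  exact hs ⟨(s, y), subset_tsupport _ h, rfl⟩

end IsTestFunction

lemma isWeakPartialXi_of_hasDerivAt {u g : Cylinder → ℝ} (hu : Continuous u) (hg : Continuous g)
    (h : ∀ s t : ℝ, HasDerivAt (fun s : ℝ => u (s, (t : Torus))) (g (s, (t : Torus))) s) :
    IsWeakPartialXi u g := by
  intro φ hφ
  have c1 := hu.mul hφ.continuous_partialXi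
  have c2 := hg.mul hφ.continuous
  have i1 : Integrable fun p => u p * partialXi φ p :=
    c1.integrable_of_hasCompactSupport hφ.hasCompactSupport_partialXi.mul_left
  have i2 : Integrable fun p => g p * φ p :=
    c2.integrable_of_hasCompactSupport hφ.compactSupport.mul_left
  rw [eq_neg_iff_add_eq_zero, ← integral_add i1 i2, Measure.volume_eq_prod,
    integral_prod_symm _ (by rw [← Measure.volume_eq_prod]; exact i1.add i2)]
  refine integral_eq_zero_of_ae (Eventually.of_forall fun y => ?_)
  induction y using QuotientAddGroup.induction_on with
  | H t =>
    have cs : Continuous fun s : ℝ => ((s, (t : Torus)) : Cylinder) := by fun_prop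
    refine integral_eq_zero_of_hasDerivAt_of_integrable
      (f := fun s => u (s, (t : Torus)) * φ (s, (t : Torus))) (fun s => ?_) ?_ ?_
    · convert! (h s t).mul (hφ.hasDerivAt_fst s t) using 1
      rw [← hφ.partialXi_cylMk (s, t)]
      simp only [cylMk]
      exact add_comm _ _
    · exact ((c1.comp cs).integrable_of_hasCompactSupport
        (hφ.hasCompactSupport_partialXi_section _).mul_left).add
        ((c2.comp cs).integrable_of_hasCompactSupport
        (hφ.hasCompactSupport_section _).mul_left)
    · exact ((hu.comp cs).mul (hφ.continuous.comp cs)).integrable_of_hasCompactSupport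
        (hφ.hasCompactSupport_section _).mul_left

lemma isWeakPartialY_of_hasDerivAt {u g : Cylinder → ℝ} (hu : Continuous u) (hg : Continuous g)
    (h : ∀ s t : ℝ, HasDerivAt (fun t : ℝ => u (s, (t : Torus))) (g (s, (t : Torus))) t) :
    IsWeakPartialY u g := by
  intro φ hφ
  have c1 := hu.mul hφ.continuous_partialY
  have c2 := hg.mul hφ.continuous
  have i1 : Integrable fun p => u p * partialY φ p :=
    c1.integrable_of_hasCompactSupport hφ.hasCompactSupport_partialY.mul_left
  have i2 : Integrable fun p => g p * φ p :=
    c2.integrable_of_hasCompactSupport hφ.compactSupport.mul_left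
  rw [eq_neg_iff_add_eq_zero, ← integral_add i1 i2, Measure.volume_eq_prod,
    integral_prod _ (by rw [← Measure.volume_eq_prod]; exact i1.add i2)]
  refine integral_eq_zero_of_ae (Eventually.of_forall fun s => ?_)
  have ct : Continuous fun t : ℝ => ((s, (t : Torus)) : Cylinder) :=
    continuous_const.prodMk (AddCircle.continuous_mk' _)
  have hd : ∀ t : ℝ, HasDerivAt (fun t : ℝ => u (s, (t : Torus)) * φ (s, (t : Torus)))
      (u (s, (t : Torus)) * partialY φ (s, (t : Torus)) + g (s, (t : Torus)) * φ (s, (t : Torus)))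
      t := fun t => by
    convert! (h s t).mul (hφ.hasDerivAt_snd s t) using 1
    rw [← hφ.partialY_cylMk (s, t)]
    exact add_comm _ _
  change ∫ y : Torus, (u (s, y) * partialY φ (s, y) + g (s, y) * φ (s, y)) = 0
  rw [← AddCircle.intervalIntegral_preimage (2 * Real.pi) 0,
    intervalIntegral.integral_eq_sub_of_hasDerivAt (fun t _ => hd t)
      (((c1.comp ct).add (c2.comp ct)).intervalIntegrable _ _)]
  -- The boundary terms at the two ends of a period cancel.
  have e : (((0 + 2 * Real.pi : ℝ)) : Torus) = ((0 : ℝ) : Torus) := by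
    rw [zero_add, AddCircle.coe_period, AddCircle.coe_zero]
  rw [e, sub_self]

/-! ### Trigonometric series with exponentially decaying coefficients -/

/-- The exponential `e^{-|ξ|/4}` controlling all coefficients on the cylinder. -/
def slowWeight (ξ : ℝ) : ℝ := Real.exp (-(|ξ| / 4))

lemma slowWeight_pos (ξ : ℝ) : 0 < slowWeight ξ := Real.exp_pos _

lemma slowWeight_le_one (ξ : ℝ) : slowWeight ξ ≤ 1 :=
  Real.exp_le_one_iff.2 (by have := abs_nonneg ξ; linarith)

/-- The series `∑ₖ w_k(ξ) τ(ky)`, used with `τ = cos` and `τ = sin`. -/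
def trigSeries (τ : Torus → ℝ) (w : ℕ → ℝ → ℝ) (p : Cylinder) : ℝ :=
  ∑' k, w k p.1 * τ (k • p.2)

/-- The coefficients `w_k` are continuous and bounded by `M_k e^{-|ξ|/4}` with `∑ M_k < ∞`. -/
structure CoeffBound (M : ℕ → ℝ) (w : ℕ → ℝ → ℝ) : Prop where
  summable : Summable M
  continuous : ∀ k, Continuous (w k)
  abs_le : ∀ k ξ, |w k ξ| ≤ M k * slowWeight ξ

section TrigSeries

variable {M : ℕ → ℝ} {w w' : ℕ → ℝ → ℝ} {τ : Torus → ℝ}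

lemma CoeffBound.nonneg (h : CoeffBound M w) (k : ℕ) : 0 ≤ M k := by
  simpa [slowWeight] using (abs_nonneg _).trans (h.abs_le k 0)

lemma CoeffBound.norm_term_le (h : CoeffBound M w) (hτ : ∀ y, |τ y| ≤ 1) (k : ℕ)
    (p : Cylinder) : ‖w k p.1 * τ (k • p.2)‖ ≤ M k * slowWeight p.1 := by
  rw [Real.norm_eq_abs, abs_mul]
  calc _ ≤ (M k * slowWeight p.1) * 1 := mul_le_mul (h.abs_le k p.1) (hτ _) (abs_nonneg _)
        (mul_nonneg (h.nonneg k) (slowWeight_pos _).le)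
    _ = _ := mul_one _

lemma CoeffBound.norm_term_le' (h : CoeffBound M w) (hτ : ∀ y, |τ y| ≤ 1) (k : ℕ)
    (p : Cylinder) : ‖w k p.1 * τ (k • p.2)‖ ≤ M k :=
  (h.norm_term_le hτ k p).trans (mul_le_of_le_one_right (h.nonneg k) (slowWeight_le_one _))

lemma CoeffBound.hasSum (h : CoeffBound M w) (hτ : ∀ y, |τ y| ≤ 1) (p : Cylinder) :
    HasSum (fun k => w k p.1 * τ (k • p.2)) (trigSeries τ w p) :=
  (Summable.of_norm_bounded h.summable fun k => h.norm_term_le' hτ k p).hasSum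

lemma CoeffBound.abs_trigSeries_le (h : CoeffBound M w) (hτ : ∀ y, |τ y| ≤ 1) (p : Cylinder) :
    |trigSeries τ w p| ≤ (∑' k, M k) * slowWeight p.1 :=
  tsum_of_norm_bounded (h.summable.hasSum.mul_right _) fun k => h.norm_term_le hτ k p

lemma CoeffBound.continuous_trigSeries (h : CoeffBound M w) (hτ : ∀ y, |τ y| ≤ 1)
    (hc : Continuous τ) : Continuous (trigSeries τ w) :=
  continuous_tsum (fun k => ((h.continuous k).comp continuous_fst).mul
    (hc.comp ((continuous_nsmul k).comp continuous_snd))) h.summable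
    fun k p => h.norm_term_le' hτ k p

lemma CoeffBound.hasDerivAt_fst (h : CoeffBound M w) (h' : CoeffBound M w')
    (hτ : ∀ y, |τ y| ≤ 1) (hw : ∀ k s, HasDerivAt (w k) (w' k s) s) (s : ℝ) (y : Torus) :
    HasDerivAt (fun s => trigSeries τ w (s, y)) (trigSeries τ w' (s, y)) s :=
  hasDerivAt_tsum h.summable (fun k s => (hw k s).mul_const (τ (k • y)))
    (fun k s => h'.norm_term_le' hτ k (s, y)) (h.hasSum hτ (0, y)).summable s

lemma CoeffBound.hasDerivAt_snd_cos (h : CoeffBound M w)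
    (h' : CoeffBound M fun k s => -(k * w k s)) (s t : ℝ) :
    HasDerivAt (fun t : ℝ => trigSeries cosTorus w (s, (t : Torus)))
      (trigSeries sinTorus (fun k s => -(k * w k s)) (s, (t : Torus))) t := by
  refine hasDerivAt_tsum (g := fun k (t : ℝ) => w k s * cosTorus (k • (t : Torus)))
    (g' := fun k (t : ℝ) => -(k * w k s) * sinTorus (k • (t : Torus))) h.summable (fun k t => ?_)
    (fun k t => h'.norm_term_le' abs_sinTorus_le k (s, (t : Torus)))
    (h.hasSum abs_cosTorus_le (s, ((0:ℝ) : Torus))).summable t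
  simp only [cosTorus_nsmul_coe, sinTorus_nsmul_coe]
  convert! (((hasDerivAt_id t).const_mul (k : ℝ)).cos).const_mul (w k s) using 1
  simp only [id]; ring

lemma CoeffBound.hasDerivAt_snd_sin (h : CoeffBound M w)
    (h' : CoeffBound M fun k s => k * w k s) (s t : ℝ) :
    HasDerivAt (fun t : ℝ => trigSeries sinTorus w (s, (t : Torus)))
      (trigSeries cosTorus (fun k s => k * w k s) (s, (t : Torus))) t := by
  refine hasDerivAt_tsum (g := fun k (t : ℝ) => w k s * sinTorus (k • (t : Torus)))
    (g' := fun k (t : ℝ) => (k * w k s) * cosTorus (k • (t : Torus))) h.summable (fun k t => ?_)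
    (fun k t => h'.norm_term_le' abs_cosTorus_le k (s, (t : Torus)))
    (h.hasSum abs_sinTorus_le (s, ((0:ℝ) : Torus))).summable t
  simp only [cosTorus_nsmul_coe, sinTorus_nsmul_coe]
  convert! (((hasDerivAt_id t).const_mul (k : ℝ)).sin).const_mul (w k s) using 1
  simp only [id]; ring

lemma memLp_slowWeight : MemLp (fun p : Cylinder => slowWeight p.1) 2 := by
  have hc : Continuous fun p : Cylinder => slowWeight p.1 := by unfold slowWeight; fun_prop
  rw [memLp_two_iff_integrable_sq hc.aestronglyMeasurable]
  have h : Integrable (fun p : Cylinder => weight p.1 * (fun _ : Torus => (1:ℝ)) p.2) :=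
    integrable_weight.mul_prod (integrable_const 1)
  refine h.congr (Eventually.of_forall fun p => ?_)
  simp only [mul_one, weight, slowWeight]
  rw [← Real.exp_nat_mul]; congr 1; push_cast; ring

/-- The `L²` norm of `e^{-|ξ|/4}` on the cylinder. -/
def slowWeightNorm : ℝ := (eLpNorm (fun p : Cylinder => slowWeight p.1) 2 volume).toReal

lemma CoeffBound.memLp (h : CoeffBound M w) (hτ : ∀ y, |τ y| ≤ 1) (hc : Continuous τ) :
    MemLp (trigSeries τ w) 2 :=
  memLp_slowWeight.of_le_mul (c := ∑' k, M k)
    (h.continuous_trigSeries hτ hc).aestronglyMeasurable (Eventually.of_forall fun p => by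
      rw [Real.norm_eq_abs, Real.norm_eq_abs, abs_of_pos (slowWeight_pos _)]
      exact h.abs_trigSeries_le hτ p)

lemma CoeffBound.eLpNorm_le (h : CoeffBound M w) (hτ : ∀ y, |τ y| ≤ 1) :
    eLpNorm (trigSeries τ w) 2 volume ≤ ENNReal.ofReal ((∑' k, M k) * slowWeightNorm) := by
  rw [ENNReal.ofReal_mul (tsum_nonneg h.nonneg), slowWeightNorm,
    ENNReal.ofReal_toReal memLp_slowWeight.2.ne]
  refine eLpNorm_le_mul_eLpNorm_of_ae_le_mul (Eventually.of_forall fun p => ?_) 2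
  rw [Real.norm_eq_abs, Real.norm_eq_abs, abs_of_pos (slowWeight_pos _)]
  exact h.abs_trigSeries_le hτ p

end TrigSeries

/-- Twice differentiable cosine coefficients whose series, with all derivatives of order at most
two, converges absolutely with exponential decay. -/
structure CoeffBound₂ (M : ℕ → ℝ) (v v' v'' : ℕ → ℝ → ℝ) : Prop where
  summable : Summable M
  hasDerivAt : ∀ k s, HasDerivAt (v k) (v' k s) s
  hasDerivAt' : ∀ k s, HasDerivAt (v' k) (v'' k s) s
  continuous : ∀ k, Continuous (v'' k)
  abs_le : ∀ (k : ℕ) ξ, (1 + (k : ℝ) ^ 2) * |v k ξ| ≤ M k * slowWeight ξ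
  abs_le' : ∀ (k : ℕ) ξ, (1 + (k : ℝ)) * |v' k ξ| ≤ M k * slowWeight ξ
  abs_le'' : ∀ k ξ, |v'' k ξ| ≤ M k * slowWeight ξ

namespace CoeffBound₂

variable {M : ℕ → ℝ} {v v' v'' : ℕ → ℝ → ℝ}

lemma continuous₀ (h : CoeffBound₂ M v v' v'') (k : ℕ) : Continuous (v k) :=
  continuous_of_hasDerivAt (h.hasDerivAt k)

lemma continuous₁ (h : CoeffBound₂ M v v' v'') (k : ℕ) : Continuous (v' k) :=
  continuous_of_hasDerivAt (h.hasDerivAt' k)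

lemma coeff (h : CoeffBound₂ M v v' v'') : CoeffBound M v :=
  ⟨h.summable, h.continuous₀, fun k ξ =>
    norm_le_of_one_add_mul_le (sq_nonneg (k : ℝ)) (abs_nonneg _) (h.abs_le k ξ)⟩

lemma coeff_x (h : CoeffBound₂ M v v' v'') : CoeffBound M v' :=
  ⟨h.summable, h.continuous₁, fun k ξ =>
    norm_le_of_one_add_mul_le (Nat.cast_nonneg k) (abs_nonneg _) (h.abs_le' k ξ)⟩

lemma coeff_xx (h : CoeffBound₂ M v v' v'') : CoeffBound M v'' :=
  ⟨h.summable, h.continuous, h.abs_le''⟩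

lemma coeff_y (h : CoeffBound₂ M v v' v'') : CoeffBound M fun k s => -(k * v k s) :=
  ⟨h.summable, fun k => (continuous_const.mul (h.continuous₀ k)).neg, fun k ξ => by
    rw [abs_neg, abs_mul, Nat.abs_cast]
    refine le_trans ?_ (h.abs_le k ξ)
    gcongr
    nlinarith [sq_nonneg ((k : ℝ) - 1)]⟩

lemma coeff_xy (h : CoeffBound₂ M v v' v'') : CoeffBound M fun k s => -(k * v' k s) :=
  ⟨h.summable, fun k => (continuous_const.mul (h.continuous₁ k)).neg, fun k ξ => by
    rw [abs_neg, abs_mul, Nat.abs_cast]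
    refine le_trans ?_ (h.abs_le' k ξ)
    gcongr
    linarith⟩

lemma coeff_yy (h : CoeffBound₂ M v v' v'') : CoeffBound M fun k s => k * -(k * v k s) :=
  ⟨h.summable, fun k => continuous_const.mul (continuous_const.mul (h.continuous₀ k)).neg,
    fun k ξ => by
    rw [abs_mul, abs_neg, abs_mul, Nat.abs_cast, ← mul_assoc]
    refine le_trans ?_ (h.abs_le k ξ)
    gcongr
    nlinarith⟩

/-- The weak derivatives of a cosine series, differentiated term by term. -/
def h2Data (h : CoeffBound₂ M v v' v'') : H2Data (trigSeries cosTorus v) where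
  dx := trigSeries cosTorus v'
  dy := trigSeries sinTorus fun k s => -(k * v k s)
  dxx := trigSeries cosTorus v''
  dxy := trigSeries sinTorus fun k s => -(k * v' k s)
  dyy := trigSeries cosTorus fun k s => k * -(k * v k s)
  memLp := h.coeff.memLp abs_cosTorus_le continuous_cosTorus
  memLp_dx := h.coeff_x.memLp abs_cosTorus_le continuous_cosTorus
  memLp_dy := h.coeff_y.memLp abs_sinTorus_le continuous_sinTorus
  memLp_dxx := h.coeff_xx.memLp abs_cosTorus_le continuous_cosTorus
  memLp_dxy := h.coeff_xy.memLp abs_sinTorus_le continuous_sinTorus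
  memLp_dyy := h.coeff_yy.memLp abs_cosTorus_le continuous_cosTorus
  weak_dx := isWeakPartialXi_of_hasDerivAt
    (h.coeff.continuous_trigSeries abs_cosTorus_le continuous_cosTorus)
    (h.coeff_x.continuous_trigSeries abs_cosTorus_le continuous_cosTorus)
    fun s t => h.coeff.hasDerivAt_fst h.coeff_x abs_cosTorus_le h.hasDerivAt s t
  weak_dy := isWeakPartialY_of_hasDerivAt
    (h.coeff.continuous_trigSeries abs_cosTorus_le continuous_cosTorus)
    (h.coeff_y.continuous_trigSeries abs_sinTorus_le continuous_sinTorus)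
    (h.coeff.hasDerivAt_snd_cos h.coeff_y)
  weak_dxx := isWeakPartialXi_of_hasDerivAt
    (h.coeff_x.continuous_trigSeries abs_cosTorus_le continuous_cosTorus)
    (h.coeff_xx.continuous_trigSeries abs_cosTorus_le continuous_cosTorus)
    fun s t => h.coeff_x.hasDerivAt_fst h.coeff_xx abs_cosTorus_le h.hasDerivAt' s t
  weak_dxy := isWeakPartialY_of_hasDerivAt
    (h.coeff_x.continuous_trigSeries abs_cosTorus_le continuous_cosTorus)
    (h.coeff_xy.continuous_trigSeries abs_sinTorus_le continuous_sinTorus)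
    (h.coeff_x.hasDerivAt_snd_cos h.coeff_xy)
  weak_dyy := isWeakPartialY_of_hasDerivAt
    (h.coeff_y.continuous_trigSeries abs_sinTorus_le continuous_sinTorus)
    (h.coeff_yy.continuous_trigSeries abs_cosTorus_le continuous_cosTorus)
    (h.coeff_y.hasDerivAt_snd_sin h.coeff_yy)

lemma h2Norm_le (h : CoeffBound₂ M v v' v'') :
    h2Norm (trigSeries cosTorus v) ≤ ENNReal.ofReal (3 * ((∑' k, M k) * slowWeightNorm)) := by
  refine (iInf_le _ h.h2Data).trans ?_
  set a := ENNReal.ofReal ((∑' k, M k) * slowWeightNorm) with ha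
  have h1 : eLpNorm (trigSeries cosTorus v) 2 volume ≤ a := h.coeff.eLpNorm_le abs_cosTorus_le
  have h2 : eLpNorm h.h2Data.dx 2 volume ≤ a := h.coeff_x.eLpNorm_le abs_cosTorus_le
  have h3 : eLpNorm h.h2Data.dy 2 volume ≤ a := h.coeff_y.eLpNorm_le abs_sinTorus_le
  have h4 : eLpNorm h.h2Data.dxx 2 volume ≤ a := h.coeff_xx.eLpNorm_le abs_cosTorus_le
  have h5 : eLpNorm h.h2Data.dxy 2 volume ≤ a := h.coeff_xy.eLpNorm_le abs_sinTorus_le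
  have h6 : eLpNorm h.h2Data.dyy 2 volume ≤ a := h.coeff_yy.eLpNorm_le abs_cosTorus_le
  calc h.h2Data.norm ≤ (a ^ 2 + a ^ 2 + a ^ 2 + a ^ 2 + a ^ 2 + a ^ 2) ^ (1 / 2 : ℝ) := by
        unfold H2Data.norm; gcongr
    _ ≤ ((3 * a) ^ 2) ^ (1 / 2 : ℝ) := by
        gcongr
        have e : a ^ 2 + a ^ 2 + a ^ 2 + a ^ 2 + a ^ 2 + a ^ 2 = 6 * a ^ 2 := by ring
        rw [e, mul_pow]
        gcongr
        norm_num
    _ = 3 * a := by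
        rw [← ENNReal.rpow_natCast, ← ENNReal.rpow_mul]; norm_num
    _ = _ := by
        rw [ENNReal.ofReal_mul (by norm_num), ha]; norm_num

lemma memH2Even (h : CoeffBound₂ M v v' v'') (hv : ∀ k s, v k (-s) = v k s) :
    MemH2Even (trigSeries cosTorus v) := by
  refine ⟨⟨h.h2Data⟩, Eventually.of_forall fun p => ?_, Eventually.of_forall fun p => ?_⟩
  · simp only [trigSeries, hv]
  · simp only [trigSeries, smul_neg, cosTorus_neg]

end CoeffBound₂

/-! ### Rescaled profiles -/

lemma weight_mul_le_slowWeight {κ : ℝ} (hκ : 1 / 2 ≤ κ) (ξ : ℝ) :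
    weight (κ * ξ) ≤ slowWeight ξ := by
  refine Real.exp_le_exp.2 ?_
  rw [abs_mul, abs_of_nonneg (by linarith)]
  nlinarith [abs_nonneg ξ]

/-- A function with three derivatives, all of size at most `C sech`. -/
structure Profile (C : ℝ) (G G₁ G₂ G₃ : ℝ → ℝ) : Prop where
  hasDerivAt : ∀ s, HasDerivAt G (G₁ s) s
  hasDerivAt₁ : ∀ s, HasDerivAt G₁ (G₂ s) s
  hasDerivAt₂ : ∀ s, HasDerivAt G₂ (G₃ s) s
  abs_le : ∀ s, |G s| ≤ C * sech s
  abs_le₁ : ∀ s, |G₁ s| ≤ C * sech s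
  abs_le₂ : ∀ s, |G₂ s| ≤ C * sech s
  abs_le₃ : ∀ s, |G₃ s| ≤ C * sech s

lemma abs_mul_tanh_le {x s C : ℝ} (h : |x| ≤ C) : |x * Real.tanh s| ≤ C := by
  rw [abs_mul]
  exact (mul_le_of_le_one_right (abs_nonneg _) (abs_tanh_le_one s)).trans h

lemma profile_sech : Profile 32 sech (fun s => -(sech s * Real.tanh s))
    (fun s => (1 - 2 * sech s ^ 2) * sech s)
    (fun s => (6 * sech s ^ 3 - sech s) * Real.tanh s) where
  hasDerivAt := hasDerivAt_sech
  hasDerivAt₁ s := by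
    convert! ((hasDerivAt_sech s).mul (hasDerivAt_tanh s)).neg using 1
    linear_combination -(sech s) * tanh_sq_eq s
  hasDerivAt₂ s := by
    convert! ((((hasDerivAt_sech s).pow 2).const_mul 2).const_sub 1).mul (hasDerivAt_sech s) using 1
    simp only [Pi.pow_apply]; push_cast; ring
  abs_le s := by
    have := sech_pos s
    rw [abs_of_pos this]; linarith
  abs_le₁ s := by
    have := sech_pos s
    rw [abs_neg]; exact abs_mul_tanh_le (by rw [abs_of_pos this]; linarith)
  abs_le₂ s := by
    have h := sech_pos s
    have h1 : sech s ^ 2 ≤ 1 := pow_le_one₀ h.le (sech_le_one s)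
    rw [abs_mul, abs_of_pos h]
    refine mul_le_mul_of_nonneg_right ?_ h.le
    rw [abs_le]; constructor <;> nlinarith [sq_nonneg (sech s)]
  abs_le₃ s := by
    have h := sech_pos s
    have h1 : sech s ^ 2 ≤ 1 := pow_le_one₀ h.le (sech_le_one s)
    refine abs_mul_tanh_le ?_
    rw [show 6 * sech s ^ 3 - sech s = (6 * sech s ^ 2 - 1) * sech s by ring, abs_mul,
      abs_of_pos h]
    refine mul_le_mul_of_nonneg_right ?_ h.le
    rw [abs_le]; constructor <;> nlinarith [sq_nonneg (sech s)]

lemma profile_sech_sq : Profile 32 (fun s => sech s ^ 2)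
    (fun s => -2 * (sech s ^ 2 * Real.tanh s))
    (fun s => (4 - 6 * sech s ^ 2) * sech s ^ 2)
    (fun s => (24 * sech s ^ 4 - 8 * sech s ^ 2) * Real.tanh s) where
  hasDerivAt := greenPairTwo.hasDerivAt_φ
  hasDerivAt₁ s := by
    convert! greenPairTwo.hasDerivAt_dφ s using 1
    simp only [greenPairTwo]; ring
  hasDerivAt₂ s := by
    convert! ((((hasDerivAt_sech s).pow 2).const_mul 6).const_sub 4).mul
      ((hasDerivAt_sech s).pow 2) using 1
    simp only [Pi.pow_apply]; push_cast; ring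
  abs_le s := by
    have h := sech_pos s
    have h1 := sech_le_one s
    rw [abs_of_pos (by positivity)]; nlinarith
  abs_le₁ s := by
    have h := sech_pos s
    have h1 := sech_le_one s
    rw [← mul_assoc]
    refine abs_mul_tanh_le ?_
    rw [abs_mul, abs_neg, abs_two, abs_of_pos (by positivity)]; nlinarith
  abs_le₂ s := by
    have h := sech_pos s
    have h1 := sech_le_one s
    have h2 : sech s ^ 2 ≤ 1 := pow_le_one₀ h.le h1
    rw [show (4 - 6 * sech s ^ 2) * sech s ^ 2 = ((4 - 6 * sech s ^ 2) * sech s) * sech s by ring,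
      abs_mul, abs_of_pos h]
    refine mul_le_mul_of_nonneg_right ?_ h.le
    rw [abs_mul, abs_of_pos h]
    have : |4 - 6 * sech s ^ 2| ≤ 32 := by
      rw [abs_le]; constructor <;> nlinarith [sq_nonneg (sech s)]
    nlinarith [abs_nonneg (4 - 6 * sech s ^ 2)]
  abs_le₃ s := by
    have h := sech_pos s
    have h1 := sech_le_one s
    have h2 : sech s ^ 2 ≤ 1 := pow_le_one₀ h.le h1
    refine abs_mul_tanh_le ?_
    rw [show 24 * sech s ^ 4 - 8 * sech s ^ 2
      = ((24 * sech s ^ 2 - 8) * sech s) * sech s by ring, abs_mul, abs_of_pos h]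
    refine mul_le_mul_of_nonneg_right ?_ h.le
    rw [abs_mul, abs_of_pos h]
    have : |24 * sech s ^ 2 - 8| ≤ 32 := by
      rw [abs_le]; constructor <;> nlinarith [sq_nonneg (sech s)]
    nlinarith [abs_nonneg (24 * sech s ^ 2 - 8)]

lemma abs_comp_mul_le {G : ℝ → ℝ} {C κ : ℝ} (hC : 0 ≤ C) (hG : ∀ s, |G s| ≤ C * sech s)
    (hκ : 1 / 2 ≤ κ) (ξ : ℝ) : |G (κ * ξ)| ≤ 2 * C * slowWeight ξ := by
  have h1 := sech_le_weight (κ * ξ)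
  have h2 := weight_mul_le_slowWeight hκ ξ
  calc _ ≤ C * sech (κ * ξ) := hG _
    _ ≤ C * (2 * slowWeight ξ) := by gcongr; linarith
    _ = _ := by ring

/-- Changing the speed in the argument of a profile costs the difference of the speeds and half of
the exponential decay. -/
lemma abs_sub_comp_mul_le {G G' : ℝ → ℝ} {C κ κ' : ℝ} (hC : 0 ≤ C)
    (hd : ∀ s, HasDerivAt G (G' s) s) (hG : ∀ s, |G' s| ≤ C * sech s)
    (hκ : 1 / 2 ≤ κ) (hκ' : 1 / 2 ≤ κ') (ξ : ℝ) :
    |G (κ * ξ) - G (κ' * ξ)| ≤ 8 * C * |κ - κ'| * slowWeight ξ := by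
  have hd' : ∀ x ∈ Set.Ici (1 / 2 : ℝ), HasDerivWithinAt (fun x => G (x * ξ)) (G' (x * ξ) * ξ)
      (Set.Ici (1 / 2)) x := fun x _ => by
    have h1 : HasDerivAt (fun x : ℝ => x * ξ) ξ x := by
      simpa using (hasDerivAt_id x).mul_const ξ
    exact ((hd (x * ξ)).comp x h1).hasDerivWithinAt
  have hb : ∀ x ∈ Set.Ici (1 / 2 : ℝ), ‖G' (x * ξ) * ξ‖ ≤ 8 * C * slowWeight ξ := fun x hx => by
    have hx' : 1 / 2 ≤ x := hx
    have h1 := sech_le (x * ξ)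
    have h2 : Real.exp (-|x * ξ|) ≤ slowWeight ξ * slowWeight ξ := by
      rw [slowWeight, ← Real.exp_add, abs_mul, abs_of_nonneg (by linarith)]
      refine Real.exp_le_exp.2 ?_
      nlinarith [abs_nonneg ξ]
    have h3 : slowWeight ξ * |ξ| ≤ 4 := by
      have h4 := Real.add_one_le_exp (|ξ| / 4)
      have h5 : slowWeight ξ * Real.exp (|ξ| / 4) = 1 := by
        rw [slowWeight, ← Real.exp_add]; simp
      nlinarith [slowWeight_pos ξ]
    rw [Real.norm_eq_abs, abs_mul]
    calc _ ≤ C * (2 * (slowWeight ξ * slowWeight ξ)) * |ξ| := by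
          gcongr; exact (hG _).trans (by gcongr; linarith)
      _ = 2 * C * slowWeight ξ * (slowWeight ξ * |ξ|) := by ring
      _ ≤ 2 * C * slowWeight ξ * 4 := by
          have := slowWeight_pos ξ; gcongr
      _ = _ := by ring
  have h := (convex_Ici (1 / 2 : ℝ)).norm_image_sub_le_of_norm_hasDerivWithin_le hd' hb
    (show κ' ∈ Set.Ici (1 / 2 : ℝ) from hκ') (show κ ∈ Set.Ici (1 / 2 : ℝ) from hκ)
  rw [Real.norm_eq_abs, Real.norm_eq_abs] at h
  linarith

lemma abs_lincomb_comp_mul_le {G G' : ℝ → ℝ} {C κ κ' A A' : ℝ} (hC : 0 ≤ C)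
    (hd : ∀ s, HasDerivAt G (G' s) s) (hG : ∀ s, |G s| ≤ C * sech s)
    (hG' : ∀ s, |G' s| ≤ C * sech s)
    (hκ : 1 / 2 ≤ κ) (hκ' : 1 / 2 ≤ κ') (ξ : ℝ) :
    |A * G (κ * ξ) - A' * G (κ' * ξ)|
      ≤ (2 * C * |A - A'| + 8 * C * |A'| * |κ - κ'|) * slowWeight ξ := by
  have h1 := abs_comp_mul_le hC hG hκ ξ
  have h2 := abs_sub_comp_mul_le hC hd hG' hκ hκ' ξ
  calc _ = |(A - A') * G (κ * ξ) + A' * (G (κ * ξ) - G (κ' * ξ))| := by ring_nf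
    _ ≤ |A - A'| * |G (κ * ξ)| + |A'| * |G (κ * ξ) - G (κ' * ξ)| := by
        rw [← abs_mul, ← abs_mul]; exact abs_add_le _ _
    _ ≤ |A - A'| * (2 * C * slowWeight ξ) + |A'| * (8 * C * |κ - κ'| * slowWeight ξ) := by
        gcongr
    _ = _ := by ring

lemma hasDerivAt_lincomb_comp_mul {G G' : ℝ → ℝ} (hd : ∀ s, HasDerivAt G (G' s) s)
    (κ κ' A A' ξ : ℝ) : HasDerivAt (fun ξ => A * G (κ * ξ) - A' * G (κ' * ξ))
      (A * κ * G' (κ * ξ) - A' * κ' * G' (κ' * ξ)) ξ := by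
  have h : ∀ κ : ℝ, HasDerivAt (fun ξ => G (κ * ξ)) (κ * G' (κ * ξ)) ξ := fun κ => by
    have h1 : HasDerivAt (fun x : ℝ => κ * x) κ ξ := by
      simpa using (hasDerivAt_id ξ).const_mul κ
    convert! (hd (κ * ξ)).comp ξ h1 using 1
    ring
  convert! ((h κ).const_mul A).sub ((h κ').const_mul A') using 1
  ring

/-! ### Building blocks of cosine series -/

namespace CoeffBound₂

lemma add {M N : ℕ → ℝ} {v v' v'' w w' w'' : ℕ → ℝ → ℝ} (hv : CoeffBound₂ M v v' v'')
    (hw : CoeffBound₂ N w w' w'') :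
    CoeffBound₂ (fun k => M k + N k) (fun k s => v k s + w k s) (fun k s => v' k s + w' k s)
      (fun k s => v'' k s + w'' k s) where
  summable := hv.summable.add hw.summable
  hasDerivAt k s := (hv.hasDerivAt k s).add (hw.hasDerivAt k s)
  hasDerivAt' k s := (hv.hasDerivAt' k s).add (hw.hasDerivAt' k s)
  continuous k := (hv.continuous k).add (hw.continuous k)
  abs_le k ξ := by
    have := hv.abs_le k ξ; have := hw.abs_le k ξ
    calc _ ≤ (1 + (k : ℝ) ^ 2) * (|v k ξ| + |w k ξ|) := by gcongr; exact abs_add_le _ _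
      _ ≤ _ := by linarith
  abs_le' k ξ := by
    have := hv.abs_le' k ξ; have := hw.abs_le' k ξ
    calc _ ≤ (1 + (k : ℝ)) * (|v' k ξ| + |w' k ξ|) := by gcongr; exact abs_add_le _ _
      _ ≤ _ := by linarith
  abs_le'' k ξ := by
    have := hv.abs_le'' k ξ; have := hw.abs_le'' k ξ
    calc _ ≤ |v'' k ξ| + |w'' k ξ| := abs_add_le _ _
      _ ≤ _ := by linarith

/-- The difference of two rescalings of a profile, as a series with one frequency. -/
lemma profile {C : ℝ} {G G₁ G₂ G₃ : ℝ → ℝ} (hG : Profile C G G₁ G₂ G₃) (hC : 0 ≤ C)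
    {κ κ' : ℝ} (A A' : ℝ) (hκ : 1 / 2 ≤ κ) (hκ1 : κ ≤ 1) (hκ' : 1 / 2 ≤ κ') (hκ1' : κ' ≤ 1)
    {k₀ : ℕ} (hk₀ : k₀ ≤ 1) :
    CoeffBound₂ (fun k => if k = k₀ then 24 * C * (|A - A'| + |A'| * |κ - κ'|) else 0)
      (fun k ξ => if k = k₀ then A * G (κ * ξ) - A' * G (κ' * ξ) else 0)
      (fun k ξ => if k = k₀ then A * κ * G₁ (κ * ξ) - A' * κ' * G₁ (κ' * ξ) else 0)
      (fun k ξ => if k = k₀ then A * κ * κ * G₂ (κ * ξ) - A' * κ' * κ' * G₂ (κ' * ξ)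
        else 0) := by
  have hN : 0 ≤ C * (|A - A'| + |A'| * |κ - κ'|) := by positivity
  have hk : (k₀ : ℝ) ≤ 1 := by exact_mod_cast hk₀
  have hk0 : (0:ℝ) ≤ k₀ := Nat.cast_nonneg _
  have hp := abs_nonneg (A - A')
  have hq : 0 ≤ |A'| * |κ - κ'| := by positivity
  have d1 : |A * κ - A' * κ'| ≤ |A - A'| + |A'| * |κ - κ'| := by
    calc _ = |(A - A') * κ + A' * (κ - κ')| := by ring_nf
      _ ≤ |A - A'| * |κ| + |A'| * |κ - κ'| := by
          rw [← abs_mul, ← abs_mul]; exact abs_add_le _ _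
      _ ≤ _ := by
          rw [abs_of_nonneg (by linarith : 0 ≤ κ)]; nlinarith
  have d2 : |A * κ * κ - A' * κ' * κ'| ≤ |A - A'| + 2 * (|A'| * |κ - κ'|) := by
    calc _ = |(A * κ - A' * κ') * κ + A' * (κ - κ') * κ'| := by ring_nf
      _ ≤ |A * κ - A' * κ'| * |κ| + |A'| * |κ - κ'| * |κ'| := by
          rw [← abs_mul, ← abs_mul, ← abs_mul]; exact abs_add_le _ _
      _ ≤ |A * κ - A' * κ'| * 1 + |A'| * |κ - κ'| * 1 := by
          rw [abs_of_nonneg (by linarith : 0 ≤ κ), abs_of_nonneg (by linarith : 0 ≤ κ')]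
          gcongr
      _ ≤ _ := by linarith
  have e1 : |A' * κ'| ≤ |A'| := by
    rw [abs_mul, abs_of_nonneg (by linarith : 0 ≤ κ')]; nlinarith [abs_nonneg A']
  have e2 : |A' * κ' * κ'| ≤ |A'| := by
    rw [abs_mul, abs_of_nonneg (by linarith : 0 ≤ κ')]; nlinarith [abs_nonneg (A' * κ')]
  have b0 : ∀ ξ, |A * G (κ * ξ) - A' * G (κ' * ξ)|
      ≤ (12 * C * (|A - A'| + |A'| * |κ - κ'|)) * slowWeight ξ := fun ξ => by
    refine (abs_lincomb_comp_mul_le hC hG.hasDerivAt hG.abs_le hG.abs_le₁ hκ hκ' ξ).trans ?_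
    refine mul_le_mul_of_nonneg_right ?_ (slowWeight_pos ξ).le
    nlinarith [mul_nonneg hC hp, mul_nonneg hC hq]
  have b1 : ∀ ξ, |A * κ * G₁ (κ * ξ) - A' * κ' * G₁ (κ' * ξ)|
      ≤ (12 * C * (|A - A'| + |A'| * |κ - κ'|)) * slowWeight ξ := fun ξ => by
    refine (abs_lincomb_comp_mul_le hC hG.hasDerivAt₁ hG.abs_le₁ hG.abs_le₂ hκ hκ' ξ).trans ?_
    refine mul_le_mul_of_nonneg_right ?_ (slowWeight_pos ξ).le
    calc _ ≤ 2 * C * (|A - A'| + |A'| * |κ - κ'|) + 8 * C * |A'| * |κ - κ'| := by gcongr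
      _ ≤ _ := by nlinarith [mul_nonneg hC hp, mul_nonneg hC hq]
  have b2 : ∀ ξ, |A * κ * κ * G₂ (κ * ξ) - A' * κ' * κ' * G₂ (κ' * ξ)|
      ≤ (12 * C * (|A - A'| + |A'| * |κ - κ'|)) * slowWeight ξ := fun ξ => by
    refine (abs_lincomb_comp_mul_le hC hG.hasDerivAt₂ hG.abs_le₂ hG.abs_le₃ hκ hκ' ξ).trans ?_
    refine mul_le_mul_of_nonneg_right ?_ (slowWeight_pos ξ).le
    calc _ ≤ 2 * C * (|A - A'| + 2 * (|A'| * |κ - κ'|)) + 8 * C * |A'| * |κ - κ'| := by gcongr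
      _ ≤ _ := by nlinarith [mul_nonneg hC hp, mul_nonneg hC hq]
  refine ⟨(hasSum_ite_eq k₀ _).summable, fun k s => ?_, fun k s => ?_, fun k => ?_,
    fun k ξ => ?_, fun k ξ => ?_, fun k ξ => ?_⟩
  · by_cases h : k = k₀
    · simpa only [h, if_true] using hasDerivAt_lincomb_comp_mul hG.hasDerivAt κ κ' A A' s
    · simpa only [h, if_false] using hasDerivAt_const s (0:ℝ)
  · by_cases h : k = k₀
    · simpa only [h, if_true] using
        hasDerivAt_lincomb_comp_mul hG.hasDerivAt₁ κ κ' (A * κ) (A' * κ') s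
    · simpa only [h, if_false] using hasDerivAt_const s (0:ℝ)
  · have hc := continuous_of_hasDerivAt hG.hasDerivAt₂
    by_cases h : k = k₀
    · simp only [h, if_true]; fun_prop
    · simp only [h, if_false]; exact continuous_const
  · by_cases h : k = k₀
    · simp only [h, if_true]
      have := b0 ξ
      calc _ ≤ 2 * ((12 * C * (|A - A'| + |A'| * |κ - κ'|)) * slowWeight ξ) := by
            gcongr; nlinarith
        _ = _ := by ring
    · simp [h]
  · by_cases h : k = k₀
    · simp only [h, if_true]
      have := b1 ξ
      calc _ ≤ 2 * ((12 * C * (|A - A'| + |A'| * |κ - κ'|)) * slowWeight ξ) := by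
            gcongr; linarith
        _ = _ := by ring
    · simp [h]
  · by_cases h : k = k₀
    · simp only [h, if_true]
      have := slowWeight_pos ξ
      refine (b2 ξ).trans (mul_le_mul_of_nonneg_right ?_ this.le)
      linarith
    · simp [h]

end CoeffBound₂

lemma abs_potential_le (k : ℕ) (s : ℝ) :
    |1 + 3 * (k : ℝ) ^ 2 - 6 * sech s ^ 2| ≤ 6 * (1 + (k : ℝ) ^ 2) := by
  have h2 : sech s ^ 2 ≤ 1 := pow_le_one₀ (sech_pos s).le (sech_le_one s)
  rw [abs_le]
  constructor <;> nlinarith [sq_nonneg (sech s), sq_nonneg (k : ℝ)]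

/-- The modes of the resolvent, rescaled. -/
lemma exists_coeffBound₂_modes (H : Modes) (hH : kernelCoeff H = 0) {κ : ℝ} (hκ : 1 / 2 ≤ κ)
    (hκ1 : κ ≤ 1) (ρ : ℝ) : ∃ v', CoeffBound₂ (fun k => |ρ| * (1500 * ‖H k‖))
      (fun k ξ => ρ * decay (resolventModes H k) (κ * ξ)) v'
      (fun k ξ => ρ * (κ ^ 2 * ((1 + 3 * (k : ℝ) ^ 2 - 6 * sech (κ * ξ) ^ 2)
        * decay (resolventModes H k) (κ * ξ) - decay (H k) |κ * ξ|))) := by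
  have hker : ∀ k : ℕ, k = 1 → ∫ t in Set.Ioi (0:ℝ), sech t ^ 2 * decay (H k) t = 0 := by
    rintro k rfl
    rw [kernelCoeff_apply] at hH
    linarith
  choose dz hdz hb using fun k => exists_isModeSolution k (H k) (hker k)
  have hlin : ∀ ξ, HasDerivAt (fun x : ℝ => κ * x) κ ξ := fun ξ => by
    simpa using (hasDerivAt_id ξ).const_mul κ
  have hw := weight_mul_le_slowWeight hκ
  refine ⟨fun k ξ => ρ * (κ * dz k (κ * ξ)), (H.summable_norm.mul_left _).mul_left _,
    fun k s => ?_, fun k s => ?_, fun k => ?_, fun k ξ => ?_, fun k ξ => ?_, fun k ξ => ?_⟩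
  · convert! (((hdz k).hasDerivAt (κ * s)).comp s (hlin s)).const_mul ρ using 1
    ring
  · convert! ((((hdz k).hasDerivAt_deriv (κ * s)).comp s (hlin s)).const_mul κ).const_mul ρ using 1
    simp only [resolventModes, Modes.diag_apply]; ring
  · have h1 := continuous_decay (resolventModes H k)
    have h2 := continuous_decay (H k)
    have h3 := continuous_sech
    fun_prop
  · have h1 := abs_modeResolvent_le k (H k) (κ * ξ)
    rw [abs_mul]
    calc _ = |ρ| * ((1 + (k : ℝ) ^ 2) * |decay (modeResolvent k (H k)) (κ * ξ)|) := by
          simp only [resolventModes, Modes.diag_apply]; ring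
      _ ≤ |ρ| * (240 * ‖H k‖ * slowWeight ξ) :=
          mul_le_mul_of_nonneg_left
            (h1.trans (mul_le_mul_of_nonneg_left (hw ξ) (by positivity))) (abs_nonneg ρ)
      _ ≤ |ρ| * (1500 * ‖H k‖ * slowWeight ξ) := by
          have := slowWeight_pos ξ; gcongr; norm_num
      _ = _ := by ring
  · have h1 := hb k (κ * ξ)
    rw [abs_mul, abs_mul, abs_of_nonneg (by linarith : 0 ≤ κ)]
    calc _ = |ρ| * (κ * ((1 + (k : ℝ)) * |dz k (κ * ξ)|)) := by ring
      _ ≤ |ρ| * (1 * (240 * ‖H k‖ * slowWeight ξ)) :=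
          mul_le_mul_of_nonneg_left (mul_le_mul hκ1
            (h1.trans (mul_le_mul_of_nonneg_left (hw ξ) (by positivity))) (by positivity)
            zero_le_one) (abs_nonneg ρ)
      _ ≤ |ρ| * (1 * (1500 * ‖H k‖ * slowWeight ξ)) := by
          have := slowWeight_pos ξ; gcongr; norm_num
      _ = _ := by ring
  · have h1 := abs_modeResolvent_le k (H k) (κ * ξ)
    have h2 := abs_potential_le k (κ * ξ)
    have h3 := abs_decay_le (H k) |κ * ξ|
    rw [weight_abs] at h3
    have h4 : κ ^ 2 ≤ 1 := pow_le_one₀ (by linarith) hκ1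
    simp only [resolventModes, Modes.diag_apply]
    rw [abs_mul, abs_mul, abs_of_nonneg (sq_nonneg κ)]
    calc _ ≤ |ρ| * (1 * (6 * (240 * ‖H k‖ * weight (κ * ξ)) + ‖H k‖ * weight (κ * ξ))) := by
          gcongr
          refine (abs_sub _ _).trans ?_
          refine add_le_add ?_ h3
          rw [abs_mul]
          calc _ ≤ 6 * (1 + (k : ℝ) ^ 2) * |decay (modeResolvent k (H k)) (κ * ξ)| := by gcongr
            _ = 6 * ((1 + (k : ℝ) ^ 2) * |decay (modeResolvent k (H k)) (κ * ξ)|) := by ring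
            _ ≤ _ := by gcongr
      _ = |ρ| * (1441 * ‖H k‖ * weight (κ * ξ)) := by ring
      _ ≤ |ρ| * (1500 * ‖H k‖ * slowWeight ξ) := by
          have := weight_pos (κ * ξ)
          gcongr
          · norm_num
          · exact hw ξ
      _ = _ := by ring

/-! ### Solutions on the cylinder -/

/-- Cosine coefficients of
`ρ (S H)(κξ, y) + (a₀ sech(κξ) - a₀' sech(κ'ξ)) + (a₁ sech²(κξ) - a₁' sech²(κ'ξ)) cos y`,
where `S` denotes the resolvent. -/
def branchCoeff (κ κ' ρ a₀ a₀' a₁ a₁' : ℝ) (H : Modes) (k : ℕ) (ξ : ℝ) : ℝ :=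
  ρ * decay (resolventModes H k) (κ * ξ)
    + (if k = 0 then a₀ * sech (κ * ξ) - a₀' * sech (κ' * ξ) else 0)
    + (if k = 1 then a₁ * sech (κ * ξ) ^ 2 - a₁' * sech (κ' * ξ) ^ 2 else 0)

/-- The second derivatives of the coefficients `branchCoeff` for `H` orthogonal to the bound state,
as given by the equation for the resolvents. -/
def branchCoeffDD (κ κ' ρ a₀ a₀' a₁ a₁' : ℝ) (H : Modes) (k : ℕ) (ξ : ℝ) : ℝ :=
  ρ * (κ ^ 2 * ((1 + 3 * (k : ℝ) ^ 2 - 6 * sech (κ * ξ) ^ 2)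
        * decay (resolventModes H k) (κ * ξ) - decay (H k) |κ * ξ|))
    + (if k = 0 then a₀ * κ * κ * ((1 - 2 * sech (κ * ξ) ^ 2) * sech (κ * ξ))
        - a₀' * κ' * κ' * ((1 - 2 * sech (κ' * ξ) ^ 2) * sech (κ' * ξ)) else 0)
    + (if k = 1 then a₁ * κ * κ * ((4 - 6 * sech (κ * ξ) ^ 2) * sech (κ * ξ) ^ 2)
        - a₁' * κ' * κ' * ((4 - 6 * sech (κ' * ξ) ^ 2) * sech (κ' * ξ) ^ 2) else 0)

/-- The summable majorant of the coefficients `branchCoeff`. -/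
def branchBound (κ κ' ρ a₀ a₀' a₁ a₁' : ℝ) (H : Modes) (k : ℕ) : ℝ :=
  |ρ| * (1500 * ‖H k‖) + (if k = 0 then 24 * 32 * (|a₀ - a₀'| + |a₀'| * |κ - κ'|) else 0)
    + (if k = 1 then 24 * 32 * (|a₁ - a₁'| + |a₁'| * |κ - κ'|) else 0)

lemma cosTorus_zero : cosTorus 0 = 1 := by
  rw [← AddCircle.coe_zero, cosTorus_coe, Real.cos_zero]

section Branch

variable {κ κ' : ℝ}

lemma exists_coeffBound₂_branch (H : Modes) (hH : kernelCoeff H = 0) (hκ : 1 / 2 ≤ κ)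
    (hκ1 : κ ≤ 1) (hκ' : 1 / 2 ≤ κ') (hκ1' : κ' ≤ 1) (ρ a₀ a₀' a₁ a₁' : ℝ) :
    ∃ v', CoeffBound₂ (branchBound κ κ' ρ a₀ a₀' a₁ a₁' H) (branchCoeff κ κ' ρ a₀ a₀' a₁ a₁' H) v'
      (branchCoeffDD κ κ' ρ a₀ a₀' a₁ a₁' H) := by
  obtain ⟨v', h⟩ := exists_coeffBound₂_modes H hH hκ hκ1 ρ
  exact ⟨_, (h.add (CoeffBound₂.profile profile_sech (by norm_num) a₀ a₀' hκ hκ1 hκ' hκ1'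
    (Nat.zero_le 1))).add (CoeffBound₂.profile profile_sech_sq (by norm_num) a₁ a₁' hκ hκ1 hκ'
    hκ1' le_rfl)⟩

lemma tsum_branchBound (κ κ' ρ a₀ a₀' a₁ a₁' : ℝ) (H : Modes) :
    ∑' k, branchBound κ κ' ρ a₀ a₀' a₁ a₁' H k = |ρ| * (1500 * ‖H‖)
      + 24 * 32 * (|a₀ - a₀'| + |a₀'| * |κ - κ'|) + 24 * 32 * (|a₁ - a₁'| + |a₁'| * |κ - κ'|) :=
  ((((H.hasSum_norm.mul_left 1500).mul_left |ρ|).add (hasSum_ite_eq 0 _)).add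
    (hasSum_ite_eq 1 _)).tsum_eq

lemma trigSeries_branchCoeff (κ κ' ρ a₀ a₀' a₁ a₁' : ℝ) (H : Modes) (p : Cylinder) :
    trigSeries cosTorus (branchCoeff κ κ' ρ a₀ a₀' a₁ a₁' H) p
      = ρ * Modes.eval (κ * p.1) p.2 (resolventModes H)
        + (a₀ * sech (κ * p.1) - a₀' * sech (κ' * p.1))
        + (a₁ * sech (κ * p.1) ^ 2 - a₁' * sech (κ' * p.1) ^ 2) * cosTorus p.2 := by
  have h1 := (Modes.hasSum_eval (κ * p.1) p.2 (resolventModes H)).mul_left ρ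
  have h2 := hasSum_ite_eq (0:ℕ) (a₀ * sech (κ * p.1) - a₀' * sech (κ' * p.1))
  have h3 := hasSum_ite_eq (1:ℕ)
    ((a₁ * sech (κ * p.1) ^ 2 - a₁' * sech (κ' * p.1) ^ 2) * cosTorus p.2)
  rw [← ((h1.add h2).add h3).tsum_eq, trigSeries]
  refine tsum_congr fun k => ?_
  rcases k with _ | _ | k
  · simp [branchCoeff, cosTorus_zero]
  · simp [branchCoeff]; ring
  · simp [branchCoeff]; ring

lemma resolventModes_even (H : Modes) (k : ℕ) (s : ℝ) :
    decay (resolventModes H k) (-s) = decay (resolventModes H k) s :=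
  modeResolvent_even k (H k) s

lemma branchCoeff_even (κ κ' ρ a₀ a₀' a₁ a₁' : ℝ) (H : Modes) (k : ℕ) (s : ℝ) :
    branchCoeff κ κ' ρ a₀ a₀' a₁ a₁' H k (-s) = branchCoeff κ κ' ρ a₀ a₀' a₁ a₁' H k s := by
  simp only [branchCoeff, mul_neg, resolventModes_even, sech_neg]

lemma decay_resolventModesYY (H : Modes) (k : ℕ) (s : ℝ) :
    decay (resolventModesYY H k) s = (k : ℝ) ^ 2 * decay (resolventModes H k) s := by
  simp only [resolventModesYY, resolventModes, Modes.diag_apply, _root_.smul_apply, decay_smul]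

/-- Evenness allows to pass from `s` to `|s|`, where the equation for the resolvents evaluates its
right-hand side. -/
lemma eval_abs_of_even {F : Modes} (hF : ∀ k s, decay (F k) (-s) = decay (F k) s) (s : ℝ)
    (y : Torus) : Modes.eval |s| y F = Modes.eval s y F := by
  simp only [Modes.eval_apply]
  rcases abs_choice s with h | h
  · rw [h]
  · rw [h]; simp only [hF]

/-- The element `√2 κ sech(κξ) + κ V(κξ, y)`, `V = δ r sech² cos y + δ² S H`, of the branch. -/
def branchFun (κ δ r : ℝ) (H : Modes) (p : Cylinder) : ℝ :=
  κ * δ ^ 2 * Modes.eval (κ * p.1) p.2 (resolventModes H) + κ * Real.sqrt 2 * sech (κ * p.1)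
    + κ * δ * r * sech (κ * p.1) ^ 2 * cosTorus p.2

lemma branchFun_eq (κ δ r : ℝ) (H : Modes) : branchFun κ δ r H
    = trigSeries cosTorus
      (branchCoeff κ κ (κ * δ ^ 2) (κ * Real.sqrt 2) 0 (κ * δ * r) 0 H) := by
  funext p
  rw [trigSeries_branchCoeff, branchFun]; ring

/-- If `H` solves the rescaled equation `δ² H = -δ² V_yy + 3QV² + V³`, then `branchFun` solves the
stationary equation with speed `c = κ² = 1/(3 - δ²)`. -/
theorem solvesTW_branchFun {δ r : ℝ} {H : Modes} (hκ : 1 / 2 ≤ κ) (hκ1 : κ ≤ 1)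
    (hδ : κ ^ 2 * (3 - δ ^ 2) = 1) (hker : kernelCoeff H = 0)
    (hH : ∀ s y, δ ^ 2 * Modes.eval s y H
      = δ ^ 2 * (δ * r * (sech s ^ 2 * cosTorus y)
          + δ ^ 2 * Modes.eval s y (resolventModesYY H))
        + 3 * (Real.sqrt 2 * sech s) * (δ * r * (sech s ^ 2 * cosTorus y)
          + δ ^ 2 * Modes.eval s y (resolventModes H)) ^ 2
        + (δ * r * (sech s ^ 2 * cosTorus y)
          + δ ^ 2 * Modes.eval s y (resolventModes H)) ^ 3) :
    MemH2Even (branchFun κ δ r H) ∧ SolvesTW (κ ^ 2) (branchFun κ δ r H)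
      ∧ Continuous (branchFun κ δ r H) := by
  obtain ⟨v', h⟩ := exists_coeffBound₂_branch H hker hκ hκ1 hκ hκ1 (κ * δ ^ 2)
    (κ * Real.sqrt 2) 0 (κ * δ * r) 0
  have hfun := branchFun_eq κ δ r H
  refine ⟨by rw [hfun]; exact h.memH2Even fun k s => branchCoeff_even _ _ _ _ _ _ _ _ _ _, ?_,
    by rw [hfun]; exact h.coeff.continuous_trigSeries abs_cosTorus_le continuous_cosTorus⟩
  rw [hfun]
  refine ⟨h.h2Data, Eventually.of_forall fun p => ?_⟩
  have s1 := h.coeff.hasSum abs_cosTorus_le p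
  have s2 := h.coeff_xx.hasSum abs_cosTorus_le p
  have s3 := h.coeff_yy.hasSum abs_cosTorus_le p
  have hL := (s2.neg.sub s3).add (s1.mul_left (κ ^ 2))
  obtain ⟨ξ, y⟩ := p
  set s := κ * ξ with hs
  -- Both sides of the equation are sums of cosine series, compared term by term in `hL` and `hR`.
  have t1 := Modes.hasSum_eval s y (resolventModes H)
  have t2 := Modes.hasSum_eval s y (resolventModesYY H)
  have t3 := Modes.hasSum_eval |s| y H
  have t4 := hasSum_ite_eq (0:ℕ) ((Real.sqrt 2 * sech s) ^ 3)
  have t5 := hasSum_ite_eq (1:ℕ) (δ * r * (sech s ^ 2 * cosTorus y))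
  have hR := ((t4.add ((t5.add (t1.mul_left (δ ^ 2))).mul_left (6 * sech s ^ 2))).sub
    ((t5.add (t2.mul_left (δ ^ 2))).mul_left (δ ^ 2))).add (t3.mul_left (δ ^ 2)) |>.mul_left (κ ^ 3)
  have h2 : Real.sqrt 2 ^ 3 = 2 * Real.sqrt 2 := by
    rw [pow_succ, Real.sq_sqrt (by norm_num)]
  have heq := hL.unique (hR.congr_fun fun k => ?_)
  · have e1 := hH |s| y
    rw [eval_abs_of_even (F := resolventModes H) (resolventModes_even H),
      eval_abs_of_even (F := resolventModesYY H) (fun k s => by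
        simp only [decay_resolventModesYY, resolventModes_even]), sech_abs] at e1
    have e2 : trigSeries cosTorus
      (branchCoeff κ κ (κ * δ ^ 2) (κ * Real.sqrt 2) 0 (κ * δ * r) 0 H) (ξ, y)
        = κ * (Real.sqrt 2 * sech s + (δ * r * (sech s ^ 2 * cosTorus y)
          + δ ^ 2 * Modes.eval s y (resolventModes H))) := by
      rw [← hfun, branchFun, hs]; ring
    have h22 : Real.sqrt 2 ^ 2 = 2 := Real.sq_sqrt (by norm_num)
    have heq' : -h.h2Data.dxx (ξ, y) - h.h2Data.dyy (ξ, y) + κ ^ 2 * trigSeries cosTorus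
      (branchCoeff κ κ (κ * δ ^ 2) (κ * Real.sqrt 2) 0 (κ * δ * r) 0 H) (ξ, y) = _ := heq
    rw [heq', e2]
    linear_combination κ ^ 3 * e1 - 3 * κ ^ 3 * sech s ^ 2 *
      (δ * r * (sech s ^ 2 * cosTorus y) + δ ^ 2 * Modes.eval s y (resolventModes H)) * h22
  -- Frequency by frequency, the linear part of the equation follows from the equation for the
  -- resolvents and from `k² (1 - 3κ²) = -κ² δ² k²`.
  · simp only [decay_resolventModesYY, branchCoeff, branchCoeffDD, ← hs]
    rcases k with _ | _ | k
    · simp [cosTorus_zero]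
      linear_combination (-κ ^ 3 * sech s ^ 3) * h2
    · simp
      linear_combination (-κ * cosTorus y
        * (δ * r * sech s ^ 2 + δ ^ 2 * decay (resolventModes H 1) s)) * hδ
    · simp
      linear_combination (-κ * δ ^ 2 * ((k : ℝ) + 1 + 1) ^ 2 * cosTorus ((k + 1 + 1) • y)
        * decay (resolventModes H (k + 1 + 1)) s) * hδ

end Branch

/-! ### Solutions of the rescaled equation -/

lemma eval_solitonMode (s : ℝ) (y : Torus) :
    Modes.eval s y solitonMode = Real.sqrt 2 * sech s := by
  rw [solitonMode, Modes.eval_single, decay_smul, decay_sechPow, zero_smul, cosTorus_zero]; ring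

lemma eval_kernelMode (s : ℝ) (y : Torus) :
    Modes.eval s y kernelMode = sech s ^ 2 * cosTorus y := by
  rw [kernelMode, Modes.eval_single, decay_sechPow, one_smul]

lemma kernelCoeff_source :
    kernelCoeff (Bifurcation.source Modes.mul solitonMode kernelMode) = 0 := by
  rw [source_eq, map_add, kernelCoeff_single_ne (by norm_num), kernelCoeff_single_ne (by norm_num),
    add_zero]

/-- The branch of solutions of the rescaled equation, parametrized by `δ`. -/
theorem exists_modes_branch (r₀ : ℝ) (hr : r₀ ^ 2 * (3 / 32 * reducedCubic) = -1) :
    ∃ δ₀ > 0, ∃ C > 0, ∀ δ : ℝ, |δ| < δ₀ → ∃ r H, |r - r₀| ≤ C * |δ| ∧ ‖H‖ ≤ C ∧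
      kernelCoeff H = 0 ∧ ∀ s y, δ ^ 2 * Modes.eval s y H
      = δ ^ 2 * (δ * r * (sech s ^ 2 * cosTorus y)
          + δ ^ 2 * Modes.eval s y (resolventModesYY H))
        + 3 * (Real.sqrt 2 * sech s) * (δ * r * (sech s ^ 2 * cosTorus y)
          + δ ^ 2 * Modes.eval s y (resolventModes H)) ^ 2
        + (δ * r * (sech s ^ 2 * cosTorus y)
          + δ ^ 2 * Modes.eval s y (resolventModes H)) ^ 3 := by
  obtain ⟨δ₀, hδ₀, C, hC, h⟩ := Bifurcation.exists_branch Modes.mul resolventModes resolventModesYY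
    solitonMode kernelMode kernelCoeff r₀ kernelCoeff_kernelMode (by rw [kernelCoeff_cubic, hr])
  set N := ‖Bifurcation.source Modes.mul solitonMode kernelMode‖ with hN
  refine ⟨min δ₀ 1, lt_min hδ₀ one_pos, C + ((|r₀| + C) ^ 2 * N + C), by positivity,
    fun δ hδ => ?_⟩
  have hδ1 : |δ| ≤ 1 := (hδ.trans_le (min_le_right _ _)).le
  obtain ⟨r, K, h1, h2, h3, h4⟩ := h δ (hδ.trans_le (min_le_left _ _))
  have hK : 0 ≤ (|r₀| + C) ^ 2 * N + C := by positivity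
  refine ⟨r, r ^ 2 • Bifurcation.source Modes.mul solitonMode kernelMode + δ • K,
    h1.trans (by gcongr; linarith), ?_, ?_, fun s y => ?_⟩
  · have hr' : |r| ≤ |r₀| + C := by
      have := abs_add_le r₀ (r - r₀)
      rw [add_sub_cancel] at this
      nlinarith
    calc _ ≤ ‖r ^ 2 • Bifurcation.source Modes.mul solitonMode kernelMode‖ + ‖δ • K‖ :=
          norm_add_le _ _
      _ = |r| ^ 2 * N + |δ| * ‖K‖ := by
          rw [norm_smul, norm_smul, Real.norm_eq_abs, Real.norm_eq_abs, abs_pow]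
      _ ≤ (|r₀| + C) ^ 2 * N + 1 * C := by gcongr
      _ ≤ _ := by linarith
  · rw [map_add, map_smul, map_smul, kernelCoeff_source, h4, smul_zero, smul_zero, add_zero]
  · set H := r ^ 2 • Bifurcation.source Modes.mul solitonMode kernelMode + δ • K with hH
    have e1 : Modes.eval s y H = r ^ 2 * (3 * ((Real.sqrt 2 * sech s) *
        ((sech s ^ 2 * cosTorus y) * (sech s ^ 2 * cosTorus y)))) + δ * Modes.eval s y K := by
      simp only [hH, map_add, map_smul, smul_eq_mul, Bifurcation.source, Modes.eval_mul,
        eval_solitonMode, eval_kernelMode]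
    have e2 := congrArg (Modes.eval s y) h3
    simp only [Bifurcation.rescaled, ← hH] at e2
    simp only [map_add (Modes.eval s y), map_smul (Modes.eval s y), smul_eq_mul, Modes.eval_mul,
      eval_solitonMode, eval_kernelMode] at e2
    rw [e1]
    linear_combination δ ^ 3 * e2

/-! ### Correctors and the coefficients of the normal form -/

/-- The critical wave number `√c_*`. -/
def kappaStar : ℝ := Real.sqrt cStar

lemma kappaStar_pos : 0 < kappaStar := Real.sqrt_pos.2 (by norm_num [cStar])

lemma kappaStar_sq : kappaStar ^ 2 = 1 / 3 := by
  rw [kappaStar, Real.sq_sqrt (by norm_num [cStar]), cStar]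

lemma half_le_kappaStar : 1 / 2 ≤ kappaStar := by
  nlinarith [kappaStar_sq, kappaStar_pos]

lemma kappaStar_le_one : kappaStar ≤ 1 := by
  nlinarith [kappaStar_sq, kappaStar_pos]

lemma lineSoliton_eq {c : ℝ} (hc : 0 ≤ c) (ξ : ℝ) :
    lineSoliton c ξ = Real.sqrt c * Real.sqrt 2 * sech (Real.sqrt c * ξ) := by
  rw [lineSoliton, mul_comm 2 c, Real.sqrt_mul hc, sech, div_eq_mul_inv]

lemma lineSoliton_cStar (ξ : ℝ) :
    lineSoliton cStar ξ = kappaStar * Real.sqrt 2 * sech (kappaStar * ξ) :=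
  lineSoliton_eq (by norm_num [cStar]) ξ

lemma psiStar_eq (ξ : ℝ) : psiStar ξ = 2 / 3 * sech (kappaStar * ξ) ^ 2 := by
  rw [psiStar, sech, inv_pow, div_eq_mul_inv, cStar, kappaStar, cStar]; ring

lemma alphaCoeff_eq : alphaCoeff = 8 * kappaStar ^ 3 := by
  have h : (0:ℝ) ≤ cStar := by norm_num [cStar]
  rw [alphaCoeff, kappaStar, Real.sqrt_eq_rpow, ← Real.rpow_natCast, ← Real.rpow_mul h]
  norm_num

/-- A function and its classical derivative form a weak derivative pair. -/
lemma isWeakDerivLine_of_hasDerivAt {w g : ℝ → ℝ} (h : ∀ x, HasDerivAt w (g x) x)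
    (hg : Continuous g) : IsWeakDerivLine w g := by
  intro φ hφ hc
  have hφ' : ∀ x, HasDerivAt φ (deriv φ x) x := fun x =>
    (hφ.differentiable (by simp)).differentiableAt.hasDerivAt
  have hcd : Continuous (deriv φ) := hφ.continuous_deriv (by simp)
  have hw := continuous_of_hasDerivAt h
  exact integral_mul_deriv_eq_deriv_mul_of_integrable (fun x _ => h x) (fun x _ => hφ' x)
    ((hw.mul hcd).integrable_of_hasCompactSupport hc.deriv.mul_left)
    ((hg.mul hφ.continuous).integrable_of_hasCompactSupport hc.mul_left)
    ((hw.mul hφ.continuous).integrable_of_hasCompactSupport hc.mul_left)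

lemma memLp_comp_kappaStar {f : ℝ → ℝ} (hf : Continuous f) {C : ℝ}
    (h : ∀ s, |f s| ≤ C * weight s) (a : ℝ) : MemLp (fun ξ => a * f (kappaStar * ξ)) 2 := by
  have hi : Integrable fun s => f s * f s :=
    integrable_of_abs_le_weight (hf.mul hf) (abs_mul_le_weight h (abs_le_of_le_weight h))
  have hc : Continuous fun ξ => f (kappaStar * ξ) := hf.comp (continuous_const.mul continuous_id)
  refine MemLp.const_mul ((memLp_two_iff_integrable_sq hc.aestronglyMeasurable).2 ?_) a
  simpa only [sq] using hi.comp_mul_left' kappaStar_pos.ne'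

/-- The solution of `(L_{c_*} + k²) w = (3/2) u_{c_*} ψ_*²`. -/
def criticalCorrector (k : ℕ) (ξ : ℝ) : ℝ :=
  6 * Real.sqrt 2 * kappaStar ^ 3 * corrector k (kappaStar * ξ)

lemma criticalCorrector_even (k : ℕ) (ξ : ℝ) :
    criticalCorrector k (-ξ) = criticalCorrector k ξ := by
  rw [criticalCorrector, mul_neg, corrector_even, criticalCorrector]

lemma solvesCorrector_criticalCorrector {k : ℕ} (hk : k ≠ 1) :
    SolvesCorrector ((k : ℝ) ^ 2) (criticalCorrector k) := by
  obtain ⟨dz, h1, h2, C, hC⟩ := exists_corrector_deriv hk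
  obtain ⟨D, hD⟩ := exists_abs_corrector_le k
  set a := 6 * Real.sqrt 2 * kappaStar ^ 3 with ha
  set ddz : ℝ → ℝ := fun s => (1 + 3 * (k : ℝ) ^ 2 - 6 * sech s ^ 2) * corrector k s - sech s ^ 5
    with hddz
  have hcdz : Continuous dz := continuous_of_hasDerivAt h2
  have hcddz : Continuous ddz := ((continuous_const.sub (continuous_const.mul
    (continuous_sech.pow 2))).mul (continuous_corrector k)).sub (continuous_sech.pow 5)
  have hlin : ∀ ξ, HasDerivAt (fun ξ => kappaStar * ξ) kappaStar ξ := fun ξ => by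
    simpa using (hasDerivAt_id ξ).const_mul kappaStar
  have d1 : ∀ ξ, HasDerivAt (criticalCorrector k) ((a * kappaStar) * dz (kappaStar * ξ)) ξ :=
    fun ξ => by
      convert! ((h1 _).comp ξ (hlin ξ)).const_mul a using 1; ring
  have d2 : ∀ ξ, HasDerivAt (fun ξ => (a * kappaStar) * dz (kappaStar * ξ))
      ((a * kappaStar ^ 2) * ddz (kappaStar * ξ)) ξ := fun ξ => by
    convert! ((h2 _).comp ξ (hlin ξ)).const_mul (a * kappaStar) using 1; ring
  have hbdd : ∀ s, |ddz s| ≤ (D * (1 + 3 * (k : ℝ) ^ 2 + 6) + 2) * weight s := fun s => by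
    have e1 : |corrector k s * (1 + 3 * (k : ℝ) ^ 2 - 6 * sech s ^ 2)|
        ≤ (D * (1 + 3 * (k : ℝ) ^ 2 + 6)) * weight s :=
      abs_mul_le_weight (g := fun s => 1 + 3 * (k : ℝ) ^ 2 - 6 * sech s ^ 2) hD (fun s => by
        have h3 : sech s ^ 2 ≤ 1 := pow_le_one₀ (sech_pos s).le (sech_le_one s)
        rw [abs_le]; constructor <;> nlinarith [sq_nonneg (sech s), sq_nonneg (k : ℝ)]) s
    have e2 : |sech s ^ 5| ≤ 2 * weight s := by
      rw [abs_of_pos (pow_pos (sech_pos s) 5)]; exact sech_pow_le_weight 4 s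
    calc |ddz s| ≤ |corrector k s * (1 + 3 * (k : ℝ) ^ 2 - 6 * sech s ^ 2)| + |sech s ^ 5| := by
          rw [mul_comm]; exact norm_sub_le _ (sech s ^ 5)
      _ ≤ _ := by linarith
  have hlc : Continuous fun ξ : ℝ => kappaStar * ξ := continuous_const.mul continuous_id
  refine ⟨⟨fun ξ => (a * kappaStar) * dz (kappaStar * ξ),
    fun ξ => (a * kappaStar ^ 2) * ddz (kappaStar * ξ),
    memLp_comp_kappaStar (continuous_corrector k) hD a, memLp_comp_kappaStar hcdz hC _,
    memLp_comp_kappaStar hcddz hbdd _,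
    isWeakDerivLine_of_hasDerivAt d1 (continuous_const.mul (hcdz.comp hlc)),
    isWeakDerivLine_of_hasDerivAt d2 (continuous_const.mul (hcddz.comp hlc))⟩,
    Eventually.of_forall fun ξ => ?_⟩
  have h22 : Real.sqrt 2 ^ 2 = 2 := Real.sq_sqrt (by norm_num)
  have hs := kappaStar_sq
  have hcs : cStar = kappaStar ^ 2 := by rw [hs, cStar]
  simp only [hddz, criticalCorrector, ← ha, psiStar_eq, lineSoliton_cStar]
  rw [hcs]
  set S := sech (kappaStar * ξ)
  set z := corrector k (kappaStar * ξ)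
  have e3 : a * kappaStar ^ 2 = 2 / 3 * Real.sqrt 2 * kappaStar := by
    rw [ha]; linear_combination (6 * Real.sqrt 2 * kappaStar * (kappaStar ^ 2 + 1 / 3)) * hs
  linear_combination (-3 * a * (k : ℝ) ^ 2 * z) * hs + S ^ 5 * e3
    - 3 * kappaStar ^ 2 * S ^ 2 * a * z * h22

lemma betaCoeff_eq :
    betaCoeff (criticalCorrector 0) (criticalCorrector 2) = kappaStar ^ 7 * reducedCubic := by
  have hs := kappaStar_sq
  have h22 : Real.sqrt 2 ^ 2 = 2 := Real.sq_sqrt (by norm_num)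
  have hinv : |kappaStar⁻¹| = 3 * kappaStar := by
    rw [abs_of_pos (inv_pos.2 kappaStar_pos), inv_eq_of_mul_eq_one_right]
    linear_combination 3 * hs
  have e1 : ∀ ξ, psiStar ξ ^ 2 * lineSoliton cStar ξ *
      (2 * criticalCorrector 0 ξ + criticalCorrector 2 ξ)
      = 16 / 3 * kappaStar ^ 4 * (fun s => sech s ^ 5 * (2 * corrector 0 s + corrector 2 s))
        (kappaStar * ξ) := fun ξ => by
    simp only [criticalCorrector, psiStar_eq, lineSoliton_cStar]
    linear_combination (8 / 3 * kappaStar ^ 4 * sech (kappaStar * ξ) ^ 5 *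
      (2 * corrector 0 (kappaStar * ξ) + corrector 2 (kappaStar * ξ))) * h22
  have e2 : ∀ ξ, psiStar ξ ^ 4 = 16 / 81 * (fun s => sech s ^ 8) (kappaStar * ξ) := fun ξ => by
    simp only [psiStar_eq]; ring
  rw [betaCoeff, integral_congr_ae (Eventually.of_forall e1),
    integral_congr_ae (Eventually.of_forall e2), integral_const_mul, integral_const_mul,
    Measure.integral_comp_mul_left (fun s => sech s ^ 5 * (2 * corrector 0 s + corrector 2 s)),
    Measure.integral_comp_mul_left (fun s => sech s ^ 8), integral_sech_pow_eight, hinv,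
    smul_eq_mul, smul_eq_mul, reducedCubic]
  set I := ∫ s, sech s ^ 5 * (2 * corrector 0 s + corrector 2 s)
  linear_combination (-72 * I * kappaStar ^ 5 - 192 / 35 * kappaStar *
    (kappaStar ^ 4 + 1 / 3 * kappaStar ^ 2 + 1 / 9)) * hs

lemma betaCoeff_neg : betaCoeff (criticalCorrector 0) (criticalCorrector 2) < 0 := by
  rw [betaCoeff_eq]
  exact mul_neg_of_pos_of_neg (pow_pos kappaStar_pos 7) reducedCubic_neg

/-! ### The bifurcating solutions -/

lemma wave_number_bounds {κ δ : ℝ} (hκ : 0 < κ) (hδ1 : |δ| ≤ 1) (hδ : κ ^ 2 * (3 - δ ^ 2) = 1) :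
    1 / 2 ≤ κ ∧ κ ≤ 1 ∧ |κ - kappaStar| ≤ δ ^ 2 := by
  have h1 : δ ^ 2 ≤ 1 := (sq_le_one_iff_abs_le_one δ).2 hδ1
  have h2 := kappaStar_sq
  have h3 := half_le_kappaStar
  have h4 : 1 / 2 ≤ κ := by nlinarith [sq_nonneg (κ * δ)]
  have h5 : κ ≤ 1 := by nlinarith [sq_nonneg κ]
  refine ⟨h4, h5, ?_⟩
  have h6 : (κ - kappaStar) * (κ + kappaStar) = κ ^ 2 * δ ^ 2 / 3 := by
    linear_combination hδ / 3 - h2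
  have h7 : κ ^ 2 * δ ^ 2 ≤ 1 * δ ^ 2 := by gcongr; exact pow_le_one₀ hκ.le h5
  rw [abs_le]; constructor <;> nlinarith [sq_nonneg (κ * δ)]

/-- The line solitons belong to the family `branchFun`. -/
lemma lineSoliton_solution {κ δ : ℝ} (hκ : 0 < κ) (hδ1 : |δ| ≤ 1)
    (hδ : κ ^ 2 * (3 - δ ^ 2) = 1) :
    MemH2Even (fun p => lineSoliton (κ ^ 2) p.1)
      ∧ SolvesTW (κ ^ 2) (fun p => lineSoliton (κ ^ 2) p.1) := by
  obtain ⟨h1, h2, -⟩ := wave_number_bounds hκ hδ1 hδ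
  have h := solvesTW_branchFun (r := 0) (H := 0) h1 h2 hδ (map_zero _) (by simp)
  have e : branchFun κ δ 0 0 = fun p => lineSoliton (κ ^ 2) p.1 := by
    funext p
    rw [branchFun, lineSoliton_eq (sq_nonneg κ), Real.sqrt_sq hκ.le]
    simp
  rw [e] at h
  exact ⟨h.1, h.2.1⟩

/-- A continuous function that takes different values at `(0, 0)` and `(0, π)` depends on `y`. -/
lemma not_ae_eq_of_ne {u : Cylinder → ℝ} (hu : Continuous u)
    (h : u (0, 0) ≠ u (0, (Real.pi : ℝ))) {f : ℝ → ℝ} (hf : Continuous f) :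
    ¬ (u =ᵐ[volume] fun p => f p.1) := fun hae => by
  have e := (hu.ae_eq_iff_eq volume (hf.comp continuous_fst)).1 hae
  exact h (by rw [e]; rfl)

lemma branchFun_ne {κ δ r : ℝ} {H : Modes} (hκ : κ ≠ 0) (hδ : δ ≠ 0)
    (hr : |δ| * (‖resolventModes‖ * ‖H‖) < |r|) :
    branchFun κ δ r H (0, 0) ≠ branchFun κ δ r H (0, (Real.pi : ℝ)) := by
  intro h
  simp only [branchFun, mul_zero, sech_zero, cosTorus_zero, cosTorus_coe, Real.cos_pi] at h
  set a := Modes.eval 0 0 (resolventModes H) with ha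
  set b := Modes.eval 0 (Real.pi : ℝ) (resolventModes H) with hb
  have hbd : ∀ y, |Modes.eval 0 y (resolventModes H)| ≤ ‖resolventModes‖ * ‖H‖ := fun y =>
    calc _ ≤ weight 0 * ‖resolventModes H‖ := Modes.abs_eval_le 0 y _
      _ ≤ 1 * (‖resolventModes‖ * ‖H‖) := by
          gcongr
          · exact weight_le_one 0
          · exact resolventModes.le_opNorm H
      _ = _ := one_mul _
  have e : κ * δ * (2 * r + δ * (a - b)) = 0 := by linear_combination h
  have e2 : 2 * r = δ * (b - a) := by
    have := (mul_eq_zero.1 e).resolve_left (mul_ne_zero hκ hδ)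
    linear_combination this
  have e3 : 2 * |r| = |δ| * |b - a| := by
    rw [← abs_mul, ← e2, abs_mul, abs_two]
  have e4 : |b - a| ≤ 2 * (‖resolventModes‖ * ‖H‖) := by
    have h1 := abs_le.1 (hbd 0)
    have h2 := abs_le.1 (hbd (Real.pi : ℝ))
    rw [abs_le]; constructor <;> linarith
  nlinarith [mul_le_mul_of_nonneg_left e4 (abs_nonneg δ)]

/-- The branch of solutions bifurcating from the critical soliton, parametrized by `δ` with
`c = κ² = 1/(3 - δ²)`. -/
theorem exists_bifurcating_solutions {r₀ : ℝ} (hr₀ : 0 < r₀)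
    (hr : r₀ ^ 2 * (3 / 32 * reducedCubic) = -1) :
    ∃ δ₁ > 0, δ₁ ≤ 1 ∧ ∃ C ≥ 0, ∀ κ δ : ℝ, 0 < κ → δ ≠ 0 → |δ| < δ₁ → κ ^ 2 * (3 - δ ^ 2) = 1 →
      ∃ u uTilde : Cylinder → ℝ, MemH2Even u ∧ SolvesTW (κ ^ 2) u ∧
        (∀ f : ℝ → ℝ, Continuous f → ¬ (u =ᵐ[volume] fun p => f p.1)) ∧
        MemH2Even uTilde ∧
        (u = fun p => lineSoliton cStar p.1
          + 3 / 2 * κ * δ * r₀ * cosTorus p.2 * psiStar p.1 + uTilde p) ∧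
        h2Norm uTilde ≤ ENNReal.ofReal (C * δ ^ 2) := by
  obtain ⟨δ₀, hδ₀, R, hR, hbranch⟩ := exists_modes_branch r₀ hr
  set L := ‖resolventModes‖ with hL
  have hL0 : 0 ≤ L := norm_nonneg resolventModes
  have hW : 0 ≤ slowWeightNorm := ENNReal.toReal_nonneg
  -- The last bound on `δ` keeps the term in `cos y` dominant, so that the solution depends on `y`.
  refine ⟨min (min δ₀ 1) (r₀ / (R + L * R)), lt_min (lt_min hδ₀ one_pos) (by positivity),
    (min_le_left _ _).trans (min_le_right _ _),
    3 * ((1500 * R + 24 * 32 * 4 + 24 * 32 * (R + r₀)) * slowWeightNorm), by positivity,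
    fun κ δ hκ hδ0 hδlt hδ => ?_⟩
  obtain ⟨r, H, hrr, hHR, hker, hH⟩ :=
    hbranch δ (hδlt.trans_le ((min_le_left _ _).trans (min_le_left _ _)))
  have hδ1 : |δ| ≤ 1 := (hδlt.trans_le ((min_le_left _ _).trans (min_le_right _ _))).le
  have hδr : |δ| * (R + L * R) < r₀ :=
    (lt_div_iff₀ (by positivity)).1 (hδlt.trans_le (min_le_right _ _))
  obtain ⟨hκ2, hκ1, hκκ⟩ := wave_number_bounds hκ hδ1 hδ
  obtain ⟨hE, hTW, hcont⟩ := solvesTW_branchFun hκ2 hκ1 hδ hker hH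
  obtain ⟨v', hv⟩ := exists_coeffBound₂_branch H hker hκ2 hκ1 half_le_kappaStar kappaStar_le_one
    (κ * δ ^ 2) (κ * Real.sqrt 2) (kappaStar * Real.sqrt 2) (κ * δ * r) (κ * δ * r₀)
  have hne : |δ| * (‖resolventModes‖ * ‖H‖) < |r| := by
    have h1 : |δ| * (L * ‖H‖) ≤ |δ| * (L * R) := by gcongr
    have h2 := abs_le.1 hrr
    have h3 := le_abs_self r
    linarith
  refine ⟨branchFun κ δ r H, _, hE, hTW,
    fun f hf => not_ae_eq_of_ne hcont (branchFun_ne hκ.ne' hδ0 hne) hf,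
    hv.memH2Even fun k s => branchCoeff_even _ _ _ _ _ _ _ _ _ _, ?_,
    hv.h2Norm_le.trans (ENNReal.ofReal_le_ofReal ?_)⟩
  · funext p
    rw [trigSeries_branchCoeff, branchFun, lineSoliton_cStar, psiStar_eq]; ring
  · rw [tsum_branchBound]
    have hs0 : 0 ≤ Real.sqrt 2 := Real.sqrt_nonneg 2
    have hs : Real.sqrt 2 ≤ 2 := Real.sqrt_le_left (by norm_num) |>.2 (by norm_num)
    have b1 : |κ * δ ^ 2| * (1500 * ‖H‖) ≤ δ ^ 2 * (1500 * R) := by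
      rw [abs_of_nonneg (by positivity)]
      gcongr
      exact mul_le_of_le_one_left (sq_nonneg δ) hκ1
    have b2 : |κ * Real.sqrt 2 - kappaStar * Real.sqrt 2| ≤ δ ^ 2 * 2 := by
      rw [← sub_mul, abs_mul, abs_of_nonneg hs0]; gcongr
    have b3 : |kappaStar * Real.sqrt 2| * |κ - kappaStar| ≤ 2 * δ ^ 2 := by
      rw [abs_of_nonneg (by have := kappaStar_pos; positivity)]
      gcongr
      calc kappaStar * Real.sqrt 2 ≤ 1 * 2 := by gcongr; exact kappaStar_le_one
        _ = 2 := by norm_num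
    have hκδ : |κ * δ| ≤ |δ| := by
      rw [abs_mul, abs_of_pos hκ]; exact mul_le_of_le_one_left (abs_nonneg δ) hκ1
    have b4 : |κ * δ * r - κ * δ * r₀| ≤ R * δ ^ 2 := by
      rw [← mul_sub, abs_mul, ← sq_abs δ]
      calc _ ≤ |δ| * (R * |δ|) := by gcongr
        _ = _ := by ring
    have b5 : |κ * δ * r₀| * |κ - kappaStar| ≤ r₀ * δ ^ 2 := by
      rw [abs_mul, abs_of_pos hr₀]
      gcongr
      exact mul_le_of_le_one_left hr₀.le (hκδ.trans hδ1)
    have hsum : |κ * δ ^ 2| * (1500 * ‖H‖)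
        + 24 * 32 * (|κ * Real.sqrt 2 - kappaStar * Real.sqrt 2|
          + |kappaStar * Real.sqrt 2| * |κ - kappaStar|)
        + 24 * 32 * (|κ * δ * r - κ * δ * r₀| + |κ * δ * r₀| * |κ - kappaStar|)
        ≤ (1500 * R + 24 * 32 * 4 + 24 * 32 * (R + r₀)) * δ ^ 2 := by linarith
    calc _ ≤ 3 * ((1500 * R + 24 * 32 * 4 + 24 * 32 * (R + r₀)) * δ ^ 2 * slowWeightNorm) := by
          gcongr
      _ = _ := by ring

end

theorem mainTheorem2 :
    0 < alphaCoeff ∧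
    ∃ w₀ w₂ : ℝ → ℝ,
      SolvesCorrector 0 w₀ ∧ (∀ᵐ ξ : ℝ, w₀ (-ξ) = w₀ ξ) ∧
      SolvesCorrector 4 w₂ ∧
      betaCoeff w₀ w₂ < 0 ∧
      ∃ cPlus : ℝ, cStar < cPlus ∧ ∃ A : ℝ, 0 < A ∧
        ∀ c : ℝ, cStar < c → c < cPlus →
          (MemH2Even (fun p => lineSoliton c p.1) ∧ SolvesTW c (fun p => lineSoliton c p.1)) ∧
          (∃ b : ℝ, b ≠ 0 ∧ alphaCoeff * (c - cStar) * b + betaCoeff w₀ w₂ * b ^ 3 = 0) ∧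
          ∀ b : ℝ, b ≠ 0 → alphaCoeff * (c - cStar) * b + betaCoeff w₀ w₂ * b ^ 3 = 0 →
            ∃ u uTilde : Cylinder → ℝ,
              MemH2Even u ∧ SolvesTW c u ∧
              ¬ (u =ᵐ[volume] fun _ => 0) ∧
              ¬ (u =ᵐ[volume] fun p => lineSoliton c p.1) ∧
              MemH2Even uTilde ∧
              (u =ᵐ[volume] fun p =>
                lineSoliton cStar p.1 + b * cosTorus p.2 * psiStar p.1 + uTilde p) ∧
              h2Norm uTilde ≤ ENNReal.ofReal (A * b ^ 2) := by
  have hneg := reducedCubic_neg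
  set r₀ := Real.sqrt (-32 / (3 * reducedCubic)) with hr₀def
  have hpos : 0 < -32 / (3 * reducedCubic) := div_pos_of_neg_of_neg (by norm_num) (by linarith)
  have hr₀ : 0 < r₀ := Real.sqrt_pos.2 hpos
  have hr : r₀ ^ 2 * (3 / 32 * reducedCubic) = -1 := by
    have hne := hneg.ne
    rw [hr₀def, Real.sq_sqrt hpos.le]; field_simp
  obtain ⟨δ₁, hδ₁, hδ₁1, C, hC, hsol⟩ := exists_bifurcating_solutions hr₀ hr
  have hs := kappaStar_sq
  have hk := kappaStar_pos
  have hα : 0 < alphaCoeff := by rw [alphaCoeff_eq]; positivity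
  have hw0 := solvesCorrector_criticalCorrector (k := 0) (by norm_num)
  have hw2 := solvesCorrector_criticalCorrector (k := 2) (by norm_num)
  norm_num at hw0 hw2
  refine ⟨hα, criticalCorrector 0, criticalCorrector 2, hw0,
    Eventually.of_forall (criticalCorrector_even 0), hw2, betaCoeff_neg,
    1 / 3 + δ₁ ^ 2 / 9, by rw [cStar]; linarith [pow_pos hδ₁ 2], C * (4 / (3 * r₀ ^ 2)) + 1,
    by positivity, fun c hc hc' => ?_⟩
  rw [cStar] at hc
  have hc0 : 0 < c := by linarith
  set κ := Real.sqrt c with hκdef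
  have hκ : 0 < κ := Real.sqrt_pos.2 hc0
  have hκc : κ ^ 2 = c := Real.sq_sqrt hc0.le
  -- The speed `c` belongs to the parameters with `δ² = 3 - 1/c`, that is `κ² (3 - δ²) = 1`.
  have hlt : ∀ δ : ℝ, κ ^ 2 * (3 - δ ^ 2) = 1 → |δ| < δ₁ := fun δ hδ => by
    refine abs_lt_of_sq_lt_sq ?_ hδ₁.le
    rw [hκc] at hδ
    nlinarith [sq_nonneg δ]
  have hroot : ∀ b : ℝ, b ≠ 0 → (alphaCoeff * (c - cStar) * b
      + betaCoeff (criticalCorrector 0) (criticalCorrector 2) * b ^ 3 = 0 ↔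
      72 * (c - 1 / 3) + reducedCubic * b ^ 2 = 0) := fun b hb => by
    have e : alphaCoeff * (c - cStar) * b
        + betaCoeff (criticalCorrector 0) (criticalCorrector 2) * b ^ 3
        = kappaStar ^ 3 * b / 9 * (72 * (c - 1 / 3) + reducedCubic * b ^ 2) := by
      rw [alphaCoeff_eq, betaCoeff_eq, cStar]
      linear_combination (kappaStar ^ 3 * reducedCubic * b ^ 3 * (kappaStar ^ 2 + 1 / 3)) * hs
    rw [e, mul_eq_zero, or_iff_right]
    positivity
  refine ⟨?_, ?_, fun b hb hroot_b => ?_⟩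
  · have h0 : 0 ≤ 3 - 1 / c := by rw [sub_nonneg, div_le_iff₀ hc0]; linarith
    have h1 : κ ^ 2 * (3 - Real.sqrt (3 - 1 / c) ^ 2) = 1 := by
      rw [Real.sq_sqrt h0, hκc]; field_simp; ring
    have h := lineSoliton_solution hκ ((hlt _ h1).le.trans hδ₁1) h1
    rwa [hκc] at h
  · have h0 : 0 < 72 * (c - 1 / 3) / -reducedCubic := div_pos (by linarith) (by linarith)
    have hb : Real.sqrt (72 * (c - 1 / 3) / -reducedCubic) ≠ 0 := (Real.sqrt_pos.2 h0).ne'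
    refine ⟨_, hb, (hroot _ hb).2 ?_⟩
    rw [Real.sq_sqrt h0.le]
    have := hneg.ne
    field_simp
    ring
  · have e1 := (hroot b hb).1 hroot_b
    have e2 : 4 * b ^ 2 = 27 * r₀ ^ 2 * (c - 1 / 3) := by
      linear_combination (-3 / 8 * r₀ ^ 2) * e1 + 4 * b ^ 2 * hr
    -- The root `b` selects the parameter `δ`, signed like `b`, for which `(3/2) κ δ r₀ = b`.
    have hb2 : 3 / 2 * κ * (2 * b / (3 * κ * r₀)) * r₀ = b := by field_simp
    set δ := 2 * b / (3 * κ * r₀) with hδdef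
    have hδ0 : δ ≠ 0 := by rw [hδdef]; positivity
    have hδ : κ ^ 2 * (3 - δ ^ 2) = 1 := by
      have h9 : 9 * r₀ ^ 2 * (κ ^ 2 * (3 - δ ^ 2) - 1) = 0 := by
        rw [← hb2] at e2
        linear_combination -e2 + (27 * r₀ ^ 2) * hκc
      have := (mul_eq_zero.1 h9).resolve_left (by positivity)
      linarith
    obtain ⟨u, ut, h1, h2, h3, h4, h5, h6⟩ := hsol κ δ hκ hδ0 (hlt δ hδ) hδ
    rw [hκc] at h2
    rw [hb2] at h5
    have hcl : Continuous (lineSoliton c) := by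
      have : lineSoliton c = fun ξ => κ * Real.sqrt 2 * sech (κ * ξ) :=
        funext (lineSoliton_eq hc0.le)
      rw [this]
      exact continuous_const.mul (continuous_sech.comp (continuous_const.mul continuous_id))
    refine ⟨u, ut, h1, h2, h3 _ continuous_const, h3 _ hcl, h4, Eventually.of_forall (congrFun h5),
      h6.trans (ENNReal.ofReal_le_ofReal ?_)⟩
    have h7 : δ ^ 2 ≤ 4 / (3 * r₀ ^ 2) * b ^ 2 := by
      rw [div_mul_eq_mul_div, le_div_iff₀ (by positivity)]
      have h8 : 4 * b ^ 2 = 9 * κ ^ 2 * δ ^ 2 * r₀ ^ 2 := by rw [← hb2]; ring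
      rw [h8, hκc]
      nlinarith [mul_nonneg (sq_nonneg δ) (sq_nonneg r₀)]
    calc C * δ ^ 2 ≤ C * (4 / (3 * r₀ ^ 2) * b ^ 2) := by gcongr
      _ ≤ (C * (4 / (3 * r₀ ^ 2)) + 1) * b ^ 2 := by nlinarith [sq_nonneg b]
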